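/- **Setting.** A semiring here is a naturally ordered commutative semiring $(D,\oplus,\otimes,\mathbf 0,\mathbf 1)$ (the relation $a\sqsubseteq b :\iff \exists c\; a\oplus c=b$ is antisymmetric) that is $\omega$-complete (every $\omega$-chain has a supremum) and $\omega$-continuous ($\oplus$ and $\otimes$ preserve suprema of $\omega$-chains). A Datalog program $P$ has finitely many EDB predicates and IDB predicates of fixed arities, and a designated target IDB. Each IDB $T$ has one rule $T(\mathbf x_H)\leftarrow \varphi_1(\mathbf x_H)\oplus\varphi_2(\mathbf x_H)\oplus\cdots$, where each $\varphi$ is a sum-product query $$\varphi(\mathbf x_H)=\bigoplus_{\mathbf x_{[\ell]\setminus H}}\ \bigotimes_{j} T_j(\mathbf x_{J_j}),$$ over finitely many EDB or IDB atoms, with $H\subseteq[\ell]$. Variables range over the active domain. The program is *linear* if each of its sum-product queries contains at most one IDB atom. It is *rulewise-acyclic* if for each of its sum-product queries the hypergraph $([\ell],\{J_j\}_j)$ has a join tree, i.e. a tree with bags $\chi(t)\subseteq[\ell]$ such that each bag is a hyperedge, each hyperedge is contained in some bag, and for every $i\in[\ell]$ the nodes $t$ with $i\in\chi(t)$ form a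 non-empty connected subtree. The *arity* of $P$ is the maximum arity of an IDB. An input instance is a finite set of tuples for each EDB predicate; $m$ is the total number of these tuples and $n$ is the number of distinct constants that occur in them. It is annotated over a semiring $\sigma$ by giving each stored tuple an element of $\sigma$; all other tuples have annotation $\mathbf 0$. A *grounding* $G$ is a finite list of variable-free rules whose heads are ground IDB atoms (over the IDBs of $P$ and possibly new predicate symbols) and whose bodies are products of ground EDB atoms (coefficients) and ground IDB atoms (variables). It stands for the system of polynomial equations in which each ground IDB atom equals the $\oplus$-sum of the bodies of the rules with that head. Its size $|G|$ is the total number of occurrences of coefficients and variables, rule heads included. $G$ is *$\sigma$-equivalent* to $P$ on the instance if, for every annotation of the instance over $\sigma$, the least fixpoints of $P$ and of $G$ exist and agree on the target. The computational model is the unit-cost word-RAM with words of $O(\log m)$ bits (for definiteness $k\lceil\log_2(m+2)\rceil$ bits for a constant $k$). The input tuples, without annotations, are given in memory as words, and the rules of $G$ are written to the output one word at a time. The program $P$ is fixed (data complexity). **Proposition.** Let $P$ be a linear rulewise-acyclic Datalog program of arity at most $2$; the EDB predicates may have any arities. Let $\kappa\in\mathbb N$. Then there are a word-RAM program and constants $k\ge\kappa$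 and $C$, depending only on $P$ and $\kappa$, such that the following holds. On every input instance whose constants are natural numbers of at most $\kappa\lceil\log_2(m+2)\rceil$ bits, the word-RAM program, run with words of $k\lceil\log_2(m+2)\rceil$ bits, halts after at most $C\,(m n+1)$ steps and outputs a grounding $G$ of size $|G|\le C\,(m n+1)$, such that $G$ is $\sigma$-equivalent to $P$ on this instance for every semiring $\sigma$ as above. Hence for $n\ge 1$ both the time and the size are $O(m\cdot n)$. -/

import Mathlib

open scoped BigOperators

namespace DatalogGrounding

/-! ### Semirings -/

/-- A naturally ordered commutative semiring (`a ≤ b ↔ ∃ c, b = a + c`, and this relation is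
antisymmetric) that is ω-complete and ω-continuous. -/
class OmegaContinuousSemiring (D : Type*) [CommSemiring D] [PartialOrder D] : Prop
    extends CanonicallyOrderedAdd D where
  omega_complete : ∀ c : ℕ → D, Monotone c → ∃ s, IsLUB (Set.range c) s
  add_continuous : ∀ (a : D) (c : ℕ → D) (s : D), Monotone c → IsLUB (Set.range c) s →
    IsLUB (Set.range fun i => a + c i) (a + s)
  mul_continuous : ∀ (a : D) (c : ℕ → D) (s : D), Monotone c → IsLUB (Set.range c) s →
    IsLUB (Set.range fun i => a * c i) (a * s)

/-! ### Datalog programs -/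

/-- The extensional (EDB) and intensional (IDB) predicates, with their arities. -/
structure Schema where
  numEDB : ℕ
  numIDB : ℕ
  edbArity : Fin numEDB → ℕ
  idbArity : Fin numIDB → ℕ

/-- An atom over the variables `x_0, …, x_{ℓ-1}`. -/
inductive Atom (S : Schema) (ℓ : ℕ) where
  | edb (R : Fin S.numEDB) (args : Fin (S.edbArity R) → Fin ℓ)
  | idb (T : Fin S.numIDB) (args : Fin (S.idbArity T) → Fin ℓ)

/-- The set of variables of an atom. -/
def Atom.vars {S : Schema} {ℓ : ℕ} : Atom S ℓ → Finset (Fin ℓ)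
  | .edb _ args => Finset.univ.image args
  | .idb _ args => Finset.univ.image args

def Atom.isIDB {S : Schema} {ℓ : ℕ} : Atom S ℓ → Bool
  | .edb _ _ => false
  | .idb _ _ => true

/-- A sum-product query with `k` head positions: the sum, over the variables that are not head
variables, of the product of the body atoms. -/
structure SumProd (S : Schema) (k : ℕ) where
  numVars : ℕ
  head : Fin k → Fin numVars
  body : List (Atom S numVars)

/-- A Datalog program: each IDB has one rule, whose body is a sum of sum-product queries. -/
structure Program where
  schema : Schema
  rules : (T : Fin schema.numIDB) → List (SumProd schema (schema.idbArity T))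
  target : Fin schema.numIDB

/-- The maximum arity of an IDB. -/
def Program.arity (P : Program) : ℕ := Finset.univ.sup P.schema.idbArity

/-- Every sum-product query of every rule contains at most one IDB atom. -/
def Program.IsLinear (P : Program) : Prop :=
  ∀ T, ∀ φ ∈ P.rules T, (φ.body.filter Atom.isIDB).length ≤ 1

/-- The hyperedges of the hypergraph associated with a sum-product query. -/
def SumProd.hyperedges {S : Schema} {k : ℕ} (φ : SumProd S k) : Set (Finset (Fin φ.numVars)) :=
  {J | ∃ a ∈ φ.body, a.vars = J}

/-- `(𝒯, χ)` is a tree decomposition of the hypergraph with vertex set `Fin ℓ` and hyperedges `E`. -/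
structure IsTreeDecomposition {ℓ : ℕ} (E : Set (Finset (Fin ℓ))) {V : Type} (𝒯 : SimpleGraph V)
    (χ : V → Finset (Fin ℓ)) : Prop where
  isTree : 𝒯.IsTree
  cover : ∀ J ∈ E, ∃ t, J ⊆ χ t
  running : ∀ i : Fin ℓ, (𝒯.induce {t | i ∈ χ t}).Connected

/-- A join tree is a tree decomposition all of whose bags are hyperedges. -/
structure IsJoinTree {ℓ : ℕ} (E : Set (Finset (Fin ℓ))) {V : Type} (𝒯 : SimpleGraph V)
    (χ : V → Finset (Fin ℓ)) : Prop extends IsTreeDecomposition E 𝒯 χ where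
  bag_mem : ∀ t, χ t ∈ E

/-- The associated hypergraph admits a (finite) join tree. -/
def SumProd.IsAcyclic {S : Schema} {k : ℕ} (φ : SumProd S k) : Prop :=
  ∃ (N : ℕ) (𝒯 : SimpleGraph (Fin N)) (χ : Fin N → Finset (Fin φ.numVars)),
    IsJoinTree φ.hyperedges 𝒯 χ

def Program.IsRulewiseAcyclic (P : Program) : Prop :=
  ∀ T, ∀ φ ∈ P.rules T, φ.IsAcyclic

/-! ### Databases -/

/-- The stored tuples of the EDB relations; constants are natural numbers. -/
structure Database (S : Schema) where
  rows : (R : Fin S.numEDB) → List (Fin (S.edbArity R) → ℕ)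
  nodup : ∀ R, (rows R).Nodup

namespace Database

variable {S : Schema} (I : Database S)

/-- The input size `m`: the sum of the sizes of the EDB relations. -/
def size : ℕ := ∑ R, (I.rows R).length

/-- The active domain: the constants that occur in the database. -/
def adom : Finset ℕ :=
  Finset.univ.biUnion fun R => (I.rows R).toFinset.biUnion fun t => Finset.univ.image t

/-- An annotation of the database with elements of `D`: tuples that are not stored have
annotation `0`. -/
structure Annotation (D : Type*) [Zero D] where
  val : (R : Fin S.numEDB) → (Fin (S.edbArity R) → ℕ) → D
  zero_of_notMem : ∀ R t, t ∉ I.rows R → val R t = 0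

/-- The database as a sequence of words: for each EDB relation, the number of its tuples followed
by the tuples. -/
def encode : List ℕ :=
  (List.finRange S.numEDB).flatMap fun R =>
    (I.rows R).length :: (I.rows R).flatMap fun t => List.ofFn t

end Database

/-- `2 ^ (k ⌈log₂ (m + 2)⌉)`, the number of values of a word of `k ⌈log₂ (m + 2)⌉` bits. -/
def wordBound (k m : ℕ) : ℕ := 2 ^ (k * Nat.clog 2 (m + 2))

/-! ### Semantics of programs -/

/-- An interpretation of the IDB predicates by `D`-relations. -/
abbrev IDBValuation (S : Schema) (D : Type*) : Type _ :=
  (T : Fin S.numIDB) → (Fin (S.idbArity T) → ℕ) → D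

section Semantics

variable {S : Schema} {D : Type*} [CommSemiring D]

def Atom.value {ℓ : ℕ} {I : Database S} (A : I.Annotation D) (X : IDBValuation S D)
    (v : Fin ℓ → ℕ) : Atom S ℓ → D
  | .edb R args => A.val R (v ∘ args)
  | .idb T args => X T (v ∘ args)

/-- The value of a sum-product query at the head tuple `c`; variables range over the active
domain. -/
def SumProd.value {k : ℕ} {I : Database S} (A : I.Annotation D) (X : IDBValuation S D)
    (φ : SumProd S k) (c : Fin k → ℕ) : D :=
  ∑ v : Fin φ.numVars → I.adom,
    if (fun i => (v (φ.head i) : ℕ)) = c then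
      (φ.body.map (Atom.value A X fun j => (v j : ℕ))).prod
    else 0

/-- The immediate consequence operator of a program. -/
def Program.ico (P : Program) {I : Database P.schema} (A : I.Annotation D)
    (X : IDBValuation P.schema D) : IDBValuation P.schema D :=
  fun T c => ((P.rules T).map fun φ => φ.value A X c).sum

end Semantics

/-- `x` is the least fixpoint of `F`. -/
def IsLeastFixpoint {α : Type*} [LE α] (F : α → α) (x : α) : Prop :=
  IsLeast {y | F y = y} x

/-! ### Groundings -/

/-- A ground IDB atom of a grounding: a predicate symbol and a tuple of constants. A grounding may
use predicate symbols of its own; symbol `T < numIDB` is the IDB `T` of the program. -/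
abbrev GroundIDB : Type := ℕ × List ℕ

/-- A ground EDB atom (a coefficient) or a ground IDB atom (a variable). -/
inductive GroundAtom (S : Schema) where
  | edb (R : Fin S.numEDB) (t : Fin (S.edbArity R) → ℕ)
  | idb (a : GroundIDB)

/-- A grounded rule; its body is a monomial. -/
structure GroundRule (S : Schema) where
  head : GroundIDB
  body : List (GroundAtom S)

/-- A grounding, given by its grounded rules. It stands for the system of polynomial equations
`x = ⨁ (bodies of the rules with head x)`, one for each ground IDB atom `x`. -/
abbrev Grounding (S : Schema) : Type := List (GroundRule S)

/-- The number of occurrences of coefficients and variables. -/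
def Grounding.size {S : Schema} (G : Grounding S) : ℕ :=
  (G.map fun r => 1 + r.body.length).sum

def GroundAtom.value {S : Schema} {D : Type*} [CommSemiring D] {I : Database S}
    (A : I.Annotation D) (Y : GroundIDB → D) : GroundAtom S → D
  | .edb R t => A.val R t
  | .idb a => Y a

/-- The right-hand sides of the system of polynomial equations. -/
def Grounding.ico {S : Schema} {D : Type*} [CommSemiring D] (G : Grounding S) {I : Database S}
    (A : I.Annotation D) (Y : GroundIDB → D) : GroundIDB → D :=
  fun x => ((G.filter fun r => r.head = x).map fun r =>
    (r.body.map (GroundAtom.value A Y)).prod).sum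

/-- `G` is `D`-equivalent to `P` on the database `I`: for every annotation of `I` by elements of
`D`, the least fixpoints of both exist and agree on the target. -/
def Grounding.IsEquivalent {P : Program} {I : Database P.schema} (G : Grounding P.schema)
    (D : Type*) [CommSemiring D] [PartialOrder D] : Prop :=
  ∀ A : I.Annotation D, ∃ (X : IDBValuation P.schema D) (Y : GroundIDB → D),
    IsLeastFixpoint (P.ico A) X ∧ IsLeastFixpoint (G.ico A) Y ∧
      ∀ c : Fin (P.schema.idbArity P.target) → ℕ,
        Y ((P.target : ℕ), List.ofFn c) = X P.target c

/-- Self-delimiting code of a ground IDB atom. -/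
def encodeGroundIDB (a : GroundIDB) : List ℕ := a.1 :: a.2.length :: a.2

def GroundAtom.encode {S : Schema} : GroundAtom S → List ℕ
  | .edb R t => 0 :: (R : ℕ) :: List.ofFn t
  | .idb a => 1 :: encodeGroundIDB a

def GroundRule.encode {S : Schema} (r : GroundRule S) : List ℕ :=
  encodeGroundIDB r.head ++ r.body.length :: r.body.flatMap GroundAtom.encode

/-- A grounding as a sequence of words. -/
def Grounding.encode {S : Schema} (G : Grounding S) : List ℕ := G.flatMap GroundRule.encode

/-! ### The word-RAM -/

inductive BinOp where
  | add | sub | mul | div | rem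

/-- Arithmetic on words, modulo the word bound `W` (quotient and remainder by `0` as for natural
numbers). -/
def BinOp.eval (W : ℕ) : BinOp → ℕ → ℕ → ℕ
  | .add, a, b => (a + b) % W
  | .sub, a, b => (a + (W - b % W)) % W
  | .mul, a, b => (a * b) % W
  | .div, a, b => (a / b) % W
  | .rem, a, b => (a % b) % W

/-- Structured word-RAM programs. Registers are numbered; memory is addressed by words. -/
inductive Cmd where
  /-- `r := c` -/
  | const (r c : ℕ)
  /-- `r := a ∘ b` -/
  | op (o : BinOp) (r a b : ℕ)
  /-- `r := mem[a]` -/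
  | load (r a : ℕ)
  /-- `mem[a] := r` -/
  | store (a r : ℕ)
  /-- append the word in `r` to the output -/
  | emit (r : ℕ)
  | seq (c₁ c₂ : Cmd)
  /-- if `a < b` then `c₁` else `c₂` -/
  | branch (a b : ℕ) (c₁ c₂ : Cmd)
  /-- while `a < b` do `c` -/
  | loop (a b : ℕ) (c : Cmd)

structure State where
  reg : ℕ → ℕ
  mem : ℕ → ℕ
  out : List ℕ

/-- The input stands at the start of the memory; everything else is zero. -/
def State.init (input : List ℕ) : State where
  reg := fun _ => 0
  mem := fun i => input.getD i 0
  out := []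

/-- `Exec W c s s' t`: with words below `W`, the program `c` started in `s` halts in `s'` after `t`
steps. Each instruction and each test costs one step. -/
inductive Exec (W : ℕ) : Cmd → State → State → ℕ → Prop
  | const (r c : ℕ) (s : State) :
      Exec W (.const r c) s { s with reg := Function.update s.reg r (c % W) } 1
  | op (o : BinOp) (r a b : ℕ) (s : State) :
      Exec W (.op o r a b) s
        { s with reg := Function.update s.reg r (o.eval W (s.reg a) (s.reg b)) } 1
  | load (r a : ℕ) (s : State) :
      Exec W (.load r a) s { s with reg := Function.update s.reg r (s.mem (s.reg a)) } 1
  | store (a r : ℕ) (s : State) :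
      Exec W (.store a r) s { s with mem := Function.update s.mem (s.reg a) (s.reg r) } 1
  | emit (r : ℕ) (s : State) :
      Exec W (.emit r) s { s with out := s.out ++ [s.reg r] } 1
  | seq {c₁ c₂ : Cmd} {s₁ s₂ s₃ : State} {t₁ t₂ : ℕ} :
      Exec W c₁ s₁ s₂ t₁ → Exec W c₂ s₂ s₃ t₂ → Exec W (.seq c₁ c₂) s₁ s₃ (t₁ + t₂)
  | branch_true {a b : ℕ} {c₁ c₂ : Cmd} {s s' : State} {t : ℕ} :
      s.reg a < s.reg b → Exec W c₁ s s' t → Exec W (.branch a b c₁ c₂) s s' (t + 1)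
  | branch_false {a b : ℕ} {c₁ c₂ : Cmd} {s s' : State} {t : ℕ} :
      ¬ s.reg a < s.reg b → Exec W c₂ s s' t → Exec W (.branch a b c₁ c₂) s s' (t + 1)
  | loop_done {a b : ℕ} {c : Cmd} {s : State} :
      ¬ s.reg a < s.reg b → Exec W (.loop a b c) s s 1
  | loop_step {a b : ℕ} {c : Cmd} {s₁ s₂ s₃ : State} {t₁ t₂ : ℕ} :
      s₁.reg a < s₁.reg b → Exec W c s₁ s₂ t₁ → Exec W (.loop a b c) s₂ s₃ t₂ →
        Exec W (.loop a b c) s₁ s₃ (t₁ + t₂ + 1)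

end DatalogGrounding

namespace DatalogGrounding

/-! A query with an acyclic body can be evaluated by passing messages along its join tree, at a cost
proportional to the number of assignments to the bags. A bag of a stored atom has at most m relevant
assignments, and at most m·n after one further variable is added; a bag of two variables has n²,
which is O(m·n) because n is O(m). So each query needs a tree decomposition in which every bag is
the variable set of an EDB atom plus at most one variable, or has at most two variables, and in
which the at most two head variables share a bag. `RIP.exists_niceCover` provides it.

By linearity, every bag of a join tree belongs to an EDB atom, except possibly one bag t of at most
two variables. Adding a head variable y to all bags and taking a bag with the other head variable x
as root works unless t grows to three variables, which would cost n³. This danger disappears if t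
has at most one element, meets {x, y}, or lies in another bag and can be deleted. Otherwise t = {u,
v} separates the tree into a u-side and a v-side without common variables (`RIP.split`). If x and y
are on the same side, y is added on that side only. If x is on the u-side and y on the v-side, then
y is added to the u-side and u to the v-side; the sides are joined along u and y, and {u, v} hangs
on the v-side.

`exists_templates_of_rip` turns such a decomposition into rule templates that do not depend on the
instance: each non-root bag defines a new predicate, its message, and distributivity shows that the
root rule computes the query. For every solution of the message equations, the IDB equations of the
grounding are therefore those of the program, and `Grounding.isEquivalent_of_ico` deduces that the
least fixpoints agree.

A template is executed by at most two nested loops, over a stored relation or the list of constants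
(`runs_scanCode`). That list is built by linear search, O(n) steps for each of the O(m) input
entries (`runs_prepareCode`). All costs are O(m·n + 1), where m itself is bounded in this form by
`Database.size_le`. -/

/-! ### Running intersection lists -/

/-- A list of bags with the running intersection property: each bag meets the union of the later
bags inside a single later bag. The last bag is the root. -/
def RIP {V : Type*} : List (Finset V) → Prop
  | [] => True
  | X :: L => RIP L ∧ (L = [] ∨ ∃ Z ∈ L, ∀ i ∈ X, (∃ Y ∈ L, i ∈ Y) → i ∈ Z)

namespace RIP

variable {V : Type*}

/-- The condition on the first bag depends only on which bags come later, not on their order, so the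
tail may be reordered. -/
theorem cons_congr {X : Finset V} {L L' : List (Finset V)} (h : RIP (X :: L)) (h' : RIP L')
    (hm : ∀ Y, Y ∈ L' ↔ Y ∈ L) : RIP (X :: L') := by
  refine ⟨h', ?_⟩
  rcases h.2 with h2 | ⟨Z, hZ, h2⟩
  · left
    subst h2
    exact List.eq_nil_iff_forall_not_mem.2 fun Y hY => by simpa using (hm Y).1 hY
  · exact Or.inr ⟨Z, (hm Z).2 hZ, fun i hi ⟨Y, hY, hiY⟩ => h2 i hi ⟨Y, (hm Y).1 hY, hiY⟩⟩

/-- Gluing of two trees by an edge from the root `R` of the first to a bag `Z` of the second. Bags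
of `L₁` keep their parents, because whatever they share with `L₂` already lies in `R`. -/
theorem append {L₁ L₂ : List (Finset V)} {R : Finset V} (h₁ : RIP (L₁ ++ [R])) (h₂ : RIP L₂)
    (hR : ∀ X ∈ L₁ ++ [R], ∀ Y ∈ L₂, ∀ i ∈ X, i ∈ Y → i ∈ R)
    (hZ : ∃ Z ∈ L₂, ∀ i ∈ R, ∀ Y ∈ L₂, i ∈ Y → i ∈ Z) : RIP (L₁ ++ [R] ++ L₂) := by
  induction L₁ with
  | nil =>
    obtain ⟨Z, hZ, h⟩ := hZ
    exact ⟨h₂, Or.inr ⟨Z, hZ, fun i hi ⟨Y, hY, hiY⟩ => h i hi Y hY hiY⟩⟩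
  | cons X L₁ ih =>
    refine ⟨ih h₁.1 fun X hX => hR X (List.mem_cons_of_mem _ hX), Or.inr ?_⟩
    rcases h₁.2 with h | ⟨Z, hZ, h⟩
    · simp at h
    · refine ⟨Z, List.mem_append_left _ hZ, fun i hi ⟨Y, hY, hiY⟩ => ?_⟩
      rcases List.mem_append.1 hY with hY | hY
      · exact h i hi ⟨Y, hY, hiY⟩
      · exact h i hi ⟨R, by simp, hR X (by simp) Y hY i hi hiY⟩

variable [DecidableEq V]

/-- A tree can be oriented towards any of its nodes. If `B` occurs in the tail, the tail is rerooted
and the first bag stays in front; otherwise `B` is the first bag, a leaf, and the tail is rerooted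
at its parent, so that `B` can follow as the new root. -/
theorem reroot {L : List (Finset V)} (h : RIP L) {B : Finset V} (hB : B ∈ L) :
    ∃ L', RIP (L' ++ [B]) ∧ ∀ X, X ∈ L' ++ [B] ↔ X ∈ L := by
  induction L generalizing B with
  | nil => simp at hB
  | cons X L ih =>
    by_cases hBL : B ∈ L
    · obtain ⟨L', h', hm⟩ := ih h.1 hBL
      exact ⟨X :: L', cons_congr h h' hm, fun Y => by
        rw [List.cons_append, List.mem_cons, List.mem_cons, hm]⟩
    · obtain rfl : B = X := by simpa [hBL] using hB
      rcases h.2 with h2 | ⟨Z, hZ, h2⟩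
      · exact ⟨[], by simp [RIP], fun Y => by simp [h2]⟩
      · obtain ⟨L', h', hm⟩ := ih h.1 hZ
        refine ⟨L' ++ [Z], append h' (by simp [RIP]) ?_ ⟨B, by simp, by simp⟩, fun Y => ?_⟩
        · intro Y hY Y' hY' i hi hi'
          obtain rfl : Y' = B := by simpa using hY'
          exact h2 i hi' ⟨Y, (hm Y).1 hY, hi⟩
        · rw [List.mem_append, hm]; simp [or_comm]

theorem map_union {L : List (Finset V)} (h : RIP L) (E : Finset V) : RIP (L.map (· ∪ E)) := by
  induction L with
  | nil => trivial
  | cons X L ih =>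
    refine ⟨ih h.1, ?_⟩
    rcases h.2 with h2 | ⟨Z, hZ, h2⟩
    · exact Or.inl (by simp [h2])
    · refine Or.inr ⟨Z ∪ E, List.mem_map_of_mem hZ, ?_⟩
      rintro i hi ⟨Y, hY, hiY⟩
      obtain ⟨Y, hY, rfl⟩ := List.mem_map.1 hY
      grind

/-- Bags whose parent was `t` are hung on the root `B`, which contains everything they shared with
later bags through `t`. -/
theorem filter_ne {L : List (Finset V)} {B t : Finset V} (h : RIP (L ++ [B])) (ht : t ⊆ B) :
    RIP (L.filter (· ≠ t) ++ [B]) := by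
  induction L with
  | nil => exact h
  | cons X L ih =>
    by_cases hX : X = t
    · have : (X :: L).filter (· ≠ t) = L.filter (· ≠ t) := by simp [hX]
      rw [this]
      exact ih h.1
    · have hm : ∀ Y, Y ∈ L.filter (· ≠ t) ++ [B] → Y ∈ L ++ [B] := by
        intro Y; simp only [List.mem_append, List.mem_filter]; tauto
      rw [List.filter_cons_of_pos (by simpa using hX)]
      refine ⟨ih h.1, Or.inr ?_⟩
      rcases h.2 with h2 | ⟨Z, hZ, h2⟩
      · simp at h2
      · by_cases hZt : Z = t
        · exact ⟨B, by simp, fun i hi ⟨Y, hY, hiY⟩ => ht (hZt ▸ h2 i hi ⟨Y, hm Y hY, hiY⟩)⟩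
        · refine ⟨Z, ?_, fun i hi ⟨Y, hY, hiY⟩ => h2 i hi ⟨Y, hm Y hY, hiY⟩⟩
          change Z ∈ L.filter (· ≠ t) ++ [B]
          have hZ' : Z ∈ L ++ [B] := hZ
          rw [List.mem_append] at hZ' ⊢
          exact hZ'.imp_left fun h' => List.mem_filter.2 ⟨h', by simpa using hZt⟩

/-- Splitting a running intersection list at a root `{u, v}` that no other bag contains. -/
theorem split {u v : V} {L : List (Finset V)} (h : RIP (L ++ [{u, v}]))
    (hL : ∀ X ∈ L, X = {u, v} ∨ ¬ ({u, v} ⊆ X)) :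
    ∃ Lu Lv, RIP Lu ∧ RIP Lv ∧ (∀ X, X ∈ Lu ∨ X ∈ Lv ↔ X ∈ L ∧ X ≠ {u, v}) ∧
      (∀ X ∈ Lu, ∀ Y ∈ Lv, ∀ i ∈ X, i ∉ Y) ∧ (∀ X ∈ Lu, v ∉ X) ∧ (∀ X ∈ Lv, u ∉ X) := by
  -- The inductive step for either side: `X` joins the `a`-side if its parent is there, or if its
  -- parent is `{a, b}` and `X` misses `b`. It is used with `(a, b)` equal to `(u, v)` and to `(v,
  -- u)`.
  have key : ∀ (a b : V) (La Lb L : List (Finset V)) (X : Finset V), RIP La →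
      (∀ X, X ∈ La ∨ X ∈ Lb ↔ X ∈ L ∧ X ≠ {a, b}) →
      (∀ X ∈ La, ∀ Y ∈ Lb, ∀ i ∈ X, i ∉ Y) → (∀ X ∈ La, b ∉ X) → (∀ X ∈ Lb, a ∉ X) →
      ∀ Z ∈ L ++ [{a, b}], (∀ i ∈ X, (∃ Y ∈ L ++ [{a, b}], i ∈ Y) → i ∈ Z) →
      (Z ∈ La ∨ (Z = {a, b} ∧ b ∉ X)) →
      RIP (X :: La) ∧ (∀ Y ∈ Lb, ∀ i ∈ X, i ∉ Y) ∧ b ∉ X := by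
    intro a b La Lb L X hLa hm hd hb ha Z hZ hXZ hcase
    have hsub : ∀ Y ∈ La, Y ∈ L ++ [{a, b}] := fun Y hY =>
      List.mem_append_left _ ((hm Y).1 (Or.inl hY)).1
    have hsub' : ∀ Y ∈ Lb, Y ∈ L ++ [{a, b}] := fun Y hY =>
      List.mem_append_left _ ((hm Y).1 (Or.inr hY)).1
    rcases hcase with hZa | ⟨rfl, hbX⟩
    · refine ⟨⟨hLa, Or.inr ⟨Z, hZa, fun i hi ⟨Y, hY, hiY⟩ => hXZ i hi ⟨Y, hsub Y hY, hiY⟩⟩⟩, ?_, ?_⟩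
      · intro Y hY i hi hiY
        exact hd Z hZa Y hY i (hXZ i hi ⟨Y, hsub' Y hY, hiY⟩) hiY
      · intro hbX
        exact hb Z hZa (hXZ b hbX ⟨{a, b}, by simp, by simp⟩)
    · have hia : ∀ i ∈ X, (∃ Y ∈ L ++ [{a, b}], i ∈ Y) → i = a := by
        intro i hi hY
        have := hXZ i hi hY
        simp only [Finset.mem_insert, Finset.mem_singleton] at this
        rcases this with h | h
        · exact h
        · exact absurd (h ▸ hi) hbX
      refine ⟨⟨hLa, ?_⟩, ?_, hbX⟩
      -- Here `X` meets the later bags at most in `a`. A bag of `La` that contains `a` can serve as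
      -- parent; if there is none, `X` shares nothing with `La` and any bag will do.
      · rcases La with _ | ⟨W, La⟩
        · exact Or.inl rfl
        · right
          by_cases hex : ∃ Y ∈ W :: La, a ∈ Y
          · obtain ⟨Y, hY, haY⟩ := hex
            exact ⟨Y, hY, fun i hi ⟨Y', hY', hiY'⟩ => hia i hi ⟨Y', hsub Y' hY', hiY'⟩ ▸ haY⟩
          · exact ⟨W, by simp, fun i hi ⟨Y', hY', hiY'⟩ =>
              absurd ⟨Y', hY', hia i hi ⟨Y', hsub Y' hY', hiY'⟩ ▸ hiY'⟩ hex⟩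
      · intro Y hY i hi hiY
        exact ha Y hY (hia i hi ⟨Y, hsub' Y hY, hiY⟩ ▸ hiY)
  induction L with
  | nil => exact ⟨[], [], trivial, trivial, by simp, by simp, by simp, by simp⟩
  | cons X L ih =>
    obtain ⟨Lu, Lv, hu, hv, hm, hd, hvu, huv⟩ := ih h.1 fun Y hY => hL Y (List.mem_cons_of_mem _ hY)
    by_cases hX : X = {u, v}
    · refine ⟨Lu, Lv, hu, hv, fun Y => ?_, hd, hvu, huv⟩
      rw [hm, List.mem_cons]
      grind
    rcases h.2 with h2 | ⟨Z, hZ, h2⟩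
    · simp at h2
    have hnot : u ∉ X ∨ v ∉ X := by
      by_contra hcon
      push Not at hcon
      refine ((hL X (by simp)).resolve_left hX) ?_
      intro i hi
      simp only [Finset.mem_insert, Finset.mem_singleton] at hi
      rcases hi with rfl | rfl
      exacts [hcon.1, hcon.2]
    have hcase : (Z ∈ Lu ∨ (Z = {u, v} ∧ v ∉ X)) ∨ (Z ∈ Lv ∨ (Z = {u, v} ∧ u ∉ X)) := by
      by_cases hZt : Z = {u, v}
      · tauto
      · have hZL : Z ∈ L := by simpa [hZt] using hZ
        have := (hm Z).2 ⟨hZL, hZt⟩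
        tauto
    rcases hcase with hc | hc
    · obtain ⟨k1, k2, k3⟩ := key u v Lu Lv L X hu hm hd hvu huv Z hZ h2 hc
      refine ⟨X :: Lu, Lv, k1, hv, fun Y => ?_, ?_, ?_, huv⟩
      · have := hm Y
        rw [List.mem_cons, List.mem_cons, or_assoc, this]; grind
      · intro Y hY
        rcases List.mem_cons.1 hY with rfl | hY
        · exact fun Y' hY' i hi => k2 Y' hY' i hi
        · exact hd Y hY
      · intro Y hY
        rcases List.mem_cons.1 hY with rfl | hY
        exacts [k3, hvu Y hY]
    · have hpair : ({v, u} : Finset V) = {u, v} := Finset.pair_comm v u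
      obtain ⟨k1, k2, k3⟩ := key v u Lv Lu L X hv (by intro Y; rw [hpair, or_comm]; exact hm Y)
        (fun Y hY Y' hY' i hi hi' => hd Y' hY' Y hY i hi' hi) huv hvu Z (by rwa [hpair])
        (by rwa [hpair]) (by rwa [hpair])
      refine ⟨Lu, X :: Lv, hu, k1, fun Y => ?_, ?_, hvu, ?_⟩
      · have := hm Y
        rw [List.mem_cons, List.mem_cons, or_left_comm, this]; grind
      · intro Y hY Y' hY' i hi hi'
        rcases List.mem_cons.1 hY' with rfl | hY'
        · exact k2 Y hY i hi' hi
        · exact hd Y hY Y' hY' i hi hi'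
      · intro Y hY
        rcases List.mem_cons.1 hY with rfl | hY
        exacts [k3, huv Y hY]

/-! ### Refining a decomposition to bags that are cheap to enumerate -/

/-- A bag covered by a set satisfying `p` and at most one further element, or with at most two
elements. -/
def Nice (p : Finset V → Prop) (B : Finset V) : Prop :=
  (∃ X, p X ∧ X ⊆ B ∧ (B \ X).card ≤ 1) ∨ B.card ≤ 2

theorem nice_union_singleton {p : Finset V → Prop} {X : Finset V} (hX : p X) {E : Finset V}
    (hE : E.card ≤ 1) : Nice p (X ∪ E) :=
  Or.inl ⟨X, hX, Finset.subset_union_left, (Finset.card_le_card (by grind)).trans hE⟩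

/-- `L'` refines `L` to nice bags, with a root that contains `H`. -/
structure NiceCover (p : Finset V → Prop) (L L' : List (Finset V)) (H : Finset V) : Prop where
  rip : RIP L'
  nice : ∀ B ∈ L', Nice p B
  cover : ∀ B ∈ L, ∃ B' ∈ L', B ⊆ B'
  root : ∃ L₀ R, L' = L₀ ++ [R] ∧ H ⊆ R

/-- The easy construction: the same set `E` is added to every bag, and the bag that then contains
`H` becomes the root. -/
theorem niceCover_of_extra {p : Finset V → Prop} {L : List (Finset V)} (h : RIP L)
    {H E : Finset V} {B : Finset V} (hB : B ∈ L) (hH : H ⊆ B ∪ E)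
    (hn : ∀ X ∈ L, Nice p (X ∪ E)) : ∃ L', NiceCover p L L' H := by
  obtain ⟨L', h', hm⟩ := h.reroot hB
  refine ⟨(L' ++ [B]).map (· ∪ E), h'.map_union E, ?_, ?_, L'.map (· ∪ E), B ∪ E, by simp, hH⟩
  · intro Y hY
    obtain ⟨X, hX, rfl⟩ := List.mem_map.1 hY
    exact hn X ((hm X).1 hX)
  · intro X hX
    exact ⟨X ∪ E, List.mem_map_of_mem ((hm X).2 hX), Finset.subset_union_left⟩

/-- Only the `v`-side receives `y`, and its bag with `x` becomes the root. The pair `{u, v}` hangs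
on this side at `v` and stays a pair; the untouched `u`-side hangs on the pair at `u`. -/
theorem niceCover_same_side {p : Finset V → Prop} {u v x y : V} {Lu Lv : List (Finset V)}
    (hu : RIP Lu) (hv : RIP Lv) (hp : ∀ X, X ∈ Lu ∨ X ∈ Lv → p X)
    (hd : ∀ X ∈ Lu, ∀ Y ∈ Lv, ∀ i ∈ X, i ∉ Y) (hvu : ∀ X ∈ Lu, v ∉ X) (huv : ∀ X ∈ Lv, u ∉ X)
    (hyu : y ≠ u) (hyv : y ≠ v) {Bx By : Finset V} (hBx : Bx ∈ Lv) (hx : x ∈ Bx)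
    (hBy : By ∈ Lv) (hy : y ∈ By) :
    ∃ L', RIP L' ∧ (∀ B ∈ L', Nice p B) ∧ (∀ X ∈ Lu, ∃ B ∈ L', X ⊆ B) ∧
      (∀ X ∈ Lv, ∃ B ∈ L', X ⊆ B) ∧ (∃ B ∈ L', {u, v} ⊆ B) ∧
      ∃ L₀ R, L' = L₀ ++ [R] ∧ ({x, y} : Finset V) ⊆ R := by
  obtain ⟨L₁, h₁, hm₁⟩ := hv.reroot hBx
  have hM := h₁.map_union {y}
  set M := (L₁ ++ [Bx]).map (· ∪ {y}) with hMdef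
  have hMmem : ∀ Y, Y ∈ M ↔ ∃ X ∈ Lv, X ∪ {y} = Y := by
    intro Y; rw [hMdef, List.mem_map]; simp only [hm₁]
  have hT : RIP ([] ++ [{u, v}] ++ M) := by
    apply append
    · simp [RIP]
    · exact hM
    · intro X hX Y _ i hi _
      obtain rfl : X = {u, v} := by simpa using hX
      exact hi
    · by_cases hex : ∃ Y ∈ Lv, v ∈ Y
      · obtain ⟨Y, hY, hvY⟩ := hex
        refine ⟨Y ∪ {y}, (hMmem _).2 ⟨Y, hY, rfl⟩, ?_⟩
        intro i hi W hW hiW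
        obtain ⟨X, hX, rfl⟩ := (hMmem W).1 hW
        have := huv X hX
        grind
      · refine ⟨Bx ∪ {y}, (hMmem _).2 ⟨Bx, hBx, rfl⟩, ?_⟩
        intro i hi W hW hiW
        obtain ⟨X, hX, rfl⟩ := (hMmem W).1 hW
        have := huv X hX
        grind
  have hTn : ∀ B ∈ ([{u, v}] ++ M : List (Finset V)), Nice p B := by
    intro B hB
    rcases List.mem_append.1 hB with hB | hB
    · obtain rfl : B = {u, v} := by simpa using hB
      exact Or.inr Finset.card_le_two
    · obtain ⟨X, hX, rfl⟩ := (hMmem B).1 hB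
      exact nice_union_singleton (hp X (Or.inr hX)) (by simp)
  have hroot : ∃ L₀ R, [{u, v}] ++ M = L₀ ++ [R] ∧ ({x, y} : Finset V) ⊆ R :=
    ⟨{u, v} :: L₁.map (· ∪ {y}), Bx ∪ {y}, by simp [hMdef], by
      rw [Finset.insert_subset_iff, Finset.singleton_subset_iff]; simp [hx]⟩
  have hcv : ∀ X ∈ Lv, ∃ B ∈ [{u, v}] ++ M, X ⊆ B := fun X hX =>
    ⟨X ∪ {y}, List.mem_append_right _ ((hMmem _).2 ⟨X, hX, rfl⟩), Finset.subset_union_left⟩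
  by_cases hLu : Lu = []
  · subst hLu
    exact ⟨[{u, v}] ++ M, hT, hTn, by simp, hcv, ⟨{u, v}, by simp, subset_rfl⟩, hroot⟩
  -- The `u`-side shares only `u` with the rest, so it must be rooted at a bag that contains `u`,
  -- unless `u` does not occur in it at all.
  have hBu : ∃ Bu ∈ Lu, (∃ X ∈ Lu, u ∈ X) → u ∈ Bu := by
    by_cases hex : ∃ X ∈ Lu, u ∈ X
    · obtain ⟨X, hX, h⟩ := hex
      exact ⟨X, hX, fun _ => h⟩
    · obtain ⟨X, hX⟩ := List.exists_mem_of_ne_nil _ hLu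
      exact ⟨X, hX, fun h => absurd h hex⟩
  obtain ⟨Bu, hBu, hBu'⟩ := hBu
  obtain ⟨L₂, h₂, hm₂⟩ := hu.reroot hBu
  have hint : ∀ X ∈ Lu, ∀ Y ∈ [{u, v}] ++ M, ∀ i ∈ X, i ∈ Y → i = u := by
    intro X hX Y hY i hi hiY
    rcases List.mem_append.1 hY with hY | hY
    · obtain rfl : Y = {u, v} := by simpa using hY
      have := hvu X hX
      grind
    · obtain ⟨W, hW, rfl⟩ := (hMmem Y).1 hY
      have h1 := hd X hX W hW i hi
      have h2 := hd X hX By hBy i hi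
      grind
  refine ⟨L₂ ++ [Bu] ++ ([{u, v}] ++ M), append h₂ hT ?_ ⟨{u, v}, by simp, ?_⟩, ?_, ?_, ?_, ?_, ?_⟩
  · intro X hX Y hY i hi hiY
    have hX' := (hm₂ X).1 hX
    have := hint X hX' Y hY i hi hiY
    subst this
    exact hBu' ⟨X, hX', hi⟩
  · intro i hi Y hY hiY
    simp [hint Bu hBu Y hY i hi hiY]
  · intro B hB
    rcases List.mem_append.1 hB with hB | hB
    · exact Or.inl ⟨B, hp B (Or.inl ((hm₂ B).1 hB)), subset_rfl, by simp⟩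
    · exact hTn B hB
  · intro X hX
    exact ⟨X, List.mem_append_left _ ((hm₂ X).2 hX), subset_rfl⟩
  · intro X hX
    obtain ⟨B, hB, h⟩ := hcv X hX
    exact ⟨B, List.mem_append_right _ hB, h⟩
  · exact ⟨{u, v}, by simp, subset_rfl⟩
  · obtain ⟨L₀, R, h, hR⟩ := hroot
    exact ⟨L₂ ++ [Bu] ++ L₀, R, by rw [h]; simp, hR⟩

/-- With `u` added to the `v`-side and `y` to the `u`-side, the two sides share at most `u` and `y`.
Both lie in `By ∪ {u}`, the root of the `v`-side, and the shared ones lie in one enlarged bag of the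
`u`-side, so the sides can be glued. The pair `{u, v}` is a leaf attached to the `v`-side, and `Bx ∪
{y}` is the root of the whole. -/
theorem niceCover_opposite_sides {p : Finset V → Prop} {u v x y : V} {Lu Lv : List (Finset V)}
    (hu : RIP Lu) (hv : RIP Lv) (hp : ∀ X, X ∈ Lu ∨ X ∈ Lv → p X)
    (hd : ∀ X ∈ Lu, ∀ Y ∈ Lv, ∀ i ∈ X, i ∉ Y) (hvu : ∀ X ∈ Lu, v ∉ X) (hne : u ≠ v)
    (hyu : y ≠ u) (hyv : y ≠ v) {Bx By : Finset V} (hBx : Bx ∈ Lu) (hx : x ∈ Bx)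
    (hBy : By ∈ Lv) (hy : y ∈ By) :
    ∃ L', RIP L' ∧ (∀ B ∈ L', Nice p B) ∧ (∀ X ∈ Lu, ∃ B ∈ L', X ⊆ B) ∧
      (∀ X ∈ Lv, ∃ B ∈ L', X ⊆ B) ∧ (∃ B ∈ L', {u, v} ⊆ B) ∧
      ∃ L₀ R, L' = L₀ ++ [R] ∧ ({x, y} : Finset V) ⊆ R := by
  obtain ⟨L₁, h₁, hm₁⟩ := hv.reroot hBy
  obtain ⟨L₂, h₂, hm₂⟩ := hu.reroot hBx
  have hM₁ := h₁.map_union {u}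
  have hM₂ := h₂.map_union {y}
  set M₁ := (L₁ ++ [By]).map (· ∪ {u}) with hM₁def
  set M₂ := (L₂ ++ [Bx]).map (· ∪ {y}) with hM₂def
  have hmem₁ : ∀ Y, Y ∈ M₁ ↔ ∃ X ∈ Lv, X ∪ {u} = Y := by
    intro Y; rw [hM₁def, List.mem_map]; simp only [hm₁]
  have hmem₂ : ∀ Y, Y ∈ M₂ ↔ ∃ X ∈ Lu, X ∪ {y} = Y := by
    intro Y; rw [hM₂def, List.mem_map]; simp only [hm₂]
  have hM₁eq : M₁ = L₁.map (· ∪ {u}) ++ [By ∪ {u}] := by simp [hM₁def]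
  have hint : ∀ X ∈ Lv, ∀ Y ∈ Lu, ∀ i ∈ X ∪ {u}, i ∈ Y ∪ {y} →
      i = y ∨ (i = u ∧ ∃ Y ∈ Lu, u ∈ Y) := by
    intro X hX Y hY i hi hi'
    have := hd Y hY X hX i
    grind
  have hM : RIP (M₁ ++ M₂) := by
    rw [hM₁eq]
    refine append (hM₁eq ▸ hM₁) hM₂ ?_ ?_
    · rw [← hM₁eq]
      intro X hX Y hY i hi hi'
      obtain ⟨X, hX', rfl⟩ := (hmem₁ X).1 hX
      obtain ⟨Y, hY', rfl⟩ := (hmem₂ Y).1 hY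
      rcases hint X hX' Y hY' i hi hi' with rfl | ⟨rfl, -⟩ <;> grind
    · by_cases hex : ∃ Y ∈ Lu, u ∈ Y
      · obtain ⟨Z, hZ, huZ⟩ := hex
        refine ⟨Z ∪ {y}, (hmem₂ _).2 ⟨Z, hZ, rfl⟩, ?_⟩
        intro i hi Y hY hi'
        obtain ⟨Y, hY', rfl⟩ := (hmem₂ Y).1 hY
        rcases hint By hBy Y hY' i hi hi' with rfl | ⟨rfl, -⟩ <;> grind
      · refine ⟨Bx ∪ {y}, (hmem₂ _).2 ⟨Bx, hBx, rfl⟩, ?_⟩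
        intro i hi Y hY hi'
        obtain ⟨Y, hY', rfl⟩ := (hmem₂ Y).1 hY
        rcases hint By hBy Y hY' i hi hi' with rfl | ⟨rfl, h⟩
        · grind
        · exact absurd h hex
  have hnv : ∀ Y ∈ M₂, v ∉ Y := by
    intro Y hY
    obtain ⟨Y, hY', rfl⟩ := (hmem₂ Y).1 hY
    have := hvu Y hY'
    grind
  have huM : ∀ Y ∈ M₁, u ∈ Y := by
    intro Y hY
    obtain ⟨Y, hY, rfl⟩ := (hmem₁ Y).1 hY
    simp
  refine ⟨{u, v} :: (M₁ ++ M₂), ⟨hM, Or.inr ?_⟩, ?_, ?_, ?_, ⟨{u, v}, by simp, subset_rfl⟩,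
    {u, v} :: (M₁ ++ L₂.map (· ∪ {y})), Bx ∪ {y}, by simp [hM₂def], by
      rw [Finset.insert_subset_iff, Finset.singleton_subset_iff]; simp [hx]⟩
  · by_cases hex : ∃ Y ∈ Lv, v ∈ Y
    · obtain ⟨Z, hZ, hvZ⟩ := hex
      exact ⟨Z ∪ {u}, List.mem_append_left _ ((hmem₁ _).2 ⟨Z, hZ, rfl⟩), by grind⟩
    · refine ⟨By ∪ {u}, List.mem_append_left _ ((hmem₁ _).2 ⟨By, hBy, rfl⟩), ?_⟩
      rintro i hi ⟨Y, hY, hiY⟩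
      have : i ≠ v := by
        rintro rfl
        rcases List.mem_append.1 hY with hY | hY
        · obtain ⟨Y', hY', rfl⟩ := (hmem₁ Y).1 hY
          refine hex ⟨Y', hY', ?_⟩
          simpa [hne.symm] using hiY
        · exact hnv Y hY hiY
      simp only [Finset.mem_insert, Finset.mem_singleton, this, or_false] at hi
      simp [hi]
  · intro B hB
    rcases List.mem_cons.1 hB with rfl | hB
    · exact Or.inr Finset.card_le_two
    rcases List.mem_append.1 hB with hB | hB
    · obtain ⟨X, hX, rfl⟩ := (hmem₁ B).1 hB
      exact nice_union_singleton (hp X (Or.inr hX)) (by simp)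
    · obtain ⟨X, hX, rfl⟩ := (hmem₂ B).1 hB
      exact nice_union_singleton (hp X (Or.inl hX)) (by simp)
  · intro X hX
    exact ⟨X ∪ {y}, List.mem_cons_of_mem _ (List.mem_append_right _ ((hmem₂ _).2 ⟨X, hX, rfl⟩)), Finset.subset_union_left⟩
  · intro X hX
    exact ⟨X ∪ {u}, List.mem_cons_of_mem _ (List.mem_append_left _ ((hmem₁ _).2 ⟨X, hX, rfl⟩)), Finset.subset_union_left⟩

/-- A running intersection list whose bags satisfy `p`, up to one bag `t` with at most two elements,
has a nice cover with a root that contains a given set of at most two elements. -/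
theorem exists_niceCover {p : Finset V → Prop} {L : List (Finset V)} (h : RIP L) (hne : L ≠ [])
    {t H : Finset V} (ht : t.card ≤ 2) (hL : ∀ X ∈ L, p X ∨ X = t) (hH : H.card ≤ 2)
    (hHL : ∀ i ∈ H, ∃ X ∈ L, i ∈ X) : ∃ L', NiceCover p L L' H := by
  rcases H.eq_empty_or_nonempty with rfl | hHne
  · obtain ⟨B, hB⟩ := List.exists_mem_of_ne_nil _ hne
    refine niceCover_of_extra h (E := ∅) hB (by simp) fun X hX => ?_
    rcases hL X hX with hX | rfl
    · exact nice_union_singleton hX (by simp)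
    · exact Or.inr (by simpa using ht)
  have herase : ∀ x ∈ H, (H.erase x).card ≤ 1 := fun x hx => by
    rw [Finset.card_erase_of_mem hx]; omega
  -- The root is a bag with `x`, and the rest of `H`, at most one element, is added to all bags.
  -- Only a bag without `p` can be spoiled by this.
  have hgood : ∀ L : List (Finset V), RIP L → (∀ i ∈ H, ∃ X ∈ L, i ∈ X) → ∀ x ∈ H,
      (∀ X ∈ L, p X ∨ (X ∪ H.erase x).card ≤ 2) → ∃ L', NiceCover p L L' H := by
    intro L h hHL x hx hp
    obtain ⟨B, hB, hxB⟩ := hHL x hx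
    refine niceCover_of_extra h (E := H.erase x) hB (by grind) fun X hX => ?_
    rcases hp X hX with hX | hX
    · exact nice_union_singleton hX (herase x hx)
    · exact Or.inr hX
  obtain ⟨x₀, hx₀⟩ := hHne
  by_cases hpt : p t ∨ t ∉ L
  · refine hgood L h hHL x₀ hx₀ fun X hX => Or.inl ?_
    rcases hL X hX with hX' | rfl
    · exact hX'
    · exact hpt.resolve_right (by simpa using hX)
  push Not at hpt
  obtain ⟨hpt, htL⟩ := hpt
  have hgood' : ∀ x ∈ H, (t ∪ H.erase x).card ≤ 2 → ∃ L', NiceCover p L L' H := by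
    intro x hx hc
    refine hgood L h hHL x hx fun X hX => ?_
    rcases hL X hX with hX' | rfl
    exacts [Or.inl hX', Or.inr hc]
  by_cases hone : H.card ≤ 1
  · refine hgood' x₀ hx₀ ?_
    have : H.erase x₀ = ∅ := by
      rw [← Finset.card_eq_zero, Finset.card_erase_of_mem hx₀]; omega
    simpa [this] using ht
  obtain ⟨x, y, hxy, rfl⟩ := Finset.card_eq_two.1 (show H.card = 2 by omega)
  -- If `t` already contains one of the two elements of `H`, that one is chosen to be added
  -- everywhere, and `t` does not grow.
  by_cases hyt : y ∈ t
  · refine hgood' x (by simp) ((Finset.card_le_card ?_).trans ht)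
    grind
  by_cases hxt : x ∈ t
  · refine hgood' y (by simp) ((Finset.card_le_card ?_).trans ht)
    grind
  by_cases ht1 : t.card ≤ 1
  · refine hgood' x (by simp) ((Finset.card_union_le _ _).trans ?_)
    have := herase x (by simp)
    omega
  -- A bag `B` that properly contains `t` makes `t` redundant: with `B` as root, `t` is filtered out
  -- and all remaining bags satisfy `p`.
  by_cases hsup : ∃ B ∈ L, t ⊆ B ∧ B ≠ t
  · obtain ⟨B, hB, htB, hBt⟩ := hsup
    obtain ⟨L₁, h₁, hm₁⟩ := h.reroot hB
    have hmem : ∀ X, X ∈ L₁.filter (· ≠ t) ++ [B] ↔ X ∈ L ∧ X ≠ t := by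
      intro X
      rw [← hm₁]
      simp only [List.mem_append, List.mem_filter, List.mem_singleton, decide_eq_true_eq]
      grind
    obtain ⟨L', hL'⟩ := hgood _ (h₁.filter_ne htB) (fun i hi => by
        obtain ⟨X, hX, hiX⟩ := hHL i hi
        exact ⟨X, (hmem X).2 ⟨hX, by grind⟩, hiX⟩) x (by simp)
      (fun X hX => Or.inl ((hL X ((hmem X).1 hX).1).resolve_right ((hmem X).1 hX).2))
    refine ⟨L', hL'.rip, hL'.nice, fun X hX => ?_, hL'.root⟩
    by_cases hXt : X = t
    · obtain ⟨B', hB', hs⟩ := hL'.cover B (by simp)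
      exact ⟨B', hB', hXt ▸ htB.trans hs⟩
    · exact hL'.cover X ((hmem X).2 ⟨hX, hXt⟩)
  push Not at hsup
  -- The essential case: `t` is a pair that no other bag contains and that is disjoint from `H = {x,
  -- y}`, so it splits the decomposition.
  obtain ⟨u, v, huv, rfl⟩ := Finset.card_eq_two.1 (show t.card = 2 by omega)
  obtain ⟨L₁, h₁, hm₁⟩ := h.reroot htL
  obtain ⟨Lu, Lv, hu, hv, hm, hd, hvu, huv'⟩ := split h₁ fun X hX => by
    by_cases hX' : {u, v} ⊆ X
    · exact Or.inl (hsup X ((hm₁ X).1 (by simp [hX])) hX')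
    · exact Or.inr hX'
  have hmL : ∀ X, X ∈ Lu ∨ X ∈ Lv ↔ X ∈ L ∧ X ≠ {u, v} := by
    intro X
    rw [hm, ← hm₁]
    simp only [List.mem_append, List.mem_singleton]
    grind
  have hp : ∀ X, X ∈ Lu ∨ X ∈ Lv → p X := fun X hX =>
    (hL X ((hmL X).1 hX).1).resolve_right ((hmL X).1 hX).2
  have hd' : ∀ X ∈ Lv, ∀ Y ∈ Lu, ∀ i ∈ X, i ∉ Y := fun X hX Y hY i hi hi' => hd Y hY X hX i hi' hi
  have hpair : ({v, u} : Finset V) = {u, v} := Finset.pair_comm v u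
  have hpair' : ({y, x} : Finset V) = {x, y} := Finset.pair_comm y x
  have hloc : ∀ i ∈ ({x, y} : Finset V), (∃ X ∈ Lu, i ∈ X) ∨ ∃ X ∈ Lv, i ∈ X := by
    intro i hi
    obtain ⟨X, hX, hiX⟩ := hHL i hi
    rcases (hmL X).2 ⟨hX, by grind⟩ with h' | h'
    exacts [Or.inl ⟨X, h', hiX⟩, Or.inr ⟨X, h', hiX⟩]
  have main : ∃ L', RIP L' ∧ (∀ B ∈ L', Nice p B) ∧ (∀ X ∈ Lu, ∃ B ∈ L', X ⊆ B) ∧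
      (∀ X ∈ Lv, ∃ B ∈ L', X ⊆ B) ∧ (∃ B ∈ L', {u, v} ⊆ B) ∧
      ∃ L₀ R, L' = L₀ ++ [R] ∧ ({x, y} : Finset V) ⊆ R := by
    simp only [Finset.mem_insert, Finset.mem_singleton, not_or] at hyt hxt
    rcases hloc x (by simp) with ⟨Bx, hBx, hxB⟩ | ⟨Bx, hBx, hxB⟩ <;>
      rcases hloc y (by simp) with ⟨By, hBy, hyB⟩ | ⟨By, hBy, hyB⟩
    · obtain ⟨L', k1, k2, k3, k4, k5, k6⟩ := niceCover_same_side hv hu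
        (fun X hX => hp X hX.symm) hd' huv' hvu hyt.2 hyt.1 hBx hxB hBy hyB
      exact ⟨L', k1, k2, k4, k3, by rwa [hpair] at k5, k6⟩
    · exact niceCover_opposite_sides hu hv hp hd hvu huv hyt.1 hyt.2 hBx hxB hBy hyB
    · obtain ⟨L', k1, k2, k3, k4, k5, k6⟩ := niceCover_opposite_sides hu hv hp hd hvu huv hxt.1 hxt.2
        hBy hyB hBx hxB
      exact ⟨L', k1, k2, k3, k4, k5, by rwa [hpair'] at k6⟩
    · exact niceCover_same_side hu hv hp hd hvu huv' hyt.1 hyt.2 hBx hxB hBy hyB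
  obtain ⟨L', k1, k2, k3, k4, k5, k6⟩ := main
  refine ⟨L', k1, k2, fun X hX => ?_, k6⟩
  by_cases hXt : X = {u, v}
  · exact hXt ▸ k5
  · rcases (hmL X).2 ⟨hX, hXt⟩ with h' | h'
    exacts [k3 X h', k4 X h']

theorem exists_walk_of_induce {α : Type*} {G : SimpleGraph α} {s : Set α} {a b : s}
    (w : (G.induce s).Walk a b) : ∃ w' : G.Walk a b, ∀ x ∈ w'.support, x ∈ s := by
  induction w with
  | nil => exact ⟨.nil, by simp⟩
  | cons h _ ih =>
    obtain ⟨w', hw'⟩ := ih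
    have h' := SimpleGraph.induce_adj.1 h
    refine ⟨.cons h' w', fun x hx => ?_⟩
    rw [SimpleGraph.Walk.support_cons, List.mem_cons] at hx
    rcases hx with rfl | hx
    exacts [Subtype.prop _, hw' x hx]

/-- The bags of a tree decomposition form a running intersection list. -/
theorem of_isTreeDecomposition {ℓ : ℕ} {E : Set (Finset (Fin ℓ))} {N : ℕ}
    {𝒯 : SimpleGraph (Fin N)} {χ : Fin N → Finset (Fin ℓ)} (h : IsTreeDecomposition E 𝒯 χ) :
    ∃ L, L ≠ [] ∧ RIP L ∧ ∀ X, X ∈ L ↔ ∃ t, χ t = X := by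
  -- A connected set `S` of tree nodes grows from a single root; each new node is a neighbour `t` of
  -- some `p ∈ S` and is put in front with parent `p`. The number `k` counts the nodes still
  -- missing.
  have key : ∀ k, ∀ S : List (Fin N), S ≠ [] → S.Nodup → N - S.length = k → RIP (S.map χ) →
      (∀ a ∈ S, ∀ b ∈ S, ∃ w : 𝒯.Walk a b, ∀ x ∈ w.support, x ∈ S) →
      ∃ S' : List (Fin N), S' ≠ [] ∧ RIP (S'.map χ) ∧ ∀ t, t ∈ S' := by
    intro k
    induction k with
    | zero =>
      intro S hne hnd hk hrip _
      refine ⟨S, hne, hrip, fun t => ?_⟩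
      have hle := hnd.length_le_card
      rw [Fintype.card_fin] at hle
      have hcard : S.toFinset.card = Fintype.card (Fin N) := by
        rw [List.toFinset_card_of_nodup hnd, Fintype.card_fin]; omega
      have := (Finset.card_eq_iff_eq_univ _).1 hcard
      rw [← List.mem_toFinset, this]
      exact Finset.mem_univ t
    | succ k ih =>
      intro S hne hnd hk hrip hconn
      have hex : ∃ t, t ∉ S := by
        by_contra hcon
        push Not at hcon
        have := (Finset.card_eq_iff_eq_univ S.toFinset).2 (by ext; simp [hcon])
        rw [List.toFinset_card_of_nodup hnd, Fintype.card_fin] at this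
        omega
      obtain ⟨t₀, ht₀⟩ := hex
      obtain ⟨s₀, hs₀⟩ := List.exists_mem_of_ne_nil _ hne
      obtain ⟨w₀⟩ := h.isTree.connected.preconnected s₀ t₀
      obtain ⟨d, -, hd1, hd2⟩ := w₀.exists_boundary_dart {x | x ∈ S} hs₀ ht₀
      obtain ⟨⟨p, t⟩, hadj⟩ := d
      simp only [Set.mem_ofPred_eq] at hd1 hd2
      change 𝒯.Adj p t at hadj
      refine ih (t :: S) (by simp) (List.nodup_cons.2 ⟨hd2, hnd⟩) (by simp; omega)
        ⟨hrip, Or.inr ⟨χ p, List.mem_map_of_mem hd1, ?_⟩⟩ ?_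
      · rintro i hi ⟨Y, hY, hiY⟩
        obtain ⟨s, hs, rfl⟩ := List.mem_map.1 hY
        by_contra hip
        obtain ⟨w₁⟩ := (h.running i).preconnected ⟨t, hi⟩ ⟨s, hiY⟩
        obtain ⟨w₁', hw₁⟩ := exists_walk_of_induce w₁
        obtain ⟨w₂, hw₂⟩ := hconn s hs p hd1
        -- The edge between `t` and `p` is a bridge, so the walk from `t` to `s` through bags
        -- containing `i`, continued from `s` to `p` inside `S`, must use it. The second part avoids
        -- `t`; hence the first part visits `p`, which gives `i ∈ χ p`.
        have hbr := SimpleGraph.isAcyclic_iff_forall_adj_isBridge.1 h.isTree.isAcyclic hadj.symm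
        have := SimpleGraph.isBridge_iff_forall_walk_mem_edges.1 hbr (w₁'.append w₂)
        rw [SimpleGraph.Walk.edges_append, List.mem_append] at this
        rcases this with h' | h'
        · exact hip (hw₁ _ (SimpleGraph.Walk.snd_mem_support_of_mem_edges _ h'))
        · exact hd2 (hw₂ _ (SimpleGraph.Walk.fst_mem_support_of_mem_edges _ h'))
      · have hstep : ∀ b ∈ S, ∃ w : 𝒯.Walk t b, ∀ x ∈ w.support, x ∈ t :: S := by
          intro b hb
          obtain ⟨w, hw⟩ := hconn p hd1 b hb
          refine ⟨.cons hadj.symm w, fun x hx => ?_⟩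
          rw [SimpleGraph.Walk.support_cons, List.mem_cons] at hx
          rcases hx with rfl | hx
          exacts [by simp, List.mem_cons_of_mem _ (hw x hx)]
        intro a ha b hb
        rcases List.mem_cons.1 ha with rfl | ha' <;> rcases List.mem_cons.1 hb with rfl | hb'
        · exact ⟨.nil, by simp⟩
        · exact hstep b hb'
        · obtain ⟨w, hw⟩ := hstep a ha'
          exact ⟨w.reverse, by simpa using hw⟩
        · obtain ⟨w, hw⟩ := hconn a ha' b hb'
          exact ⟨w, fun x hx => List.mem_cons_of_mem _ (hw x hx)⟩
  obtain ⟨r⟩ := h.isTree.connected.nonempty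
  obtain ⟨S, hne, hS, hall⟩ := key _ [r] (by simp) (by simp) rfl (by simp [RIP]) (by
    intro a ha b hb
    obtain rfl : a = r := by simpa using ha
    obtain rfl : b = a := by simpa using hb
    exact ⟨.nil, by simp⟩)
  exact ⟨S.map χ, by simpa using hne, hS, fun X => by simp [hall]⟩

end RIP

/-! ### Least fixpoints of continuous operators -/

section Kleene

variable {D : Type*} [PartialOrder D] {ι : Type*}

/-- Monotone functions that preserve suprema of ω-chains. -/
def OmegaCont (F : (ι → D) → D) : Prop :=
  Monotone F ∧ ∀ (c : ℕ → ι → D) (s : ι → D), Monotone c →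
    (∀ i, IsLUB (Set.range fun n => c n i) (s i)) → IsLUB (Set.range fun n => F (c n)) (F s)

namespace OmegaCont

theorem const (a : D) : OmegaCont fun _ : ι → D => a :=
  ⟨fun _ _ _ => le_rfl, fun _ _ _ _ => by simp [isLUB_singleton]⟩

theorem eval (i : ι) : OmegaCont fun X : ι → D => X i :=
  ⟨fun _ _ h => h i, fun _ _ _ h => h i⟩

variable [CommSemiring D] [OmegaContinuousSemiring D]

/-- The semiring axioms give continuity in one argument at a time. The resulting double supremum is
bounded by the diagonal one, because the terms with indices `n` and `m` are dominated by those with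
index `max n m`. -/
theorem add {F G : (ι → D) → D} (hF : OmegaCont F) (hG : OmegaCont G) :
    OmegaCont fun X => F X + G X := by
  refine ⟨fun X Y h => add_le_add (hF.1 h) (hG.1 h), fun c s hc hs => ⟨?_, ?_⟩⟩
  · rintro _ ⟨n, rfl⟩
    have h := fun i => (hs i).1 ⟨n, rfl⟩
    exact add_le_add (hF.1 h) (hG.1 h)
  · intro u hu
    have h1 : ∀ n, G s + F (c n) ≤ u := by
      intro n
      rw [add_comm]
      refine (OmegaContinuousSemiring.add_continuous (F (c n)) (fun m => G (c m)) (G s)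
        (fun a b h => hG.1 (hc h)) (hG.2 c s hc hs)).2 ?_
      rintro _ ⟨m, rfl⟩
      exact (add_le_add (hF.1 (hc (le_max_left n m))) (hG.1 (hc (le_max_right n m)))).trans
        (hu ⟨max n m, rfl⟩)
    have h2 : G s + F s ≤ u := (OmegaContinuousSemiring.add_continuous (G s) (fun m => F (c m)) (F s)
        (fun a b h => hF.1 (hc h)) (hF.2 c s hc hs)).2 (by rintro _ ⟨m, rfl⟩; exact h1 m)
    rwa [add_comm] at h2

theorem mul {F G : (ι → D) → D} (hF : OmegaCont F) (hG : OmegaCont G) :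
    OmegaCont fun X => F X * G X := by
  refine ⟨fun X Y h => mul_le_mul' (hF.1 h) (hG.1 h), fun c s hc hs => ⟨?_, ?_⟩⟩
  · rintro _ ⟨n, rfl⟩
    have h := fun i => (hs i).1 ⟨n, rfl⟩
    exact mul_le_mul' (hF.1 h) (hG.1 h)
  · intro u hu
    have h1 : ∀ n, G s * F (c n) ≤ u := by
      intro n
      rw [mul_comm]
      refine (OmegaContinuousSemiring.mul_continuous (F (c n)) (fun m => G (c m)) (G s)
        (fun a b h => hG.1 (hc h)) (hG.2 c s hc hs)).2 ?_
      rintro _ ⟨m, rfl⟩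
      exact (mul_le_mul' (hF.1 (hc (le_max_left n m))) (hG.1 (hc (le_max_right n m)))).trans
        (hu ⟨max n m, rfl⟩)
    have h2 : G s * F s ≤ u := (OmegaContinuousSemiring.mul_continuous (G s) (fun m => F (c m)) (F s)
        (fun a b h => hF.1 (hc h)) (hF.2 c s hc hs)).2 (by rintro _ ⟨m, rfl⟩; exact h1 m)
    rwa [mul_comm] at h2

theorem list_sum {α : Type*} (l : List α) {F : α → (ι → D) → D} (h : ∀ a, OmegaCont (F a)) :
    OmegaCont fun X => (l.map fun a => F a X).sum := by
  induction l with
  | nil => exact const 0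
  | cons a l ih => simpa using (h a).add ih

theorem list_prod {α : Type*} (l : List α) {F : α → (ι → D) → D} (h : ∀ a, OmegaCont (F a)) :
    OmegaCont fun X => (l.map fun a => F a X).prod := by
  induction l with
  | nil => exact const 1
  | cons a l ih => simpa using (h a).mul ih

theorem finset_sum {α : Type*} (s : Finset α) {F : α → (ι → D) → D} (h : ∀ a, OmegaCont (F a)) :
    OmegaCont fun X => ∑ a ∈ s, F a X := by
  classical
  induction s using Finset.induction with
  | empty => simpa using const 0
  | insert a s ha ih => simpa [Finset.sum_insert ha] using (h a).add ih

end OmegaCont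

variable [CommSemiring D] [OmegaContinuousSemiring D]

/-- Kleene's fixpoint theorem. -/
theorem exists_isLeastFixpoint {F : (ι → D) → ι → D} (hF : ∀ i, OmegaCont fun X => F X i) :
    ∃ X, IsLeastFixpoint F X := by
  have hmono : Monotone F := fun X Y h i => (hF i).1 h
  have hc : Monotone fun n => F^[n] 0 := by
    refine monotone_nat_of_le_succ fun n => ?_
    rw [Function.iterate_succ_apply]
    exact hmono.iterate n fun i => zero_le
  choose s hs using fun i => OmegaContinuousSemiring.omega_complete (fun n => F^[n] 0 i)
    fun a b h => hc h i
  refine ⟨s, ?_, ?_⟩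
  · funext i
    have h1 := (hF i).2 _ s hc hs
    refine h1.unique ⟨?_, fun u hu => (hs i).2 ?_⟩
    · rintro _ ⟨n, rfl⟩
      have := (hs i).1 ⟨n + 1, rfl⟩
      simpa only [Function.iterate_succ_apply'] using this
    · rintro _ ⟨n, rfl⟩
      refine (hc n.le_succ i).trans ?_
      have := hu ⟨n, rfl⟩
      simpa only [Function.iterate_succ_apply'] using this
  · intro y hy i
    refine (hs i).2 ?_
    rintro _ ⟨n, rfl⟩
    have : F^[n] 0 ≤ y := by
      induction n with
      | zero => exact fun i => zero_le
      | succ n ih =>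
        rw [Function.iterate_succ_apply']
        exact (hmono ih).trans_eq hy
    exact this i

end Kleene

/-! ### Fixpoints of programs and of groundings -/

/-- A short name for the annotations of a database. -/
abbrev Database.Weighting {S : Schema} (I : Database S) (D : Type*) [Zero D] : Type _ :=
  I.Annotation D

section Fixpoints

variable {D : Type*} [CommSemiring D] [PartialOrder D]
variable {P : Program} {I : Database P.schema}

/-- The values that a valuation of ground IDB atoms gives to the IDBs of the program. -/
def restrictIDB (S : Schema) {D : Type*} (Y : GroundIDB → D) : IDBValuation S D :=
  fun T c => Y ((T : ℕ), List.ofFn c)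

theorem GroundAtom.omegaCont {S : Schema} {I : Database S} (A : I.Weighting D)
    (a : GroundAtom S) : OmegaCont fun Y => a.value A Y := by
  cases a with
  | edb R t => exact OmegaCont.const _
  | idb a => exact OmegaCont.eval _

variable [OmegaContinuousSemiring D]

theorem Program.exists_isLeastFixpoint (A : I.Weighting D) :
    ∃ X, IsLeastFixpoint (P.ico A) X := by
  -- Valuations of the IDBs are dependent functions; indexing by ground atoms turns them into plain
  -- ones, to which Kleene's theorem applies.
  let ι := Σ T : Fin P.schema.numIDB, Fin (P.schema.idbArity T) → ℕ
  let F : (ι → D) → ι → D := fun X p => P.ico A (fun T c => X ⟨T, c⟩) p.1 p.2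
  have hF : ∀ i, OmegaCont fun X => F X i := by
    intro i
    refine OmegaCont.list_sum _ fun φ => OmegaCont.finset_sum _ fun v => ?_
    by_cases h : (fun j => (v (φ.head j) : ℕ)) = i.2
    · simp only [h, if_true]
      refine OmegaCont.list_prod _ fun a => ?_
      cases a with
      | edb R args => exact OmegaCont.const _
      | idb T args => exact OmegaCont.eval _
    · simp only [h, if_false]
      exact OmegaCont.const _
  obtain ⟨X, hX, hmin⟩ := DatalogGrounding.exists_isLeastFixpoint hF
  refine ⟨fun T c => X ⟨T, c⟩, ?_, fun Y hY T c => ?_⟩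
  · funext T c
    exact congrFun hX ⟨T, c⟩
  · refine hmin (a := fun p => Y p.1 p.2) ?_ ⟨T, c⟩
    funext p
    exact congrFun (congrFun hY p.1) p.2

theorem Grounding.omegaCont {S : Schema} {I : Database S} (G : Grounding S) (A : I.Weighting D)
    (x : GroundIDB) : OmegaCont fun Y => G.ico A Y x :=
  OmegaCont.list_sum _ fun _ => OmegaCont.list_prod _ fun a => a.omegaCont A

/-- A grounding with new predicate symbols from `numIDB` on is equivalent to the program if, for
every solution of the equations of the new symbols, it computes the immediate consequence
operator. -/
theorem Grounding.isEquivalent_of_ico (G : Grounding P.schema)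
    (h : ∀ (A : I.Weighting D) (Y : GroundIDB → D),
      (∀ x : GroundIDB, P.schema.numIDB ≤ x.1 → Y x = G.ico A Y x) →
      (∀ (T : Fin P.schema.numIDB) c,
        G.ico A Y ((T : ℕ), List.ofFn c) = P.ico A (restrictIDB P.schema Y) T c) ∧
      ∀ (T : Fin P.schema.numIDB) l, l.length ≠ P.schema.idbArity T →
        G.ico A Y ((T : ℕ), l) = 0) :
    G.IsEquivalent (I := I) D := by
  intro A
  obtain ⟨X, hX, hXmin⟩ := Program.exists_isLeastFixpoint (P := P) A
  obtain ⟨Y, hY, hYmin⟩ := exists_isLeastFixpoint (Grounding.omegaCont G A)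
  refine ⟨X, Y, ⟨hX, hXmin⟩, ⟨hY, hYmin⟩, ?_⟩
  suffices hr : restrictIDB P.schema Y = X from fun c => congrFun (congrFun hr P.target) c
  -- For `≤`, the fixpoint `X` of the program is extended to a fixpoint of `G`, which lies above the
  -- least one. For `≥`, the restriction of `Y` is a fixpoint of the program.
  refine le_antisymm ?_ (hXmin ?_)
  -- Ground atoms with an IDB symbol and a tuple of the wrong length get value `0`, as the second
  -- half of `h` demands.
  · let ext : GroundIDB → D := fun x =>
      if hx : ∃ (h : x.1 < P.schema.numIDB), x.2.length = P.schema.idbArity ⟨x.1, h⟩ then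
        X ⟨x.1, hx.1⟩ fun i => x.2.get (i.cast hx.2.symm) else 0
    -- The new symbols are solved with the IDB values frozen at `X`. Any solution suffices here, so
    -- leastness is dropped.
    obtain ⟨Y', hY', -⟩ := exists_isLeastFixpoint
      (F := fun (Y : GroundIDB → D) x => if x.1 < P.schema.numIDB then ext x else G.ico A Y x)
      (by
        intro x
        by_cases hx : x.1 < P.schema.numIDB
        · simp only [hx, if_true]
          exact OmegaCont.const _
        · simp only [hx, if_false]
          exact Grounding.omegaCont G A x)
    have hY'x : ∀ x, (if x.1 < P.schema.numIDB then ext x else G.ico A Y' x) = Y' x :=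
      fun x => congrFun hY' x
    have hres : restrictIDB P.schema Y' = X := by
      funext T c
      rw [restrictIDB, ← hY'x, if_pos T.2]
      have hx : ∃ (h : (T : ℕ) < P.schema.numIDB),
          (List.ofFn c).length = P.schema.idbArity ⟨T, h⟩ := ⟨T.2, by simp⟩
      change (if hx : _ then _ else _) = _
      rw [dif_pos hx]
      simp
    have haux : ∀ x : GroundIDB, P.schema.numIDB ≤ x.1 → Y' x = G.ico A Y' x := by
      intro x hx
      have := hY'x x
      rw [if_neg (by omega)] at this
      exact this.symm
    obtain ⟨h1, h2⟩ := h A Y' haux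
    have hfix : G.ico A Y' = Y' := by
      funext ⟨s, l⟩
      by_cases hs : s < P.schema.numIDB
      · by_cases hl : l.length = P.schema.idbArity ⟨s, hs⟩
        · obtain ⟨c, rfl⟩ : ∃ c : Fin (P.schema.idbArity ⟨s, hs⟩) → ℕ, List.ofFn c = l := by
            refine ⟨fun i => l.get (i.cast hl.symm), ?_⟩
            refine List.ext_get (by simp [hl]) fun n _ _ => by simp
          have := h1 ⟨s, hs⟩ c
          rw [hres] at this
          refine this.trans ?_
          rw [congrFun (congrFun hX _) c, ← hres]
          rfl
        · rw [h2 ⟨s, hs⟩ l hl, ← hY'x, if_pos hs]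
          change _ = dite _ _ _
          rw [dif_neg]
          rintro ⟨_, h'⟩
          exact hl h'
      · exact (haux _ (by simpa using hs)).symm
    intro T c
    rw [← hres]
    exact hYmin hfix _
  · obtain ⟨h1, -⟩ := h A Y fun x _ => (congrFun hY x).symm
    funext T c
    rw [← h1]
    exact congrFun hY _

end Fixpoints

/-! ### Sums over the assignments that extend a given one -/

section Marginals

variable {V α D : Type*} [Fintype V] [DecidableEq V]

/-- The assignments that agree with `v` outside of `U` and take values in `s` on `U`. -/
def agree (s : Finset α) (U : Finset V) (v : V → α) : Finset (V → α) :=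
  Fintype.piFinset fun i => if i ∈ U then s else {v i}

theorem mem_agree {s : Finset α} {U : Finset V} {v w : V → α} :
    w ∈ agree s U v ↔ (∀ i ∈ U, w i ∈ s) ∧ ∀ i ∉ U, w i = v i := by
  rw [agree, Fintype.mem_piFinset]
  constructor
  · intro h
    refine ⟨fun i hi => ?_, fun i hi => ?_⟩
    · simpa [hi] using h i
    · simpa [hi] using h i
  · rintro ⟨h1, h2⟩ i
    by_cases hi : i ∈ U
    · simpa [hi] using h1 i hi
    · simpa [hi] using h2 i hi

variable [DecidableEq α] [CommSemiring D]

theorem sum_agree_union (s : Finset α) {U₁ U₂ : Finset V} (h : Disjoint U₁ U₂) (v : V → α)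
    (f : (V → α) → D) :
    ∑ w ∈ agree s (U₁ ∪ U₂) v, f w = ∑ w₁ ∈ agree s U₁ v, ∑ w ∈ agree s U₂ w₁, f w := by
  rw [← Finset.sum_fiberwise_of_maps_to (g := fun w i => if i ∈ U₁ then w i else v i)
    (t := agree s U₁ v)]
  · refine Finset.sum_congr rfl fun w₁ hw₁ => Finset.sum_congr ?_ fun _ _ => rfl
    ext w
    rw [mem_agree] at hw₁
    rw [Finset.mem_filter, mem_agree, mem_agree]
    constructor
    · rintro ⟨⟨h1, h2⟩, rfl⟩
      refine ⟨fun i hi => h1 i (Finset.mem_union_right _ hi), fun i hi => ?_⟩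
      by_cases hi1 : i ∈ U₁
      · simp [hi1]
      · simp [hi1, h2 i (by simp [hi, hi1])]
    · rintro ⟨h1, h2⟩
      have h3 : ∀ i ∈ U₁, w i = w₁ i := fun i hi => h2 i (Finset.disjoint_left.1 h hi)
      refine ⟨⟨fun i hi => ?_, fun i hi => ?_⟩, ?_⟩
      · rcases Finset.mem_union.1 hi with hi | hi
        · rw [h3 i hi]; exact hw₁.1 i hi
        · exact h1 i hi
      · rw [Finset.mem_union, not_or] at hi
        rw [h2 i hi.2, hw₁.2 i hi.1]
      · funext i
        by_cases hi1 : i ∈ U₁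
        · simp [hi1, h3 i hi1]
        · simp [hi1, hw₁.2 i hi1]
  · intro w hw
    rw [mem_agree] at hw ⊢
    refine ⟨fun i hi => ?_, fun i hi => ?_⟩
    · simpa [hi] using hw.1 i (Finset.mem_union_left _ hi)
    · simp [hi]

/-- The left side is how the rule of a message sums, over whole assignments of the bag `B` that
match the separator `B ∩ U`; the right side is what elimination needs, a sum over the private
variables `B \ U` on top of `w`. Since `f` looks only at `B`, changing the values outside `B` is a
bijection between the two. -/
theorem sum_agree_restrict {s : Finset α} {B U : Finset V} {w v : V → α}
    (hw : ∀ i ∈ B, i ∈ U → w i ∈ s) {f : (V → α) → D}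
    (hf : ∀ w₁ w₂ : V → α, (∀ i ∈ B, w₁ i = w₂ i) → f w₁ = f w₂) :
    (∑ w' ∈ agree s B v, if ∀ i ∈ B ∩ U, w' i = w i then f w' else 0) =
      ∑ w' ∈ agree s (B \ U) w, f w' := by
  rw [← Finset.sum_filter]
  refine Finset.sum_nbij' (fun w' i => if i ∈ B then w' i else w i)
    (fun w' i => if i ∈ B then w' i else v i) ?_ ?_ ?_ ?_ ?_
  · intro w' hw'
    rw [Finset.mem_filter, mem_agree] at hw'
    rw [mem_agree]
    refine ⟨fun i hi => ?_, fun i hi => ?_⟩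
    · rw [Finset.mem_sdiff] at hi
      simpa [hi.1] using hw'.1.1 i hi.1
    · by_cases hB : i ∈ B
      · simpa [hB] using hw'.2 i (by simpa [hB] using hi)
      · simp [hB]
  · intro w' hw'
    rw [mem_agree] at hw'
    rw [Finset.mem_filter, mem_agree]
    refine ⟨⟨fun i hi => ?_, fun i hi => by simp [hi]⟩, fun i hi => ?_⟩
    · by_cases hU : i ∈ U
      · simpa [hi, hw'.2 i (by simp [hU])] using hw i hi hU
      · simpa [hi] using hw'.1 i (by simp [hi, hU])
    · rw [Finset.mem_inter] at hi
      simpa [hi.1] using hw'.2 i (by simp [hi.2])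
  · intro w' hw'
    rw [Finset.mem_filter, mem_agree] at hw'
    funext i
    by_cases hB : i ∈ B
    · simp [hB]
    · simp [hB, hw'.1.2 i hB]
  · intro w' hw'
    rw [mem_agree] at hw'
    funext i
    by_cases hB : i ∈ B
    · simp [hB]
    · simp [hB, hw'.2 i (by simp [hB])]
  · intro w' _
    exact hf _ _ fun i hi => by simp [hi]

end Marginals

/-! ### Templates for ground rules -/

/-- A loop over the rows of a table, which are matched with the list of variables `args`. -/
structure Scan (ℓ : ℕ) where
  tab : ℕ
  args : List (Fin ℓ)

inductive TAtom (S : Schema) (ℓ : ℕ) where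
  | edb (R : Fin S.numEDB) (args : Fin (S.edbArity R) → Fin ℓ)
  | idb (s : ℕ) (args : List (Fin ℓ))

/-- A rule whose variables are bound by nested scans. -/
structure Template (S : Schema) where
  numVars : ℕ
  scans : List (Scan numVars)
  head : ℕ
  headArgs : List (Fin numVars)
  body : List (TAtom S numVars)

def TAtom.vars {S : Schema} {ℓ : ℕ} : TAtom S ℓ → List (Fin ℓ)
  | .edb _ args => List.ofFn args
  | .idb _ args => args

def TAtom.ground {S : Schema} {ℓ : ℕ} (v : Fin ℓ → ℕ) : TAtom S ℓ → GroundAtom S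
  | .edb R args => .edb R (v ∘ args)
  | .idb s args => .idb (s, args.map v)

/-- Assign the values in the second list to the variables in the first one. -/
def assign {ℓ : ℕ} (v : Fin ℓ → ℕ) : List (Fin ℓ) → List ℕ → Fin ℓ → ℕ
  | i :: l, a :: t => assign (Function.update v i a) l t
  | _, _ => v

/-- The tables: the stored relations, followed by the list `dl` of constants. -/
def tables {S : Schema} (I : Database S) (dl : List ℕ) (k : ℕ) : List (List ℕ) :=
  if h : k < S.numEDB then (I.rows ⟨k, h⟩).map List.ofFn else dl.map fun a => [a]

def tabArity (S : Schema) (k : ℕ) : ℕ := if h : k < S.numEDB then S.edbArity ⟨k, h⟩ else 1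

/-- The assignments enumerated by nested scans. -/
def envs {ℓ : ℕ} (tbl : ℕ → List (List ℕ)) : List (Scan ℓ) → (Fin ℓ → ℕ) → List (Fin ℓ → ℕ)
  | [], v => [v]
  | σ :: l, v => (tbl σ.tab).flatMap fun t =>
      -- A variable that is repeated in `args` keeps the last value assigned to it; the test
      -- discards the rows in which its entries differ.
      if σ.args.map (assign v σ.args t) = t then envs tbl l (assign v σ.args t) else []

/-- The variables bound by nested scans. -/
def bound {ℓ : ℕ} : List (Scan ℓ) → Finset (Fin ℓ)
  | [] => ∅
  | σ :: l => σ.args.toFinset ∪ bound l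

def ScansDisjoint {ℓ : ℕ} : List (Scan ℓ) → Prop
  | [] => True
  | σ :: l => Disjoint σ.args.toFinset (bound l) ∧ ScansDisjoint l

/-- The rules that a template generates. -/
def Template.ground {S : Schema} (τ : Template S) (tbl : ℕ → List (List ℕ)) : Grounding S :=
  (envs tbl τ.scans 0).map fun v =>
    ⟨(τ.head, τ.headArgs.map v), τ.body.map (TAtom.ground v)⟩

/-- The part of the right-hand side of the equation of `x` that a template contributes. -/
def Template.rhs {S : Schema} {D : Type*} [CommSemiring D] {I : Database S} (A : I.Weighting D)
    (dl : List ℕ) (Y : GroundIDB → D) (x : GroundIDB) (τ : Template S) : D :=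
  ((envs (tables I dl) τ.scans 0).map fun v =>
    if (τ.head, τ.headArgs.map v) = x then
      (τ.body.map fun a => (a.ground v).value A Y).prod else 0).sum

/-- Scans that enumerate few assignments: a scan of one table, followed by at most one scan of the
list of constants. -/
structure ScansWF (S : Schema) {ℓ : ℕ} (l : List (Scan ℓ)) : Prop where
  disjoint : ScansDisjoint l
  arity : ∀ σ ∈ l, σ.tab ≤ S.numEDB ∧ σ.args.length = tabArity S σ.tab
  cheap : l = [] ∨ ∃ σ, l = [σ] ∨ ∃ i, l = [σ, ⟨S.numEDB, [i]⟩]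

structure Template.WF {S : Schema} (τ : Template S) : Prop where
  scans : ScansWF S τ.scans
  headArgs : ∀ i ∈ τ.headArgs, i ∈ bound τ.scans
  body : ∀ a ∈ τ.body, ∀ i ∈ a.vars, i ∈ bound τ.scans

theorem sum_map_filter {β D : Type*} [AddCommMonoid D] (l : List β) (p : β → Prop) [DecidablePred p]
    (f : β → D) : ((l.filter p).map f).sum = (l.map fun b => if p b then f b else 0).sum := by
  induction l with
  | nil => rfl
  | cons b l ih =>
    by_cases h : p b <;> simp [h, ih]

theorem ico_flatMap_ground {S : Schema} {D : Type*} [CommSemiring D] {I : Database S}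
    (A : I.Weighting D) (dl : List ℕ) (Y : GroundIDB → D) (x : GroundIDB)
    (Ts : List (Template S)) :
    Grounding.ico (Ts.flatMap fun τ => τ.ground (tables I dl)) A Y x =
      (Ts.map (Template.rhs A dl Y x)).sum := by
  rw [Grounding.ico, sum_map_filter]
  induction Ts with
  | nil => rfl
  | cons τ Ts ih =>
    rw [List.flatMap_cons, List.map_append, List.sum_append, ih, List.map_cons, List.sum_cons]
    congr 1
    simp only [Template.ground, Template.rhs, List.map_map, Function.comp_def]

theorem assign_of_notMem {ℓ : ℕ} {i : Fin ℓ} : ∀ {l : List (Fin ℓ)} (v : Fin ℓ → ℕ) (t : List ℕ),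
    i ∉ l → assign v l t i = v i
  | [], _, _, _ => rfl
  | _ :: _, _, [], _ => rfl
  | j :: l, v, a :: t, h => by
    rw [List.mem_cons, not_or] at h
    rw [assign, assign_of_notMem _ _ h.2, Function.update_of_ne h.1]

theorem assign_map {ℓ : ℕ} {w : Fin ℓ → ℕ} : ∀ {l : List (Fin ℓ)} {v : Fin ℓ → ℕ},
    (∀ i ∉ l, w i = v i) → assign v l (l.map w) = w
  | [], v, h => funext fun i => (h i (by simp)).symm
  | j :: l, v, h => by
    rw [List.map_cons, assign]
    refine assign_map fun i hi => ?_
    by_cases hj : i = j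
    · simp [hj]
    · rw [Function.update_of_ne hj, h i (by simp [hi, hj])]

/-- Rows that pass the consistency test correspond bijectively to assignments of the scanned
variables whose tuple occurs in the table: `assign` and reading off `args` are inverse to each
other. -/
theorem sum_scan {ℓ : ℕ} {D : Type*} [CommSemiring D] (s : Finset ℕ) (args : List (Fin ℓ))
    {ts : List (List ℕ)} (hnd : ts.Nodup)
    (hts : ∀ t ∈ ts, ∀ a ∈ t, a ∈ s) (v : Fin ℓ → ℕ) (f : (Fin ℓ → ℕ) → D) :
    (ts.map fun t => if args.map (assign v args t) = t then f (assign v args t) else 0).sum =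
      ∑ w ∈ agree s args.toFinset v, if args.map w ∈ ts then f w else 0 := by
  rw [← List.sum_toFinset _ hnd, ← Finset.sum_filter, ← Finset.sum_filter]
  refine Finset.sum_nbij' (fun t => assign v args t) (fun w => args.map w) ?_ ?_ ?_ ?_ ?_
  · intro t ht
    rw [Finset.mem_filter, List.mem_toFinset] at ht
    rw [Finset.mem_filter, mem_agree]
    refine ⟨⟨fun i hi => ?_, fun i hi => assign_of_notMem _ _ (by simpa using hi)⟩, ?_⟩
    · have := List.mem_map_of_mem (f := assign v args t) (List.mem_toFinset.1 hi)
      rw [ht.2] at this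
      exact hts t ht.1 _ this
    · rw [ht.2]; exact ht.1
  · intro w hw
    rw [Finset.mem_filter, mem_agree] at hw
    have := assign_map (l := args) (v := v) (w := w) fun i hi => hw.1.2 i (by simpa using hi)
    rw [Finset.mem_filter, List.mem_toFinset, this]
    exact ⟨hw.2, rfl⟩
  · intro t ht
    rw [Finset.mem_filter] at ht
    exact ht.2
  · intro w hw
    rw [Finset.mem_filter, mem_agree] at hw
    exact assign_map fun i hi => hw.1.2 i (by simpa using hi)
  · intro t _
    rfl

/-- Disjointness of the scans is what makes the nested loops a single sum: inner scans never
overwrite outer variables, so an outer table condition can be tested on the final assignment. -/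
theorem sum_envs {ℓ : ℕ} {D : Type*} [CommSemiring D] (s : Finset ℕ) {tbl : ℕ → List (List ℕ)}
    (hnd : ∀ k, (tbl k).Nodup) (hts : ∀ k, ∀ t ∈ tbl k, ∀ a ∈ t, a ∈ s) {l : List (Scan ℓ)}
    (hl : ScansDisjoint l) (v : Fin ℓ → ℕ) (f : (Fin ℓ → ℕ) → D) :
    ((envs tbl l v).map f).sum =
      ∑ w ∈ agree s (bound l) v, if ∀ σ ∈ l, σ.args.map w ∈ tbl σ.tab then f w else 0 := by
  induction l generalizing v with
  | nil =>
    have : agree s (bound []) v = {v} := by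
      ext w
      simp [mem_agree, bound, funext_iff]
    simp [envs, this]
  | cons σ l ih =>
    have h1 : ((envs tbl (σ :: l) v).map f).sum = ((tbl σ.tab).map fun t =>
        if σ.args.map (assign v σ.args t) = t then
          ((envs tbl l (assign v σ.args t)).map f).sum else 0).sum := by
      rw [envs, List.map_flatMap, List.flatMap, List.sum_flatten, List.map_map]
      congr 1
      refine List.map_congr_left fun t _ => ?_
      simp only [Function.comp_apply]
      split_ifs <;> simp
    rw [h1, sum_scan s σ.args (hnd _) (hts _) v fun w => ((envs tbl l w).map f).sum, bound,
      sum_agree_union s hl.1]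
    refine Finset.sum_congr rfl fun w _ => ?_
    rw [ih hl.2]
    have h2 : ∀ w' ∈ agree s (bound l) w, σ.args.map w' = σ.args.map w := by
      intro w' hw'
      rw [mem_agree] at hw'
      exact List.map_congr_left fun i hi =>
        hw'.2 i (Finset.disjoint_left.1 hl.1 (by simpa using hi))
    split_ifs with h
    · refine Finset.sum_congr rfl fun w' hw' => ?_
      simp [h2 w' hw', h]
    · symm
      refine Finset.sum_eq_zero fun w' hw' => if_neg fun hall => h ?_
      rw [← h2 w' hw']
      exact hall σ (by simp)

theorem tables_nodup {S : Schema} (I : Database S) {dl : List ℕ} (hdl : dl.Nodup) (k : ℕ) :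
    (tables I dl k).Nodup := by
  rw [tables]
  split_ifs with h
  · exact (I.nodup _).map List.ofFn_injective
  · exact hdl.map fun a b h => by simpa using h

theorem mem_adom {S : Schema} {I : Database S} {a : ℕ} :
    a ∈ I.adom ↔ ∃ R, ∃ t ∈ I.rows R, ∃ i, t i = a := by
  simp [Database.adom]

theorem mem_adom_of_mem_tables {S : Schema} (I : Database S) {dl : List ℕ}
    (hdl : dl.toFinset = I.adom) (k : ℕ) : ∀ t ∈ tables I dl k, ∀ a ∈ t, a ∈ I.adom := by
  intro t ht a ha
  rw [tables] at ht
  split_ifs at ht with h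
  · obtain ⟨r, hr, rfl⟩ := List.mem_map.1 ht
    obtain ⟨i, rfl⟩ := (List.mem_ofFn' _ _).1 ha
    exact mem_adom.2 ⟨_, r, hr, i, rfl⟩
  · obtain ⟨b, hb, rfl⟩ := List.mem_map.1 ht
    obtain rfl : a = b := by simpa using ha
    rw [← hdl]; simpa using hb

/-! ### Elimination along a running intersection list -/

universe u

theorem prod_filter_mul_prod_filter_not {β D : Type*} [CommMonoid D] (l : List β) (p : β → Prop)
    [DecidablePred p] [DecidablePred fun b => ¬ p b] (f : β → D) :
    ((l.filter (p ·)).map f).prod * ((l.filter (¬ p ·)).map f).prod = (l.map f).prod := by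
  induction l with
  | nil => simp
  | cons b l ih =>
    by_cases h : p b
    · rw [List.filter_cons_of_pos (by simpa using h), List.filter_cons_of_neg (by simpa using h)]
      simp only [List.map_cons, List.prod_cons, ← ih, mul_assoc]
    · rw [List.filter_cons_of_neg (by simpa using h), List.filter_cons_of_pos (by simpa using h)]
      simp only [List.map_cons, List.prod_cons, ← ih, mul_left_comm]

section Elimination

variable {S : Schema} {ℓ : ℕ}

/-- All variables of a list of bags. -/
def allVars : List (List (Scan ℓ)) → Finset (Fin ℓ)
  | [] => ∅
  | l :: L => bound l ∪ allVars L

theorem mem_allVars {L : List (List (Scan ℓ))} {i : Fin ℓ} :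
    i ∈ allVars L ↔ ∃ l ∈ L, i ∈ bound l := by
  induction L with
  | nil => simp [allVars]
  | cons l L ih => simp [allVars, ih]

theorem mem_bound {l : List (Scan ℓ)} {i : Fin ℓ} : i ∈ bound l ↔ ∃ σ ∈ l, i ∈ σ.args := by
  induction l with
  | nil => simp [bound]
  | cons σ l ih => simp [bound, ih]

/-- The equations of the predicate symbols from `b` to `e`. -/
def Solves {D : Type*} [CommSemiring D] {I : Database S} (A : I.Weighting D) (dl : List ℕ)
    (Ts : List (Template S)) (b e : ℕ) (Y : GroundIDB → D) : Prop :=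
  ∀ s, b ≤ s → s < e → ∀ l, Y (s, l) = (Ts.map (Template.rhs A dl Y (s, l))).sum

theorem rhs_eq_zero {D : Type*} [CommSemiring D] {I : Database S} (A : I.Weighting D)
    (dl : List ℕ) (Y : GroundIDB → D) {s : ℕ} (l : List ℕ) {τ : Template S} (h : τ.head ≠ s) :
    τ.rhs A dl Y (s, l) = 0 := by
  have : ∀ v : Fin τ.numVars → ℕ, (τ.head, τ.headArgs.map v) ≠ (s, l) := fun v hv =>
    h (congrArg Prod.fst hv)
  simp [Template.rhs, this]

theorem sum_rhs_eq_zero {D : Type*} [CommSemiring D] {I : Database S} (A : I.Weighting D)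
    (dl : List ℕ) (Y : GroundIDB → D) {s : ℕ} (l : List ℕ) {Ts : List (Template S)}
    (h : ∀ τ ∈ Ts, τ.head ≠ s) : (Ts.map (Template.rhs A dl Y (s, l))).sum = 0 := by
  refine List.sum_eq_zero fun x hx => ?_
  obtain ⟨τ, hτ, rfl⟩ := List.mem_map.1 hx
  exact rhs_eq_zero A dl Y l (h τ hτ)

theorem TAtom.ground_congr {a : TAtom S ℓ} {v w : Fin ℓ → ℕ} (h : ∀ i ∈ a.vars, v i = w i) :
    a.ground v = a.ground w := by
  cases a with
  | edb R args =>
    have : v ∘ args = w ∘ args := funext fun j => h _ ((List.mem_ofFn' _ _).2 ⟨j, rfl⟩)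
    simp [TAtom.ground, this]
  | idb s args =>
    have : args.map v = args.map w := List.map_congr_left h
    simp [TAtom.ground, this]

theorem map_ground_congr {D : Type*} [CommSemiring D] {I : Database S} (A : I.Weighting D)
    (Y : GroundIDB → D) {Q : List (TAtom S ℓ)} {v w : Fin ℓ → ℕ}
    (h : ∀ a ∈ Q, ∀ i ∈ a.vars, v i = w i) :
    (Q.map fun a => (a.ground v).value A Y) = Q.map fun a => (a.ground w).value A Y :=
  List.map_congr_left fun a ha => by rw [TAtom.ground_congr (h a ha)]

/-- The condition that an assignment matches the tables of all scans of a bag. -/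
def Matches (tbl : ℕ → List (List ℕ)) (l : List (Scan ℓ)) (w : Fin ℓ → ℕ) : Prop :=
  ∀ σ ∈ l, σ.args.map w ∈ tbl σ.tab

theorem Matches.congr {tbl : ℕ → List (List ℕ)} {l : List (Scan ℓ)} {v w : Fin ℓ → ℕ}
    (h : ∀ i ∈ bound l, v i = w i) : Matches tbl l v ↔ Matches tbl l w := by
  refine forall₂_congr fun σ hσ => ?_
  rw [List.map_congr_left fun i hi => h i (mem_bound.2 ⟨σ, hσ, hi⟩)]

open Classical in
theorem rhs_eq_sum {D : Type*} [CommSemiring D] {I : Database S} (A : I.Weighting D) {dl : List ℕ}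
    (hnd : dl.Nodup) (hdl : dl.toFinset = I.adom) (Y : GroundIDB → D) {B : List (Scan ℓ)}
    (hB : ScansWF S B) (s : ℕ) (ha : List (Fin ℓ)) (Q : List (TAtom S ℓ)) (c : List ℕ) :
    Template.rhs A dl Y (s, c) ⟨ℓ, B, s, ha, Q⟩ =
      ∑ w ∈ agree I.adom (bound B) 0, if ha.map w = c ∧ Matches (tables I dl) B w then
        (Q.map fun a => (a.ground w).value A Y).prod else 0 := by
  rw [Template.rhs, sum_envs I.adom (tables_nodup I hnd) (mem_adom_of_mem_tables I hdl) hB.disjoint]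
  refine Finset.sum_congr rfl fun w _ => ?_
  have h1 : ((s, ha.map w) = (s, c)) ↔ ha.map w = c := by simp
  have h2 : (∀ σ ∈ B, σ.args.map w ∈ tables I dl σ.tab) ↔ Matches (tables I dl) B w := Iff.rfl
  simp only [h1, h2]
  by_cases c1 : ha.map w = c <;> by_cases c2 : Matches (tables I dl) B w
  · rw [if_pos c2, if_pos c1, if_pos ⟨c1, c2⟩]
  · rw [if_neg c2, if_neg fun h => c2 h.2]
  · rw [if_pos c2, if_neg c1, if_neg fun h => c1 h.1]
  · rw [if_neg c2, if_neg fun h => c2 h.2]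

open Classical in
-- Variable elimination. The first bag `B` is a leaf; its message is a fresh predicate `b` over the
-- separator `bound B ∩ U`, and its rule multiplies the atoms that no later bag covers. Those atoms
-- are replaced by the single atom of `b`, and by distributivity the sum over the private variables
-- of `B` moves into the message. The root rule has head `hs`; the interval from `b` to `e` reserves
-- the fresh symbols.
theorem exists_templates_of_rip (L : List (List (Scan ℓ))) (hne : L ≠ [])
    (hrip : RIP (L.map bound)) (hwf : ∀ l ∈ L, ScansWF S l) (Q : List (TAtom S ℓ))
    (hQ : ∀ a ∈ Q, ∃ l ∈ L, ∀ i ∈ a.vars, i ∈ bound l) (hs : ℕ) (ha : List (Fin ℓ))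
    (hroot : ∃ L₀ R, L = L₀ ++ [R] ∧ ∀ i ∈ ha, i ∈ bound R) (b : ℕ) (hb : hs < b) :
    ∃ (Ts : List (Template S)) (e : ℕ), b ≤ e ∧
      (∀ τ ∈ Ts, τ.WF ∧ ((b ≤ τ.head ∧ τ.head < e) ∨
        (τ.head = hs ∧ τ.headArgs.length = ha.length))) ∧
      ∀ (D : Type u) [CommSemiring D] (I : Database S) (A : I.Weighting D) (dl : List ℕ),
        dl.Nodup → dl.toFinset = I.adom → ∀ Y : GroundIDB → D, Solves A dl Ts b e Y →
        ∀ c, (Ts.map (Template.rhs A dl Y (hs, c))).sum =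
          ∑ w ∈ agree I.adom (allVars L) 0,
            if ha.map w = c ∧ ∀ l ∈ L, Matches (tables I dl) l w then
              (Q.map fun a => (a.ground w).value A Y).prod else 0 := by
  induction L generalizing Q b with
  | nil => exact absurd rfl hne
  | cons B L ih =>
    obtain ⟨L₀, R, hL₀, hR⟩ := hroot
    by_cases hL : L = []
    · subst hL
      have hBR : B = R := by
        rcases L₀ with _ | ⟨x, L₀⟩ <;> simp at hL₀
        exact hL₀
      subst hBR
      refine ⟨[⟨ℓ, B, hs, ha, Q⟩], b, le_rfl, ?_, ?_⟩
      · intro τ hτ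
        obtain rfl : τ = ⟨ℓ, B, hs, ha, Q⟩ := by simpa using hτ
        refine ⟨⟨hwf B (by simp), hR, fun a ha' => ?_⟩, Or.inr ⟨rfl, rfl⟩⟩
        simpa using hQ a ha'
      · intro D _ I A dl hnd hdl Y _ c
        rw [List.map_singleton, List.sum_singleton, rhs_eq_sum A hnd hdl Y (hwf B (by simp))]
        simp [allVars]
    · have hBwf := hwf B (by simp)
      set U := allVars L with hU
      obtain ⟨Z, hZ, hBZ⟩ : ∃ Z ∈ L, ∀ i ∈ bound B, i ∈ U → i ∈ bound Z := by
        rcases hrip.2 with h | ⟨Z, hZ, h⟩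
        · exact absurd (List.map_eq_nil_iff.1 h) hL
        · obtain ⟨Z, hZ', rfl⟩ := List.mem_map.1 hZ
          refine ⟨Z, hZ', fun i hi hiU => h i hi ?_⟩
          obtain ⟨l, hl, hil⟩ := mem_allVars.1 hiU
          exact ⟨bound l, List.mem_map_of_mem hl, hil⟩
      obtain ⟨L₁, hL₁⟩ : ∃ L₁, L = L₁ ++ [R] := by
        rcases L₀ with _ | ⟨x, L₀⟩
        · simp [hL] at hL₀
        · simp only [List.cons_append, List.cons.injEq] at hL₀
          exact ⟨L₀, hL₀.2⟩
      have hRL : R ∈ L := by simp [hL₁]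
      have haU : ∀ i ∈ ha, i ∈ U := fun i hi => mem_allVars.2 ⟨R, hRL, hR i hi⟩
      let cov : TAtom S ℓ → Prop := fun a => ∃ l ∈ L, ∀ i ∈ a.vars, i ∈ bound l
      let sep : List (Fin ℓ) := (bound B ∩ U).toList
      set Q₁ := Q.filter (¬ cov ·) with hQ₁
      set Q₂ := Q.filter (cov ·) with hQ₂
      have hQ₁B : ∀ a ∈ Q₁, ∀ i ∈ a.vars, i ∈ bound B := by
        intro a ha'
        rw [hQ₁, List.mem_filter, decide_eq_true_eq] at ha'
        obtain ⟨l, hl, h⟩ := hQ a ha'.1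
        rcases List.mem_cons.1 hl with rfl | hl
        · exact h
        · exact absurd ⟨l, hl, h⟩ ha'.2
      have hQ₂U : ∀ a ∈ Q₂, ∃ l ∈ L, ∀ i ∈ a.vars, i ∈ bound l := by
        intro a ha'
        rw [hQ₂, List.mem_filter, decide_eq_true_eq] at ha'
        exact ha'.2
      -- Running intersection enters here: the separator lies in the parent bag `Z`, so the new atom
      -- is covered by a later bag.
      obtain ⟨Ts, e, hbe, hTs, hsem⟩ := ih hL hrip.1 (fun l hl => hwf l (List.mem_cons_of_mem _ hl))
        (Q₂ ++ [.idb b sep]) (by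
          intro a ha'
          rcases List.mem_append.1 ha' with h | h
          · exact hQ₂U a h
          · obtain rfl : a = .idb b sep := by simpa using h
            refine ⟨Z, hZ, fun i hi => ?_⟩
            have : i ∈ bound B ∩ U := by simpa [TAtom.vars, sep] using hi
            rw [Finset.mem_inter] at this
            exact hBZ i this.1 this.2)
        ⟨L₁, R, hL₁, hR⟩ (b + 1) (by omega)
      refine ⟨⟨ℓ, B, b, sep, Q₁⟩ :: Ts, e, by omega, ?_, ?_⟩
      · intro τ hτ
        rcases List.mem_cons.1 hτ with rfl | hτ
        · refine ⟨⟨hBwf, fun i hi => ?_, hQ₁B⟩, Or.inl ⟨le_rfl, by change b < e; omega⟩⟩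
          have : i ∈ bound B ∩ U := by simpa [sep] using hi
          exact (Finset.mem_inter.1 this).1
        · obtain ⟨h1, h2⟩ := hTs τ hτ
          exact ⟨h1, by omega⟩
      · intro D _ I A dl hnd hdl Y hY c
        have hTsb : ∀ τ ∈ Ts, τ.head ≠ b := fun τ hτ => by
          have := (hTs τ hτ).2
          omega
        have hY' : Solves A dl Ts (b + 1) e Y := by
          intro s hs1 hs2 l
          rw [hY s (by omega) hs2 l, List.map_cons, List.sum_cons,
            rhs_eq_zero A dl Y l (by change b ≠ s; omega), zero_add]
        have hYb : ∀ l, Y (b, l) = Template.rhs A dl Y (b, l) ⟨ℓ, B, b, sep, Q₁⟩ := by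
          intro l
          rw [hY b le_rfl (by omega) l, List.map_cons, List.sum_cons,
            sum_rhs_eq_zero A dl Y l hTsb, add_zero]
        rw [List.map_cons, List.sum_cons, rhs_eq_zero A dl Y c (by change b ≠ hs; omega), zero_add,
          hsem D I A dl hnd hdl Y hY' c]
        have hunion : allVars (B :: L) = U ∪ bound B \ U := by
          rw [allVars, Finset.union_sdiff_self_eq_union, Finset.union_comm]
        rw [hunion, sum_agree_union _ Finset.disjoint_sdiff]
        refine Finset.sum_congr rfl fun w hw => ?_
        rw [mem_agree] at hw
        have hprod : ∀ w' : Fin ℓ → ℕ, (Q.map fun a => (a.ground w').value A Y).prod =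
            (Q₂.map fun a => (a.ground w').value A Y).prod *
              (Q₁.map fun a => (a.ground w').value A Y).prod := by
          intro w'
          exact (prod_filter_mul_prod_filter_not Q cov _).symm
        have hmsg : Y (b, sep.map w) = ∑ w' ∈ agree I.adom (bound B \ U) w,
            if Matches (tables I dl) B w' then
              (Q₁.map fun a => (a.ground w').value A Y).prod else 0 := by
          rw [hYb, rhs_eq_sum A hnd hdl Y hBwf, ← sum_agree_restrict (v := 0)
            (fun i _ hi => hw.1 i hi)]
          · refine Finset.sum_congr rfl fun w' _ => ?_
            have : sep.map w' = sep.map w ↔ ∀ i ∈ bound B ∩ U, w' i = w i := by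
              rw [List.map_inj_left]
              simp [sep]
            simp only [this, ite_and]
            congr
          · intro w₁ w₂ h
            rw [if_congr (Matches.congr h) rfl rfl,
              map_ground_congr A Y fun a ha' i hi => h i (hQ₁B a ha' i hi)]
        have heq : ∀ w' ∈ agree I.adom (bound B \ U) w, ∀ i ∈ U, w' i = w i := fun w' hw' i hi =>
          (mem_agree.1 hw').2 i (by simp [hi])
        -- The first factor depends only on the values on `U`, where `w'` and `w` agree, so it can
        -- be pulled out of the sum over `w'`.
        have hstep : ∀ w' ∈ agree I.adom (bound B \ U) w,
            (if ha.map w' = c ∧ ∀ l ∈ B :: L, Matches (tables I dl) l w' then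
              (Q.map fun a => (a.ground w').value A Y).prod else 0) =
            (if ha.map w = c ∧ ∀ l ∈ L, Matches (tables I dl) l w then
              (Q₂.map fun a => (a.ground w).value A Y).prod else 0) *
            if Matches (tables I dl) B w' then
              (Q₁.map fun a => (a.ground w').value A Y).prod else 0 := by
          intro w' hw'
          have e1 : ha.map w' = ha.map w :=
            List.map_congr_left fun i hi => heq w' hw' i (haU i hi)
          have e2 : (∀ l ∈ L, Matches (tables I dl) l w') ↔ ∀ l ∈ L, Matches (tables I dl) l w :=
            forall₂_congr fun l hl => Matches.congr fun i hi =>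
              heq w' hw' i (mem_allVars.2 ⟨l, hl, hi⟩)
          have e3 := map_ground_congr A Y (Q := Q₂) (v := w') (w := w) fun a ha' i hi => by
            obtain ⟨l, hl, h⟩ := hQ₂U a ha'
            exact heq w' hw' i (mem_allVars.2 ⟨l, hl, h i hi⟩)
          simp only [hprod w', e1, e3, List.forall_mem_cons, e2]
          by_cases c1 : ha.map w = c <;> by_cases c2 : ∀ l ∈ L, Matches (tables I dl) l w <;>
            by_cases c3 : Matches (tables I dl) B w' <;> simp [c1, c2, c3]
        rw [Finset.sum_congr rfl hstep, ← Finset.mul_sum, ← hmsg]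
        split_ifs
        · simp [TAtom.ground, GroundAtom.value]
        · simp

end Elimination

/-! ### Templates for queries and programs -/

section Queries

variable {S : Schema}

/-- The value of a query at a head tuple that is given as a list. -/
def SumProd.listValue {D : Type*} [CommSemiring D] {k : ℕ} {I : Database S} (A : I.Weighting D)
    (X : IDBValuation S D) (φ : SumProd S k) (l : List ℕ) : D :=
  ∑ v : Fin φ.numVars → I.adom,
    if List.ofFn (fun i => (v (φ.head i) : ℕ)) = l then
      (φ.body.map (Atom.value A X fun j => (v j : ℕ))).prod
    else 0

theorem SumProd.listValue_ofFn {D : Type*} [CommSemiring D] {k : ℕ} {I : Database S}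
    (A : I.Weighting D) (X : IDBValuation S D) (φ : SumProd S k) (c : Fin k → ℕ) :
    φ.listValue A X (List.ofFn c) = φ.value A X c := by
  simp only [SumProd.listValue, SumProd.value, List.ofFn_injective.eq_iff]

theorem SumProd.listValue_eq_zero {D : Type*} [CommSemiring D] {k : ℕ} {I : Database S}
    (A : I.Weighting D) (X : IDBValuation S D) (φ : SumProd S k) {l : List ℕ}
    (hl : l.length ≠ k) : φ.listValue A X l = 0 := by
  refine Finset.sum_eq_zero fun v _ => if_neg ?_
  rintro rfl
  simp at hl

def Atom.toTAtom {ℓ : ℕ} : Atom S ℓ → TAtom S ℓ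
  | .edb R args => .edb R args
  | .idb T args => .idb T (List.ofFn args)

theorem Atom.mem_vars_toTAtom {ℓ : ℕ} {a : Atom S ℓ} {i : Fin ℓ} :
    i ∈ a.toTAtom.vars ↔ i ∈ a.vars := by
  cases a <;> simp [Atom.toTAtom, TAtom.vars, Atom.vars]

theorem Atom.value_toTAtom {ℓ : ℕ} {D : Type*} [CommSemiring D] {I : Database S}
    (A : I.Weighting D) (Y : GroundIDB → D) (a : Atom S ℓ) (w : Fin ℓ → ℕ) :
    (a.toTAtom.ground w).value A Y = a.value A (restrictIDB S Y) w := by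
  cases a <;> simp [Atom.toTAtom, TAtom.ground, GroundAtom.value, Atom.value, restrictIDB,
    List.map_ofFn]

/-- A nice bag is bound by few scans over stored relations of the query and over the constants. -/
theorem exists_scans_of_nice {ℓ : ℕ} {body : List (Atom S ℓ)} {B : Finset (Fin ℓ)}
    (h : RIP.Nice (fun X => ∃ R args, Atom.edb R args ∈ body ∧ (Atom.edb R args).vars = X) B) :
    ∃ l : List (Scan ℓ), ScansWF S l ∧ bound l = B ∧ ∀ σ ∈ l,
      (∃ R args, Atom.edb R args ∈ body ∧ σ = ⟨R, List.ofFn args⟩) ∨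
        ∃ i, σ = ⟨S.numEDB, [i]⟩ := by
  have hvars : ∀ R (args : Fin (S.edbArity R) → Fin ℓ),
      (List.ofFn args).toFinset = (Atom.edb R args).vars := by
    intro R args
    ext i
    simp [Atom.vars]
  have hR : ∀ R (args : Fin (S.edbArity R) → Fin ℓ),
      ((R : ℕ) ≤ S.numEDB ∧ (List.ofFn args).length = tabArity S R) := by
    intro R args
    exact ⟨R.2.le, by simp [tabArity]⟩
  have hdom : ∀ i : Fin ℓ, S.numEDB ≤ S.numEDB ∧ [i].length = tabArity S S.numEDB := by
    intro i
    simp [tabArity]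
  rcases h with ⟨_, ⟨R, args, hmem, rfl⟩, hsub, hcard⟩ | hcard
  · rcases Nat.le_one_iff_eq_zero_or_eq_one.1 hcard with h0 | h1
    · have hB : B = (Atom.edb R args).vars :=
        Finset.Subset.antisymm (Finset.sdiff_eq_empty_iff_subset.1 (Finset.card_eq_zero.1 h0)) hsub
      refine ⟨[⟨R, List.ofFn args⟩], ⟨by simp [ScansDisjoint, bound], ?_, ?_⟩, ?_, ?_⟩
      · simpa using hR R args
      · exact Or.inr ⟨_, Or.inl rfl⟩
      · simp [bound, hvars, hB]
      · intro σ hσ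
        exact Or.inl ⟨R, args, hmem, by simpa using hσ⟩
    · obtain ⟨i, hi⟩ := Finset.card_eq_one.1 h1
      refine ⟨[⟨R, List.ofFn args⟩, ⟨S.numEDB, [i]⟩], ⟨?_, ?_, ?_⟩, ?_, ?_⟩
      · refine ⟨?_, by simp [ScansDisjoint, bound]⟩
        have : i ∈ B \ (Atom.edb R args).vars := by simp [hi]
        rw [hvars]
        simpa [bound] using (Finset.mem_sdiff.1 this).2
      · intro σ hσ
        simp only [List.mem_cons, List.not_mem_nil, or_false] at hσ
        rcases hσ with rfl | rfl
        exacts [hR R args, hdom i]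
      · exact Or.inr ⟨_, Or.inr ⟨i, rfl⟩⟩
      · rw [bound, bound, bound, hvars, Finset.union_empty, List.toFinset_cons, List.toFinset_nil,
          LawfulSingleton.insert_empty_eq, ← hi, Finset.union_sdiff_of_subset hsub]
      · intro σ hσ
        simp only [List.mem_cons, List.not_mem_nil, or_false] at hσ
        exact hσ.imp (fun h => ⟨R, args, hmem, h⟩) fun h => ⟨i, h⟩
  · have h3 : B.card = 0 ∨ B.card = 1 ∨ B.card = 2 := by omega
    rcases h3 with h0 | h1 | h2
    · exact ⟨[], ⟨trivial, by simp, Or.inl rfl⟩, (Finset.card_eq_zero.1 h0).symm, by simp⟩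
    · obtain ⟨i, rfl⟩ := Finset.card_eq_one.1 h1
      refine ⟨[⟨S.numEDB, [i]⟩], ⟨by simp [ScansDisjoint, bound], ?_, Or.inr ⟨_, Or.inl rfl⟩⟩,
        by simp [bound], fun σ hσ => Or.inr ⟨i, by simpa using hσ⟩⟩
      simpa using hdom i
    · obtain ⟨i, j, hij, rfl⟩ := Finset.card_eq_two.1 h2
      refine ⟨[⟨S.numEDB, [i]⟩, ⟨S.numEDB, [j]⟩],
        ⟨by simp [ScansDisjoint, bound, hij], ?_, Or.inr ⟨_, Or.inr ⟨j, rfl⟩⟩⟩,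
        by ext; simp [bound], ?_⟩
      · intro σ hσ
        simp only [List.mem_cons, List.not_mem_nil, or_false] at hσ
        rcases hσ with rfl | rfl
        exacts [hdom i, hdom j]
      · intro σ hσ
        simp only [List.mem_cons, List.not_mem_nil, or_false] at hσ
        rcases hσ with rfl | rfl
        exacts [Or.inr ⟨i, rfl⟩, Or.inr ⟨j, rfl⟩]

/-- The join tree is refined by `RIP.exists_niceCover`, with the head variables in the root; each
bag is bound by cheap scans, and elimination is applied to the result. -/
theorem exists_templates_of_query {k : ℕ} (φ : SumProd S k) (hac : φ.IsAcyclic)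
    (hlin : (φ.body.filter Atom.isIDB).length ≤ 1) (hk : k ≤ 2) (hidb : ∀ T, S.idbArity T ≤ 2)
    (hs b : ℕ) (hb : hs < b) :
    ∃ (Ts : List (Template S)) (e : ℕ), b ≤ e ∧
      (∀ τ ∈ Ts, τ.WF ∧ ((b ≤ τ.head ∧ τ.head < e) ∨
        (τ.head = hs ∧ τ.headArgs.length = k))) ∧
      ∀ (D : Type u) [CommSemiring D] (I : Database S) (A : I.Weighting D) (dl : List ℕ),
        dl.Nodup → dl.toFinset = I.adom → ∀ Y : GroundIDB → D, Solves A dl Ts b e Y →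
        ∀ c, (Ts.map (Template.rhs A dl Y (hs, c))).sum = φ.listValue A (restrictIDB S Y) c := by
  classical
  obtain ⟨N, 𝒯, χ, hT⟩ := hac
  obtain ⟨L, hne, hrip, hmem⟩ := RIP.of_isTreeDecomposition hT.toIsTreeDecomposition
  have hcover : ∀ a ∈ φ.body, ∃ X ∈ L, a.vars ⊆ X := by
    intro a ha
    obtain ⟨t, ht⟩ := hT.cover a.vars ⟨a, ha, rfl⟩
    exact ⟨χ t, (hmem _).2 ⟨t, rfl⟩, ht⟩
  have hall : ∀ i, ∃ X ∈ L, i ∈ X := by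
    intro i
    obtain ⟨t, ht⟩ := (hT.running i).nonempty
    exact ⟨χ t, (hmem _).2 ⟨t, rfl⟩, ht⟩
  obtain ⟨t, ht, hLt⟩ : ∃ t : Finset (Fin φ.numVars), t.card ≤ 2 ∧
      ∀ X ∈ L, (∃ R args, Atom.edb R args ∈ φ.body ∧ (Atom.edb R args).vars = X) ∨ X = t := by
    have hcase : ∀ X ∈ L, (∃ R args, Atom.edb R args ∈ φ.body ∧ (Atom.edb R args).vars = X) ∨
        ∃ a ∈ φ.body.filter Atom.isIDB, a.vars = X := by
      intro X hX
      obtain ⟨t, rfl⟩ := (hmem X).1 hX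
      obtain ⟨a, ha, hav⟩ := hT.bag_mem t
      cases a with
      | edb R args => exact Or.inl ⟨R, args, ha, hav⟩
      | idb T args => exact Or.inr ⟨_, List.mem_filter.2 ⟨ha, rfl⟩, hav⟩
    rcases hf : φ.body.filter Atom.isIDB with _ | ⟨a, l⟩
    · refine ⟨∅, by simp, fun X hX => ?_⟩
      rcases hcase X hX with h | ⟨a, ha, -⟩
      · exact Or.inl h
      · simp [hf] at ha
    · have hl : l = [] := by
        rw [hf, List.length_cons] at hlin
        exact List.eq_nil_of_length_eq_zero (by omega)
      refine ⟨a.vars, ?_, fun X hX => ?_⟩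
      · have ha : a ∈ φ.body.filter Atom.isIDB := by simp [hf]
        cases a with
        | edb R args => simp [Atom.isIDB] at ha
        | idb T args =>
          refine Finset.card_image_le.trans ?_
          simpa using hidb T
      · rcases hcase X hX with h | ⟨a', ha', rfl⟩
        · exact Or.inl h
        · rw [hf, hl, List.mem_singleton] at ha'
          exact Or.inr (ha' ▸ rfl)
  obtain ⟨L', hL'⟩ := RIP.exists_niceCover hrip hne ht hLt (H := Finset.univ.image φ.head)
    (Finset.card_image_le.trans (by simpa using hk)) fun i _ => hall i
  have hex : ∀ B : Finset (Fin φ.numVars), ∃ l : List (Scan φ.numVars), B ∈ L' →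
      ScansWF S l ∧ bound l = B ∧ ∀ σ ∈ l,
        (∃ R args, Atom.edb R args ∈ φ.body ∧ σ = ⟨R, List.ofFn args⟩) ∨
          ∃ i, σ = ⟨S.numEDB, [i]⟩ := by
    intro B
    by_cases hB : B ∈ L'
    · obtain ⟨l, hl⟩ := exists_scans_of_nice (hL'.nice B hB)
      exact ⟨l, fun _ => hl⟩
    · exact ⟨[], fun h => absurd h hB⟩
  choose g hg using hex
  have hgb : (L'.map g).map bound = L' := by
    rw [List.map_map]
    exact (List.map_congr_left fun B hB => (hg B hB).2.1).trans (List.map_id L')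
  obtain ⟨L₀, R, hR, hHR⟩ := hL'.root
  have hRL' : R ∈ L' := by simp [hR]
  have hcov' : ∀ X ∈ L, ∃ l ∈ L'.map g, X ⊆ bound l := by
    intro X hX
    obtain ⟨B, hB, hXB⟩ := hL'.cover X hX
    exact ⟨g B, List.mem_map_of_mem hB, by rwa [(hg B hB).2.1]⟩
  obtain ⟨Ts, e, hbe, hTs, hsem⟩ := exists_templates_of_rip.{u} (S := S) (L'.map g)
    (by simp [hR]) (by rw [hgb]; exact hL'.rip)
    (by
      intro l hl
      obtain ⟨B, hB, rfl⟩ := List.mem_map.1 hl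
      exact (hg B hB).1)
    (φ.body.map Atom.toTAtom)
    (by
      intro a ha
      obtain ⟨a, ha', rfl⟩ := List.mem_map.1 ha
      obtain ⟨X, hX, haX⟩ := hcover a ha'
      obtain ⟨l, hl, hXl⟩ := hcov' X hX
      exact ⟨l, hl, fun i hi => hXl (haX (Atom.mem_vars_toTAtom.1 hi))⟩)
    hs (List.ofFn φ.head)
    ⟨L₀.map g, g R, by simp [hR], fun i hi => by
      rw [(hg R hRL').2.1]
      exact hHR (by simpa [List.mem_ofFn'] using hi)⟩ b hb
  refine ⟨Ts, e, hbe, fun τ hτ => by simpa using hTs τ hτ, ?_⟩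
  intro D _ I A dl hnd hdl Y hY c
  have huniv : allVars (L'.map g) = Finset.univ := by
    refine Finset.eq_univ_of_forall fun i => ?_
    obtain ⟨X, hX, hi⟩ := hall i
    obtain ⟨l, hl, h⟩ := hcov' X hX
    exact mem_allVars.2 ⟨l, hl, h hi⟩
  rw [hsem D I A dl hnd hdl Y hY c, huniv, SumProd.listValue]
  symm
  refine Finset.sum_nbij (fun v i => (v i : ℕ)) ?_ ?_ ?_ ?_
  · intro v _
    rw [mem_agree]
    exact ⟨fun i _ => (v i).2, fun i hi => absurd (Finset.mem_univ i) hi⟩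
  · intro v _ v' _ h
    funext i
    exact Subtype.ext (congrFun h i)
  · intro w hw
    have := (mem_agree.1 (Finset.mem_coe.1 hw)).1
    exact ⟨fun i => ⟨w i, this i (Finset.mem_univ i)⟩, by simp, rfl⟩
  · intro v _
    set w : Fin φ.numVars → ℕ := fun i => (v i : ℕ) with hw
    have hprod : ((φ.body.map Atom.toTAtom).map fun a => (a.ground w).value A Y) =
        φ.body.map (Atom.value A (restrictIDB S Y) w) := by
      rw [List.map_map]
      exact List.map_congr_left fun a _ => Atom.value_toTAtom A Y a w
    have hhead : (List.ofFn φ.head).map w = List.ofFn fun i => w (φ.head i) := by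
      rw [List.map_ofFn]; rfl
    rw [hprod, hhead]
    by_cases h1 : (List.ofFn fun i => w (φ.head i)) = c
    · by_cases h2 : ∀ l ∈ L'.map g, Matches (tables I dl) l w
      · rw [if_pos h1, if_pos ⟨h1, h2⟩]
      · rw [if_pos h1, if_neg fun h => h2 h.2]
        simp only [Matches] at h2
        push Not at h2
        obtain ⟨l, hl, σ, hσ, hno⟩ := h2
        obtain ⟨B, hB, rfl⟩ := List.mem_map.1 hl
        rcases (hg B hB).2.2 σ hσ with ⟨R', args, hmem', rfl⟩ | ⟨i, rfl⟩
        · refine List.prod_eq_zero (List.mem_map.2 ⟨_, hmem', ?_⟩)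
          refine A.zero_of_notMem _ _ fun hin => hno ?_
          rw [tables, dif_pos R'.2, List.map_ofFn]
          exact List.mem_map_of_mem hin
        · refine absurd ?_ hno
          rw [tables, dif_neg (lt_irrefl _)]
          refine List.mem_map.2 ⟨w i, ?_, rfl⟩
          rw [← List.mem_toFinset, hdl]
          exact (v i).2
    · rw [if_neg h1, if_neg fun h => h1 h.1]

/-- The queries use consecutive intervals of fresh symbols, so the message equations of one query
are unaffected by the templates of the others, while contributions to a common IDB head add up. -/
theorem exists_templates_of_queries (qs : List (Σ T : Fin S.numIDB, SumProd S (S.idbArity T)))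
    (hac : ∀ q ∈ qs, q.2.IsAcyclic) (hlin : ∀ q ∈ qs, (q.2.body.filter Atom.isIDB).length ≤ 1)
    (hidb : ∀ T, S.idbArity T ≤ 2) (b : ℕ) (hb : S.numIDB ≤ b) :
    ∃ (Ts : List (Template S)) (e : ℕ), b ≤ e ∧
      (∀ τ ∈ Ts, τ.WF ∧ ((b ≤ τ.head ∧ τ.head < e) ∨
        ∃ T : Fin S.numIDB, τ.head = T ∧ τ.headArgs.length = S.idbArity T)) ∧
      ∀ (D : Type u) [CommSemiring D] (I : Database S) (A : I.Weighting D) (dl : List ℕ),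
        dl.Nodup → dl.toFinset = I.adom → ∀ Y : GroundIDB → D, Solves A dl Ts b e Y →
        ∀ (T : Fin S.numIDB) c, (Ts.map (Template.rhs A dl Y ((T : ℕ), c))).sum =
          (qs.map fun q => if q.1 = T then q.2.listValue A (restrictIDB S Y) c else 0).sum := by
  induction qs generalizing b with
  | nil => exact ⟨[], b, le_rfl, by simp, by simp⟩
  | cons q qs ih =>
    obtain ⟨Ts₁, e₁, hbe₁, hTs₁, hsem₁⟩ := exists_templates_of_query.{u} q.2 (hac q (by simp))
      (hlin q (by simp)) (hidb _) hidb q.1 b (q.1.2.trans_le hb)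
    obtain ⟨Ts₂, e₂, hbe₂, hTs₂, hsem₂⟩ := ih (fun q hq => hac q (List.mem_cons_of_mem _ hq))
      (fun q hq => hlin q (List.mem_cons_of_mem _ hq)) e₁ (hb.trans hbe₁)
    refine ⟨Ts₁ ++ Ts₂, e₂, hbe₁.trans hbe₂, ?_, ?_⟩
    · intro τ hτ
      rcases List.mem_append.1 hτ with h | h
      · obtain ⟨h1, h2⟩ := hTs₁ τ h
        refine ⟨h1, ?_⟩
        rcases h2 with h2 | h2
        · exact Or.inl ⟨h2.1, by omega⟩
        · exact Or.inr ⟨q.1, h2⟩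
      · obtain ⟨h1, h2⟩ := hTs₂ τ h
        exact ⟨h1, h2.imp_left fun h => by omega⟩
    · intro D _ I A dl hnd hdl Y hY T c
      have hY₁ : Solves A dl Ts₁ b e₁ Y := by
        intro s hs1 hs2 l
        rw [hY s hs1 (by omega) l, List.map_append, List.sum_append,
          sum_rhs_eq_zero A dl Y l (Ts := Ts₂), add_zero]
        intro τ hτ
        rcases (hTs₂ τ hτ).2 with h | ⟨T', h, -⟩
        · omega
        · have := T'.2
          omega
      have hY₂ : Solves A dl Ts₂ e₁ e₂ Y := by
        intro s hs1 hs2 l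
        rw [hY s (by omega) (by omega) l, List.map_append, List.sum_append,
          sum_rhs_eq_zero A dl Y l (Ts := Ts₁), zero_add]
        intro τ hτ
        have := q.1.2
        rcases (hTs₁ τ hτ).2 with h | h <;> omega
      rw [List.map_append, List.sum_append, hsem₂ D I A dl hnd hdl Y hY₂ T c, List.map_cons,
        List.sum_cons]
      congr 1
      by_cases hT : q.1 = T
      · subst hT
        rw [hsem₁ D I A dl hnd hdl Y hY₁ c, if_pos rfl]
      · rw [if_neg hT]
        refine sum_rhs_eq_zero A dl Y c fun τ hτ => ?_
        have h1 := T.2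
        rcases (hTs₁ τ hτ).2 with h | h
        · omega
        · rw [h.1]
          exact fun h' => hT (Fin.ext h')

/-- A linear rulewise-acyclic program of arity at most two has a list of templates whose ground
rules are an equivalent grounding, on every database. -/
theorem Program.exists_templates (P : Program) (hlin : P.IsLinear) (hac : P.IsRulewiseAcyclic)
    (har : P.arity ≤ 2) :
    ∃ Ts : List (Template P.schema), (∀ τ ∈ Ts, τ.WF) ∧
      ∀ (I : Database P.schema) (dl : List ℕ), dl.Nodup → dl.toFinset = I.adom →
        ∀ (D : Type u) [CommSemiring D] [PartialOrder D] [OmegaContinuousSemiring D],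
          Grounding.IsEquivalent (P := P) (I := I)
            (Ts.flatMap fun τ => τ.ground (tables I dl)) D := by
  have hidb : ∀ T, P.schema.idbArity T ≤ 2 := fun T =>
    (Finset.le_sup (f := P.schema.idbArity) (Finset.mem_univ T)).trans har
  let qs : List (Σ T : Fin P.schema.numIDB, SumProd P.schema (P.schema.idbArity T)) :=
    (List.finRange P.schema.numIDB).flatMap fun T => (P.rules T).map fun φ => ⟨T, φ⟩
  have hqs : ∀ q ∈ qs, q.2 ∈ P.rules q.1 := by
    intro q hq
    obtain ⟨T, -, hq⟩ := List.mem_flatMap.1 hq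
    obtain ⟨φ, hφ, rfl⟩ := List.mem_map.1 hq
    exact hφ
  obtain ⟨Ts, e, -, hTs, hsem⟩ := exists_templates_of_queries.{u} qs
    (fun q hq => hac q.1 q.2 (hqs q hq)) (fun q hq => hlin q.1 q.2 (hqs q hq)) hidb
    P.schema.numIDB le_rfl
  refine ⟨Ts, fun τ hτ => (hTs τ hτ).1, fun I dl hnd hdl D _ _ _ => ?_⟩
  refine Grounding.isEquivalent_of_ico _ fun A Y hY => ?_
  simp only [ico_flatMap_ground] at hY ⊢
  have hrhs := hsem D I A dl hnd hdl Y fun s hs _ l => hY (s, l) hs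
  have hsum : ∀ (T : Fin P.schema.numIDB) c,
      (qs.map fun q => if q.1 = T then q.2.listValue A (restrictIDB P.schema Y) c else 0).sum =
        ((P.rules T).map fun φ => φ.listValue A (restrictIDB P.schema Y) c).sum := by
    intro T c
    have h1 : ∀ T' : Fin P.schema.numIDB,
        (((P.rules T').map fun φ => (⟨T', φ⟩ : Σ T, SumProd P.schema (P.schema.idbArity T))).map
          fun q => if q.1 = T then q.2.listValue A (restrictIDB P.schema Y) c else 0).sum =
        if T' = T then
          ((P.rules T').map fun φ => φ.listValue A (restrictIDB P.schema Y) c).sum else 0 := by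
      intro T'
      rw [List.map_map]
      by_cases h : T' = T
      · simp [h, Function.comp_def]
      · simp [h, Function.comp_def]
    rw [List.map_flatMap, List.flatMap, List.sum_flatten, List.map_map]
    simp only [Function.comp_def, h1]
    rw [← List.ofFn_eq_map, List.sum_ofFn, Finset.sum_ite_eq' Finset.univ T]
    simp
  refine ⟨fun T c => ?_, fun T l hl => ?_⟩
  · rw [hrhs T, hsum, Program.ico]
    simp only [SumProd.listValue_ofFn]
  · rw [hrhs T, hsum]
    refine List.sum_eq_zero fun x hx => ?_
    obtain ⟨φ, -, rfl⟩ := List.mem_map.1 hx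
    exact φ.listValue_eq_zero A _ hl

end Queries

/-! ### Reasoning about word-RAM programs -/

/-- From `s`, the program `c` halts after at most `b` steps in a state that satisfies `Q`. -/
def Runs (W : ℕ) (c : Cmd) (s : State) (b : ℕ) (Q : State → Prop) : Prop :=
  ∃ s' t, Exec W c s s' t ∧ t ≤ b ∧ Q s'

namespace Runs

variable {W : ℕ}

theorem mono {c : Cmd} {s : State} {b b' : ℕ} {Q Q' : State → Prop} (h : Runs W c s b Q)
    (hb : b ≤ b') (hQ : ∀ s', Q s' → Q' s') : Runs W c s b' Q' := by
  obtain ⟨s', t, he, ht, hq⟩ := h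
  exact ⟨s', t, he, ht.trans hb, hQ _ hq⟩

/-- Continuation form: the rest of the program is the postcondition of its first command, so the
intermediate state need not be named. -/
theorem seq {c₁ c₂ : Cmd} {s : State} {b₁ b₂ : ℕ} {Q : State → Prop}
    (h : Runs W c₁ s b₁ fun s' => Runs W c₂ s' b₂ Q) : Runs W (.seq c₁ c₂) s (b₁ + b₂) Q := by
  obtain ⟨s₁, t₁, he₁, ht₁, s₂, t₂, he₂, ht₂, hQ⟩ := h
  exact ⟨s₂, _, .seq he₁ he₂, Nat.add_le_add ht₁ ht₂, hQ⟩

theorem const {r c : ℕ} {s : State} {Q : State → Prop} (hc : c < W)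
    (h : Q { s with reg := Function.update s.reg r c }) : Runs W (.const r c) s 1 Q := by
  refine ⟨_, _, .const r c s, le_rfl, ?_⟩
  rwa [Nat.mod_eq_of_lt hc]

theorem add {r a b : ℕ} {s : State} {Q : State → Prop} (hc : s.reg a + s.reg b < W)
    (h : Q { s with reg := Function.update s.reg r (s.reg a + s.reg b) }) :
    Runs W (.op .add r a b) s 1 Q := by
  refine ⟨_, _, .op .add r a b s, le_rfl, ?_⟩
  rwa [BinOp.eval, Nat.mod_eq_of_lt hc]

theorem mul {r a b : ℕ} {s : State} {Q : State → Prop} (hc : s.reg a * s.reg b < W)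
    (h : Q { s with reg := Function.update s.reg r (s.reg a * s.reg b) }) :
    Runs W (.op .mul r a b) s 1 Q := by
  refine ⟨_, _, .op .mul r a b s, le_rfl, ?_⟩
  rwa [BinOp.eval, Nat.mod_eq_of_lt hc]

theorem load {r a : ℕ} {s : State} {Q : State → Prop}
    (h : Q { s with reg := Function.update s.reg r (s.mem (s.reg a)) }) :
    Runs W (.load r a) s 1 Q :=
  ⟨_, _, .load r a s, le_rfl, h⟩

theorem store {r a : ℕ} {s : State} {Q : State → Prop}
    (h : Q { s with mem := Function.update s.mem (s.reg a) (s.reg r) }) :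
    Runs W (.store a r) s 1 Q :=
  ⟨_, _, .store a r s, le_rfl, h⟩

theorem emit {r : ℕ} {s : State} {Q : State → Prop}
    (h : Q { s with out := s.out ++ [s.reg r] }) : Runs W (.emit r) s 1 Q :=
  ⟨_, _, .emit r s, le_rfl, h⟩

theorem branch {a b : ℕ} {c₁ c₂ : Cmd} {s : State} {n : ℕ} {Q : State → Prop}
    (h₁ : s.reg a < s.reg b → Runs W c₁ s n Q) (h₂ : ¬ s.reg a < s.reg b → Runs W c₂ s n Q) :
    Runs W (.branch a b c₁ c₂) s (n + 1) Q := by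
  by_cases h : s.reg a < s.reg b
  · obtain ⟨s', t, he, ht, hq⟩ := h₁ h
    exact ⟨s', _, .branch_true h he, by omega, hq⟩
  · obtain ⟨s', t, he, ht, hq⟩ := h₂ h
    exact ⟨s', _, .branch_false h he, by omega, hq⟩

theorem loop_done {a b : ℕ} {c : Cmd} {s : State} {Q : State → Prop} (h : ¬ s.reg a < s.reg b)
    (hQ : Q s) : Runs W (.loop a b c) s 1 Q :=
  ⟨s, 1, .loop_done h, le_rfl, hQ⟩

theorem loop_step {a b : ℕ} {c : Cmd} {s : State} {n m : ℕ} {Q : State → Prop}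
    (h : s.reg a < s.reg b) (hc : Runs W c s n fun s' => Runs W (.loop a b c) s' m Q) :
    Runs W (.loop a b c) s (n + m + 1) Q := by
  obtain ⟨s₁, t₁, he₁, ht₁, s₂, t₂, he₂, ht₂, hQ⟩ := hc
  exact ⟨s₂, _, .loop_step h he₁ he₂, by omega, hQ⟩

end Runs

/-- The list `l` stands in memory from address `p` on. -/
def MemAt (mem : ℕ → ℕ) : ℕ → List ℕ → Prop
  | _, [] => True
  | p, a :: l => mem p = a ∧ MemAt mem (p + 1) l

theorem memAt_append {mem : ℕ → ℕ} {l₁ l₂ : List ℕ} {p : ℕ} :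
    MemAt mem p (l₁ ++ l₂) ↔ MemAt mem p l₁ ∧ MemAt mem (p + l₁.length) l₂ := by
  induction l₁ generalizing p with
  | nil => simp [MemAt]
  | cons a l₁ ih =>
    simp only [List.cons_append, MemAt, ih, List.length_cons, and_assoc]
    rw [show p + 1 + l₁.length = p + (l₁.length + 1) by ring]

theorem MemAt.congr {mem mem' : ℕ → ℕ} {l : List ℕ} {p : ℕ} (h : MemAt mem p l)
    (hm : ∀ i, p ≤ i → i < p + l.length → mem' i = mem i) : MemAt mem' p l := by
  induction l generalizing p with
  | nil => trivial
  | cons a l ih =>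
    rw [List.length_cons] at hm
    exact ⟨(hm p le_rfl (by omega)).trans h.1, ih h.2 fun i h1 h2 => hm i (by omega) (by omega)⟩

/-- Memory and the registers in `F` are unchanged. -/
structure Frame (F : ℕ → Prop) (s s' : State) : Prop where
  mem : s'.mem = s.mem
  reg : ∀ r, F r → s'.reg r = s.reg r

theorem Frame.refl {F : ℕ → Prop} (s : State) : Frame F s s := ⟨rfl, fun _ _ => rfl⟩

theorem Frame.trans {F : ℕ → Prop} {s₁ s₂ s₃ : State} (h : Frame F s₁ s₂) (h' : Frame F s₂ s₃) :
    Frame F s₁ s₃ :=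
  ⟨h'.mem.trans h.mem, fun r hr => (h'.reg r hr).trans (h.reg r hr)⟩

theorem Frame.mono {F F' : ℕ → Prop} {s s' : State} (h : Frame F s s') (hF : ∀ r, F' r → F r) :
    Frame F' s s' :=
  ⟨h.mem, fun r hr => h.reg r (hF r hr)⟩

/-! ### The program that executes a template

Register `8 * i` holds variable `i`; registers `8 * d + 1` and `8 * d + 5` hold the pointer and the
counter of the loop at depth `d`; registers `8 * k + 2` and `8 * k + 3` hold the address and the
number of rows of table `k`; registers `4` and `12` hold `1` and `0`; registers `20`, `28` and `36`
are scratch. -/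

/-- A step without effect. -/
def skipCmd : Cmd := .const 20 0

/-- Load `mem[p + j]` into `r`. -/
def fetch (r p j : ℕ) : Cmd := .seq (.const 28 j) (.seq (.op .add 28 p 28) (.load r 28))

/-- A word of the code of a rule, possibly depending on the variables. -/
inductive Tok (ℓ : ℕ) where
  | const (c : ℕ)
  | var (i : Fin ℓ)

def Tok.eval {ℓ : ℕ} (v : Fin ℓ → ℕ) : Tok ℓ → ℕ
  | .const c => c
  | .var i => v i

/-- Emit a list of tokens. -/
def emitToks {ℓ : ℕ} : List (Tok ℓ) → Cmd
  | [] => skipCmd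
  | .const c :: l => .seq (.const 20 c) (.seq (.emit 20) (emitToks l))
  | .var i :: l => .seq (.emit (8 * i)) (emitToks l)

/-- Load the row at `p` into the variables. -/
def loadRow {ℓ : ℕ} (p : ℕ) : ℕ → List (Fin ℓ) → Cmd
  | _, [] => skipCmd
  | j, i :: l => .seq (fetch (8 * i) p j) (loadRow p (j + 1) l)

/-- Run `c` if the row at `p` matches the variables. -/
def checkRow {ℓ : ℕ} (p : ℕ) (c : Cmd) : ℕ → List (Fin ℓ) → Cmd
  | _, [] => c
  | j, i :: l => .seq (fetch 36 p j)
      (.branch 36 (8 * i) skipCmd (.branch (8 * i) 36 skipCmd (checkRow p c (j + 1) l)))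

/-- Nested loops over the tables; the innermost body emits `toks`. -/
def scanCode {ℓ : ℕ} (toks : List (Tok ℓ)) : ℕ → List (Scan ℓ) → Cmd
  | _, [] => emitToks toks
  | d, σ :: l => .seq (.op .add (8 * d + 1) (8 * σ.tab + 2) 12) (.seq (.const (8 * d + 5) 0)
      (.loop (8 * d + 5) (8 * σ.tab + 3) (.seq (loadRow (8 * d + 1) 0 σ.args)
        (.seq (checkRow (8 * d + 1) (scanCode toks (d + 1) l) 0 σ.args)
          (.seq (.const 28 σ.args.length) (.seq (.op .add (8 * d + 1) (8 * d + 1) 28)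
            (.op .add (8 * d + 5) (8 * d + 5) 4)))))))

theorem runs_fetch {W r p j : ℕ} {s : State} {Q : State → Prop} (hp : p ≠ 28)
    (hW : s.reg p + j < W)
    (h : Q { s with reg := Function.update (Function.update s.reg 28 (s.reg p + j)) r
                     (s.mem (s.reg p + j)) }) :
    Runs W (fetch r p j) s 3 Q := by
  refine Runs.seq (b₁ := 1) (b₂ := 2) (.const (by omega) (Runs.seq (b₁ := 1) (b₂ := 1) ?_))
  refine .add ?_ (.load ?_)
  · simpa [hp] using hW
  · simpa [hp] using h

theorem runs_emitToks {W ℓ : ℕ} (hW : 0 < W) {toks : List (Tok ℓ)}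
    (hc : ∀ c, Tok.const c ∈ toks → c < W) (s : State) :
    Runs W (emitToks toks) s (2 * toks.length + 1) fun s' => Frame (· ≠ 20) s s' ∧
      s'.out = s.out ++ toks.map (Tok.eval fun i => s.reg (8 * i)) := by
  induction toks generalizing s with
  | nil => exact .const hW ⟨⟨rfl, fun r hr => by simp [hr]⟩, by simp⟩
  | cons a toks ih =>
    have ih := ih fun c h => hc c (List.mem_cons_of_mem _ h)
    cases a with
    | const c =>
      refine Runs.mono (b := 1 + (1 + (2 * toks.length + 1))) (.seq (.const (hc c (by simp))
        (.seq (.emit (ih _)))) ) (by simp; omega) fun s' hs' => ⟨⟨hs'.1.mem, fun r hr => ?_⟩, ?_⟩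
      · rw [hs'.1.reg r hr]; simp [hr]
      · rw [hs'.2, List.append_assoc]
        congr 1
        simp only [Function.update_self, List.cons_append, List.nil_append, List.map_cons]
        congr 1
        refine List.map_congr_left fun a _ => ?_
        cases a with
        | const c => rfl
        | var i => exact Function.update_of_ne (by omega) _ _
    | var i =>
      refine Runs.mono (b := 1 + (2 * toks.length + 1)) (.seq (.emit (ih _)))
        (by simp; omega) fun s' hs' => ⟨⟨hs'.1.mem, hs'.1.reg⟩, ?_⟩
      rw [hs'.2, List.append_assoc]
      rfl

theorem runs_loadRow {W ℓ p : ℕ} (hp : p % 8 = 1) {l : List (Fin ℓ)} {t : List ℕ}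
    (hlen : t.length = l.length) {j : ℕ} (s : State) (hmem : MemAt s.mem (s.reg p + j) t)
    (hW : s.reg p + j + t.length < W) :
    Runs W (loadRow p j l) s (3 * l.length + 1) fun s' =>
      Frame (fun r => r % 8 ≠ 0 ∧ r ≠ 20 ∧ r ≠ 28) s s' ∧ s'.out = s.out ∧
      (fun i : Fin ℓ => s'.reg (8 * i)) = assign (fun i => s.reg (8 * i)) l t := by
  induction l generalizing t j s with
  | nil =>
    refine .const (by omega) ⟨⟨rfl, fun r hr => by simp [hr.2.1]⟩, rfl, ?_⟩
    funext i
    cases t <;> exact Function.update_of_ne (by omega) _ _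
  | cons i l ih =>
    cases t with
    | nil => simp at hlen
    | cons a t =>
      simp only [List.length_cons, Nat.add_right_cancel_iff] at hlen hW
      refine Runs.mono (b := 3 + (3 * l.length + 1)) (.seq (runs_fetch (by omega) (by omega) ?_))
        (by simp; omega) fun _ h => h
      have hreg : Function.update (Function.update s.reg 28 (s.reg p + j)) (8 * (i : ℕ))
          (s.mem (s.reg p + j)) p = s.reg p := by
        rw [Function.update_of_ne (by omega), Function.update_of_ne (by omega)]
      refine Runs.mono (ih hlen _ (by simp only [hreg]; exact hmem.2) (by simp only [hreg]; omega)) le_rfl ?_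
      rintro s' ⟨h1, h2, h3⟩
      refine ⟨⟨h1.mem, fun r hr => ?_⟩, h2, ?_⟩
      · rw [h1.reg r hr]
        change Function.update _ _ _ _ = _
        rw [Function.update_of_ne (by omega), Function.update_of_ne hr.2.2]
      · rw [h3, assign, ← hmem.1]
        congr 1
        funext i'
        by_cases hi : i' = i
        · simp [hi]
        · rw [Function.update_of_ne hi]
          change Function.update _ _ _ _ = _
          rw [Function.update_of_ne (by have := Fin.val_ne_of_ne hi; omega),
            Function.update_of_ne (by omega)]

/-- The row is read a second time because loading may have overwritten a repeated variable. Equality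
is tested as the failure of both strict comparisons. The condition on `p` keeps the pointer apart
from the variables, which are 0 modulo 8, and from the scratch registers, which are 4. -/
theorem runs_checkRow {W ℓ p : ℕ} (hp : p % 8 = 1) {c : Cmd} {n : ℕ} {Q : State → Prop}
    {l : List (Fin ℓ)} {t : List ℕ} (hlen : t.length = l.length) {j : ℕ} (s : State)
    (hmem : MemAt s.mem (s.reg p + j) t) (hW : s.reg p + j + t.length < W)
    (h₁ : (l.map fun i : Fin ℓ => s.reg (8 * i)) = t → ∀ s',
      Frame (fun r => r ≠ 20 ∧ r ≠ 28 ∧ r ≠ 36) s s' → s'.out = s.out → Runs W c s' n Q)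
    (h₂ : (l.map fun i : Fin ℓ => s.reg (8 * i)) ≠ t → ∀ s',
      Frame (fun r => r ≠ 20 ∧ r ≠ 28 ∧ r ≠ 36) s s' → s'.out = s.out → Q s') :
    Runs W (checkRow p c j l) s (5 * l.length + n + 1) Q := by
  induction l generalizing t j s with
  | nil =>
    cases t with
    | nil => exact (h₁ rfl s (.refl s) rfl).mono (by omega) fun _ h => h
    | cons a t => simp at hlen
  | cons i l ih =>
    cases t with
    | nil => simp at hlen
    | cons a t =>
      simp only [List.length_cons, Nat.add_right_cancel_iff] at hlen hW
      refine Runs.mono (b := 3 + ((5 * l.length + n + 1) + 1 + 1))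
        (.seq (runs_fetch (by omega) (by omega) ?_)) (by simp; omega) fun _ h => h
      set s₁ : State := { s with
        reg := Function.update (Function.update s.reg 28 (s.reg p + j)) 36 (s.mem (s.reg p + j)) }
      have hreg : ∀ r, r ≠ 28 ∧ r ≠ 36 → s₁.reg r = s.reg r := by
        intro r hr
        change Function.update _ _ _ _ = _
        rw [Function.update_of_ne hr.2, Function.update_of_ne hr.1]
      have h36 : s₁.reg 36 = a := by
        simp only [s₁, Function.update_self]
        exact hmem.1
      have hfr : Frame (fun r => r ≠ 20 ∧ r ≠ 28 ∧ r ≠ 36) s s₁ := ⟨rfl, fun r hr => hreg r hr.2⟩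
      have hskip : a ≠ s.reg (8 * i) → Runs W skipCmd s₁ (5 * l.length + n + 1) Q := by
        intro hne
        refine Runs.mono (b := 1) (.const (by omega) ?_) (by omega) fun _ h => h
        refine h₂ (fun h => hne ?_) _ (hfr.trans ⟨rfl, fun r hr => ?_⟩) rfl
        · simp only [List.map_cons, List.cons.injEq] at h
          exact h.1.symm
        · exact Function.update_of_ne hr.1 _ _
      have hi : s₁.reg (8 * i) = s.reg (8 * i) := hreg _ (by omega)
      refine .branch (fun hlt => (hskip (by omega)).mono (by omega) fun _ h => h) fun hnl =>
        .branch (fun hlt => hskip (by omega)) fun hnl' => ?_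
      have heq : s.reg (8 * i) = a := by omega
      have hregp : s₁.reg p = s.reg p := hreg _ (by omega)
      have hmap : (l.map fun i : Fin ℓ => s₁.reg (8 * i)) = l.map fun i : Fin ℓ => s.reg (8 * i) :=
        List.map_congr_left fun i _ => hreg _ (by omega)
      refine ih hlen s₁ (by rw [hregp]; exact hmem.2) (by rw [hregp]; omega) ?_ ?_
      · intro h s' hs' ho
        exact h₁ (by rw [List.map_cons, heq, ← hmap, h]) s' (hfr.trans hs') ho
      · intro h s' hs' ho
        refine h₂ (fun h' => h ?_) s' (hfr.trans hs') ho
        rw [List.map_cons, heq, ← hmap] at h'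
        exact (List.cons.inj h').2

/-- The tables stand in memory. -/
structure Ready (W E : ℕ) (tbl : ℕ → List (List ℕ)) (s : State) : Prop where
  one : s.reg 4 = 1
  zero : s.reg 12 = 0
  len : ∀ k ≤ E, s.reg (8 * k + 3) = (tbl k).length
  len_lt : ∀ k ≤ E, (tbl k).length < W
  mem : ∀ k ≤ E, MemAt s.mem (s.reg (8 * k + 2)) (tbl k).flatten
  mem_lt : ∀ k ≤ E, s.reg (8 * k + 2) + (tbl k).flatten.length < W

/-- The registers that the code of a scan at depth `d` preserves, with variables in `U` bound. -/
def Kept {ℓ : ℕ} (d : ℕ) (U : Finset (Fin ℓ)) (r : ℕ) : Prop :=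
  r % 8 = 2 ∨ r % 8 = 3 ∨ r = 4 ∨ r = 12 ∨ (∃ d' < d, r = 8 * d' + 1 ∨ r = 8 * d' + 5) ∨
    ∃ i ∈ U, r = 8 * (i : ℕ)

theorem Ready.of_frame {W E ℓ d : ℕ} {U : Finset (Fin ℓ)} {tbl : ℕ → List (List ℕ)} {s s' : State}
    (h : Ready W E tbl s) (hf : Frame (Kept d U) s s') : Ready W E tbl s' := by
  have h2 : ∀ k, s'.reg (8 * k + 2) = s.reg (8 * k + 2) := fun k => hf.reg _ (Or.inl (by omega))
  have h3 : ∀ k, s'.reg (8 * k + 3) = s.reg (8 * k + 3) := fun k =>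
    hf.reg _ (Or.inr (Or.inl (by omega)))
  refine ⟨?_, ?_, ?_, h.len_lt, ?_, ?_⟩
  · rw [hf.reg 4 (by simp [Kept]), h.one]
  · rw [hf.reg 12 (by simp [Kept]), h.zero]
  · intro k hk; rw [h3, h.len k hk]
  · intro k hk; rw [h2, hf.mem]; exact h.mem k hk
  · intro k hk; rw [h2]; exact h.mem_lt k hk

theorem assign_congr {ℓ : ℕ} {i : Fin ℓ} : ∀ {l : List (Fin ℓ)} {t : List ℕ} {v w : Fin ℓ → ℕ},
    t.length = l.length → v i = w i ∨ i ∈ l → assign v l t i = assign w l t i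
  | [], _, _, _, _, h => by simpa [assign] using h
  | _ :: _, [], _, _, hl, _ => by simp at hl
  | j :: l, a :: t, v, w, hl, h => by
    rw [assign, assign]
    refine assign_congr (by simpa using hl) ?_
    by_cases hj : i = j
    · left; simp [hj]
    · simpa [hj] using h

/-- The running time of `scanCode`. -/
def scanCost {ℓ : ℕ} (n : ℕ) (tbl : ℕ → List (List ℕ)) : List (Scan ℓ) → ℕ
  | [] => 2 * n + 1
  | σ :: l => (tbl σ.tab).length * (8 * σ.args.length + scanCost n tbl l + 6) + 3

theorem Kept.succ {ℓ d r : ℕ} {U U' : Finset (Fin ℓ)} (hU : U ⊆ U') (h : Kept d U r) :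
    Kept (d + 1) U' r := by
  unfold Kept at h ⊢
  rcases h with h | h | h | h | ⟨d', hd, h⟩ | ⟨i, hi, h⟩
  · exact Or.inl h
  · exact Or.inr (Or.inl h)
  · exact Or.inr (Or.inr (Or.inl h))
  · exact Or.inr (Or.inr (Or.inr (Or.inl h)))
  · exact Or.inr (Or.inr (Or.inr (Or.inr (Or.inl ⟨d', by omega, h⟩))))
  · exact Or.inr (Or.inr (Or.inr (Or.inr (Or.inr ⟨i, hU hi, h⟩))))

theorem Kept.mono {ℓ d r : ℕ} {U U' : Finset (Fin ℓ)} (hU : U ⊆ U') (h : Kept d U r) :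
    Kept d U' r := by
  unfold Kept at h ⊢
  rcases h with h | h | h | h | h | ⟨i, hi, h⟩
  · exact Or.inl h
  · exact Or.inr (Or.inl h)
  · exact Or.inr (Or.inr (Or.inl h))
  · exact Or.inr (Or.inr (Or.inr (Or.inl h)))
  · exact Or.inr (Or.inr (Or.inr (Or.inr (Or.inl h))))
  · exact Or.inr (Or.inr (Or.inr (Or.inr (Or.inr ⟨i, hU hi, h⟩))))

theorem Kept.not_scratch {ℓ d r : ℕ} {U : Finset (Fin ℓ)} (h : Kept d U r) :
    r ≠ 20 ∧ r ≠ 28 ∧ r ≠ 36 := by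
  unfold Kept at h
  rcases h with h | h | h | h | ⟨d', hd, h⟩ | ⟨i, hi, h⟩ <;> omega

theorem Kept.not_loop {ℓ d r : ℕ} {U : Finset (Fin ℓ)} (h : Kept d U r) :
    r ≠ 8 * d + 1 ∧ r ≠ 8 * d + 5 := by
  unfold Kept at h
  rcases h with h | h | h | h | ⟨d', hd, h⟩ | ⟨i, hi, h⟩ <;> omega

theorem kept_loop {ℓ d r : ℕ} {U : Finset (Fin ℓ)} (h : r = 8 * d + 1 ∨ r = 8 * d + 5) :
    Kept (d + 1) U r :=
  Or.inr (Or.inr (Or.inr (Or.inr (Or.inl ⟨d, by omega, h⟩))))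

/-- The registers need to agree with `v` only on the variables `U` bound so far. Other variable
registers may hold leftovers of earlier loops, which is harmless since every emitted variable is
bound by then. -/
theorem runs_scanCode {W E ℓ : ℕ} {tbl : ℕ → List (List ℕ)} {toks : List (Tok ℓ)} (hW : 1 < W)
    (hc : ∀ c, Tok.const c ∈ toks → c < W) (l : List (Scan ℓ)) (d : ℕ) (U : Finset (Fin ℓ))
    (hdisj : ScansDisjoint l) (hU : Disjoint (bound l) U)
    (htoks : ∀ i, Tok.var i ∈ toks → i ∈ U ∪ bound l)
    (har : ∀ σ ∈ l, σ.tab ≤ E ∧ ∀ t ∈ tbl σ.tab, t.length = σ.args.length) (s : State)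
    (hs : Ready W E tbl s) (v : Fin ℓ → ℕ) (hv : ∀ i ∈ U, s.reg (8 * i) = v i) :
    Runs W (scanCode toks d l) s (scanCost toks.length tbl l) fun s' =>
      Frame (Kept d U) s s' ∧
      s'.out = s.out ++ (envs tbl l v).flatMap fun v' => toks.map (Tok.eval v') := by
  induction l generalizing d U s v with
  | nil =>
    refine (runs_emitToks (by omega) hc s).mono le_rfl fun s' hs' =>
      ⟨hs'.1.mono fun r hr => hr.not_scratch.1, ?_⟩
    rw [hs'.2, envs, List.flatMap_singleton]
    congr 1
    refine List.map_congr_left fun a ha => ?_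
    cases a with
    | const c => rfl
    | var i => exact hv i (by simpa [bound] using htoks i ha)
  | cons σ l ih =>
    obtain ⟨hσE, hσlen⟩ := har σ (by simp)
    rw [bound, Finset.disjoint_union_left] at hU
    -- Loop invariant: `ts` are the remaining rows, the pointer stands at their first word, and the
    -- counter together with `ts.length` gives the size of the table.
    have hloop : ∀ (ts : List (List ℕ)) (s : State), Ready W E tbl s →
        MemAt s.mem (s.reg (8 * d + 1)) ts.flatten →
        s.reg (8 * d + 1) + ts.flatten.length < W →
        s.reg (8 * d + 5) + ts.length = (tbl σ.tab).length →
        (∀ t ∈ ts, t.length = σ.args.length) → (∀ i ∈ U, s.reg (8 * i) = v i) →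
        Runs W (.loop (8 * d + 5) (8 * σ.tab + 3) (.seq (loadRow (8 * d + 1) 0 σ.args)
          (.seq (checkRow (8 * d + 1) (scanCode toks (d + 1) l) 0 σ.args)
            (.seq (.const 28 σ.args.length) (.seq (.op .add (8 * d + 1) (8 * d + 1) 28)
              (.op .add (8 * d + 5) (8 * d + 5) 4)))))) s
          (ts.length * (8 * σ.args.length + scanCost toks.length tbl l + 6) + 1) fun s' =>
          Frame (Kept d U) s s' ∧ s'.out = s.out ++ (ts.flatMap fun t =>
            if σ.args.map (assign v σ.args t) = t then envs tbl l (assign v σ.args t)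
            else []).flatMap fun v' => toks.map (Tok.eval v') := by
      intro ts
      induction ts with
      | nil =>
        intro s hs _ _ hcnt _ _
        refine Runs.mono (.loop_done ?_ ⟨.refl s, by simp⟩) (by omega) fun _ h => h
        rw [hs.len _ hσE]
        simp only [List.length_nil, add_zero] at hcnt
        omega
      | cons t ts ihts =>
        intro s hs hmem hlt hcnt hts hv
        rw [List.flatten_cons, memAt_append] at hmem
        rw [List.flatten_cons, List.length_append] at hlt
        have htlen := hts t (by simp)
        have hlenW := hs.len_lt _ hσE
        rw [List.length_cons] at hcnt
        set R : List ℕ := ((if σ.args.map (assign v σ.args t) = t then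
          envs tbl l (assign v σ.args t) else []).flatMap fun v' => toks.map (Tok.eval v')) with hR
        have htail : ∀ s₂, Frame (Kept (d + 1) U) s s₂ → s₂.out = s.out ++ R →
            Runs W (.seq (.const 28 σ.args.length) (.seq (.op .add (8 * d + 1) (8 * d + 1) 28)
              (.op .add (8 * d + 5) (8 * d + 5) 4))) s₂ 3 fun s₃ =>
              Frame (Kept d U) s s₃ ∧ s₃.reg (8 * d + 1) = s.reg (8 * d + 1) + t.length ∧
              s₃.reg (8 * d + 5) = s.reg (8 * d + 5) + 1 ∧ s₃.out = s.out ++ R := by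
          intro s₂ hf ho
          have hp := hf.reg (8 * d + 1) (kept_loop (Or.inl rfl))
          have hn := hf.reg (8 * d + 5) (kept_loop (Or.inr rfl))
          have h4 : s₂.reg 4 = 1 := (hf.reg 4 (by simp [Kept])).trans hs.one
          have e1 : Function.update s₂.reg 28 σ.args.length (8 * d + 1) = s.reg (8 * d + 1) := by
            rw [Function.update_of_ne (by omega), hp]
          refine Runs.seq (b₁ := 1) (b₂ := 2) (.const (by omega)
            (Runs.seq (b₁ := 1) (b₂ := 1) (.add ?_ (.add ?_ ?_))))
          · simp only [e1, Function.update_self]; omega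
          · dsimp only
            rw [Function.update_of_ne (by omega), Function.update_of_ne (by omega),
              Function.update_of_ne (by omega), Function.update_of_ne (by omega), hn, h4]
            omega
          · refine ⟨⟨hf.mem, fun r hr => ?_⟩, ?_, ?_, ho⟩
            · have h1 := hr.not_loop
              have h2 := hr.not_scratch
              dsimp only
              rw [Function.update_of_ne h1.2, Function.update_of_ne h1.1,
                Function.update_of_ne h2.2.1, hf.reg r (hr.succ subset_rfl)]
            · dsimp only
              rw [Function.update_of_ne (by omega), Function.update_self, e1, Function.update_self,
                htlen]
            · dsimp only
              rw [Function.update_self, Function.update_of_ne (by omega),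
                Function.update_of_ne (by omega), Function.update_of_ne (by omega),
                Function.update_of_ne (by omega), hn, h4]
        -- One iteration: loading the row, checking it and running the inner scans, three
        -- instructions to advance, and one loop test.
        refine Runs.mono (b := ((3 * σ.args.length + 1) + ((5 * σ.args.length +
            scanCost toks.length tbl l + 1) + 3)) + (ts.length *
            (8 * σ.args.length + scanCost toks.length tbl l + 6) + 1) + 1)
          (.loop_step (by rw [hs.len _ hσE]; omega) (.seq (Runs.mono (runs_loadRow (by omega)
            htlen s hmem.1 (by omega)) le_rfl ?_))) (by rw [List.length_cons, Nat.add_mul ts.length 1]; omega)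
          fun _ h => h
        rintro s₁ ⟨hf₁, ho₁, hv₁⟩
        have hs₁p : s₁.reg (8 * d + 1) = s.reg (8 * d + 1) :=
          hf₁.reg _ ⟨by omega, by omega, by omega⟩
        have hf₁' : Frame (Kept (d + 1) U) s s₁ := by
          refine ⟨hf₁.mem, fun r hr => ?_⟩
          by_cases hr8 : r % 8 = 0
          · unfold Kept at hr
            rcases hr with h | h | h | h | ⟨d', hd, h⟩ | ⟨i, hi, rfl⟩ <;> try omega
            refine (congrFun hv₁ i).trans (assign_of_notMem _ _ fun hmem => ?_)
            exact Finset.disjoint_left.1 hU.1 (by simpa using hmem) hi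
          · exact hf₁.reg r ⟨hr8, hr.not_scratch.1, hr.not_scratch.2.1⟩
        have hval : ∀ i, i ∈ U ∨ i ∈ σ.args → s₁.reg (8 * (i : ℕ)) = assign v σ.args t i := by
          intro i hi
          refine (congrFun hv₁ i).trans (assign_congr htlen ?_)
          exact hi.imp_left fun h => hv i h
        have hmatch : (σ.args.map fun i : Fin ℓ => s₁.reg (8 * i)) =
            σ.args.map (assign v σ.args t) :=
          List.map_congr_left fun i hi => hval i (Or.inr hi)
        have hnext : ∀ s₂, Frame (Kept (d + 1) U) s s₂ → s₂.out = s.out ++ R →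
            Runs W (.seq (.const 28 σ.args.length) (.seq (.op .add (8 * d + 1) (8 * d + 1) 28)
              (.op .add (8 * d + 5) (8 * d + 5) 4))) s₂ 3 fun s₃ =>
              Runs W (.loop (8 * d + 5) (8 * σ.tab + 3) (.seq (loadRow (8 * d + 1) 0 σ.args)
                (.seq (checkRow (8 * d + 1) (scanCode toks (d + 1) l) 0 σ.args)
                  (.seq (.const 28 σ.args.length) (.seq (.op .add (8 * d + 1) (8 * d + 1) 28)
                    (.op .add (8 * d + 5) (8 * d + 5) 4)))))) s₃
                (ts.length * (8 * σ.args.length + scanCost toks.length tbl l + 6) + 1) fun s' =>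
              Frame (Kept d U) s s' ∧ s'.out = s.out ++ ((t :: ts).flatMap fun t =>
                if σ.args.map (assign v σ.args t) = t then envs tbl l (assign v σ.args t)
                else []).flatMap fun v' => toks.map (Tok.eval v') := by
          intro s₂ hf ho
          refine (htail s₂ hf ho).mono le_rfl ?_
          rintro s₃ ⟨hf₃, hp₃, hc₃, ho₃⟩
          refine Runs.mono (ihts s₃ (hs.of_frame hf₃) ?_ ?_ ?_ (fun t' ht' =>
            hts t' (List.mem_cons_of_mem _ ht')) fun i hi => ?_) le_rfl ?_
          · rw [hp₃, hf₃.mem]; exact hmem.2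
          · rw [hp₃]; omega
          · rw [hc₃]; omega
          · rw [hf₃.reg _ (Or.inr (Or.inr (Or.inr (Or.inr (Or.inr ⟨i, hi, rfl⟩))))), hv i hi]
          · rintro s' ⟨hf', ho'⟩
            refine ⟨hf₃.trans hf', ?_⟩
            rw [ho', ho₃, List.flatMap_cons, List.flatMap_append, ← hR, List.append_assoc]
        refine Runs.seq (runs_checkRow (by omega) htlen s₁ ?_ ?_ ?_ ?_)
        · rw [hs₁p, hf₁.mem]; exact hmem.1
        · rw [hs₁p]; omega
        · intro hm s₂ hf₂ ho₂
          rw [hmatch] at hm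
          have hf₂' : Frame (Kept (d + 1) U) s s₂ :=
            hf₁'.trans (hf₂.mono fun r hr => hr.not_scratch)
          refine (ih (d + 1) (σ.args.toFinset ∪ U) hdisj.2 ?_ ?_ (fun τ hτ =>
            har τ (List.mem_cons_of_mem _ hτ)) s₂ (hs.of_frame hf₂') (assign v σ.args t) ?_).mono
            le_rfl ?_
          · rw [Finset.disjoint_union_right]
            exact ⟨hdisj.1.symm, hU.2⟩
          · intro i hi
            have := htoks i hi
            simp only [bound, Finset.mem_union] at this ⊢
            tauto
          · intro i hi
            rw [hf₂.reg _ ⟨by omega, by omega, by omega⟩]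
            refine hval i ?_
            simpa [or_comm] using hi
          · rintro s₃ ⟨hf₃, ho₃⟩
            refine hnext s₃ (hf₂'.trans (hf₃.mono fun r hr =>
              hr.mono Finset.subset_union_right)) ?_
            rw [ho₃, ho₂, ho₁, hR, if_pos hm]
        · intro hm s₂ hf₂ ho₂
          rw [hmatch] at hm
          refine hnext s₂ (hf₁'.trans (hf₂.mono fun r hr => hr.not_scratch)) ?_
          rw [ho₂, ho₁, hR, if_neg hm]
          simp
    have hmlt := hs.mem_lt _ hσE
    refine Runs.mono (b := 1 + (1 + ((tbl σ.tab).length *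
      (8 * σ.args.length + scanCost toks.length tbl l + 6) + 1)))
      (.seq (.add (by rw [hs.zero]; omega) (.seq (.const (by omega) ?_)))) (by rw [scanCost]; omega)
      fun _ h => h
    rw [hs.zero, add_zero]
    set s₂ : State := { s with
      reg := Function.update (Function.update s.reg (8 * d + 1) (s.reg (8 * σ.tab + 2)))
        (8 * d + 5) 0 }
    have hf : Frame (Kept d U) s s₂ := by
      refine ⟨rfl, fun r hr => ?_⟩
      change Function.update _ _ _ _ = _
      rw [Function.update_of_ne hr.not_loop.2, Function.update_of_ne hr.not_loop.1]
    have hp : s₂.reg (8 * d + 1) = s.reg (8 * σ.tab + 2) := by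
      change Function.update _ _ _ _ = _
      rw [Function.update_of_ne (by omega), Function.update_self]
    have hn : s₂.reg (8 * d + 5) = 0 := by simp only [s₂, Function.update_self]
    refine Runs.mono (hloop (tbl σ.tab) s₂ (hs.of_frame hf) ?_ ?_ ?_ hσlen fun i hi => ?_) le_rfl ?_
    · rw [hp]; exact hs.mem _ hσE
    · rw [hp]; exact hmlt
    · rw [hn, zero_add]
    · rw [hf.reg _ (Or.inr (Or.inr (Or.inr (Or.inr (Or.inr ⟨i, hi, rfl⟩))))), hv i hi]
    · rintro s' ⟨hf', ho'⟩
      exact ⟨hf.trans hf', ho'⟩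

/-! ### The words written for a template, and the code for a list of templates -/

variable {S : Schema}

/-- The words that encode a ground atom. -/
def TAtom.toks {ℓ : ℕ} : TAtom S ℓ → List (Tok ℓ)
  | .edb R args => .const 0 :: .const R :: (List.ofFn args).map .var
  | .idb s args => .const 1 :: .const s :: .const args.length :: args.map .var

/-- The words that encode a ground rule of the template. -/
def Template.toks (τ : Template S) : List (Tok τ.numVars) :=
  .const τ.head :: .const τ.headArgs.length :: (τ.headArgs.map .var ++
    .const τ.body.length :: τ.body.flatMap TAtom.toks)

theorem TAtom.map_toks {ℓ : ℕ} (v : Fin ℓ → ℕ) (a : TAtom S ℓ) :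
    a.toks.map (Tok.eval v) = (a.ground v).encode := by
  cases a with
  | edb R args =>
    simp only [toks, ground, GroundAtom.encode, List.map_cons, List.map_map, Tok.eval]
    rw [List.map_ofFn]
    rfl
  | idb s args =>
    simp only [toks, ground, GroundAtom.encode, encodeGroundIDB, List.map_cons, List.map_map,
      Tok.eval, List.length_map]
    rfl

theorem Template.map_toks (τ : Template S) (v : Fin τ.numVars → ℕ) :
    τ.toks.map (Tok.eval v) = GroundRule.encode (S := S)
      ⟨(τ.head, τ.headArgs.map v), τ.body.map (TAtom.ground v)⟩ := by
  simp only [toks, GroundRule.encode, encodeGroundIDB, List.map_cons, List.map_append,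
    List.map_map, List.map_flatMap, TAtom.map_toks, List.flatMap_map, List.length_map, Tok.eval,
    List.cons_append]
  rfl

theorem Template.encode_ground (τ : Template S) (tbl : ℕ → List (List ℕ)) :
    (τ.ground tbl).encode = (envs tbl τ.scans 0).flatMap fun v => τ.toks.map (Tok.eval v) := by
  simp only [Grounding.encode, ground, List.flatMap_map, Template.map_toks]

theorem TAtom.mem_toks {ℓ : ℕ} {a : TAtom S ℓ} {i : Fin ℓ} (h : Tok.var i ∈ a.toks) :
    i ∈ a.vars := by
  cases a <;> simpa [toks, vars] using h

theorem Template.WF.mem_bound {τ : Template S} (h : τ.WF) {i : Fin τ.numVars}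
    (hi : Tok.var i ∈ τ.toks) : i ∈ bound τ.scans := by
  simp only [Template.toks, List.mem_cons, reduceCtorEq, false_or, List.mem_append, List.mem_map,
    Tok.var.injEq, exists_eq_right, List.mem_flatMap] at hi
  rcases hi with hi | ⟨a, ha, hi⟩
  · exact h.headArgs i hi
  · exact h.body a ha i (TAtom.mem_toks hi)

theorem exists_const_lt {ℓ : ℕ} (l : List (Tok ℓ)) : ∃ N, ∀ c, Tok.const c ∈ l → c < N := by
  induction l with
  | nil => exact ⟨0, by simp⟩
  | cons a l ih =>
    obtain ⟨N, hN⟩ := ih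
    cases a with
    | const b =>
      refine ⟨N + b + 1, fun c hc => ?_⟩
      rcases List.mem_cons.1 hc with h | h
      · cases h; omega
      · have := hN c h; omega
    | var i => exact ⟨N, fun c hc => hN c (by simpa using hc)⟩

theorem length_of_mem_tables (I : Database S) (dl : List ℕ) {k : ℕ} {t : List ℕ}
    (h : t ∈ tables I dl k) : t.length = tabArity S k := by
  rw [tables] at h
  rw [tabArity]
  split_ifs at h ⊢ with hk
  · obtain ⟨r, _, rfl⟩ := List.mem_map.1 h
    exact List.length_ofFn
  · obtain ⟨a, _, rfl⟩ := List.mem_map.1 h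
    rfl

/-- The program that executes a list of templates. -/
def templatesCode : List (Template S) → Cmd
  | [] => skipCmd
  | τ :: Ts => .seq (scanCode τ.toks 0 τ.scans) (templatesCode Ts)

/-- The running time of `templatesCode`. -/
def templatesCost (tbl : ℕ → List (List ℕ)) : List (Template S) → ℕ
  | [] => 1
  | τ :: Ts => scanCost τ.toks.length tbl τ.scans + templatesCost tbl Ts

theorem runs_templatesCode {W : ℕ} (hW : 1 < W) {I : Database S} {dl : List ℕ}
    {Ts : List (Template S)} (hwf : ∀ τ ∈ Ts, τ.WF)
    (hc : ∀ τ ∈ Ts, ∀ c, Tok.const c ∈ τ.toks → c < W) (s : State)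
    (hs : Ready W S.numEDB (tables I dl) s) :
    Runs W (templatesCode Ts) s (templatesCost (tables I dl) Ts) fun s' =>
      s'.out = s.out ++ Grounding.encode (Ts.flatMap fun τ => τ.ground (tables I dl)) := by
  induction Ts generalizing s with
  | nil => exact .const (by omega) (by simp [Grounding.encode])
  | cons τ Ts ih =>
    have hτ := hwf τ (by simp)
    refine .seq (Runs.mono (runs_scanCode hW (hc τ (by simp)) τ.scans 0 ∅ hτ.scans.disjoint (by simp)
      (fun i hi => by simpa using hτ.mem_bound hi) (fun σ hσ => ⟨(hτ.scans.arity σ hσ).1,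
        fun t ht => (length_of_mem_tables I dl ht).trans (hτ.scans.arity σ hσ).2.symm⟩) s hs 0
        (by simp)) le_rfl ?_)
    rintro s₁ ⟨hf, ho⟩
    refine (ih (fun τ h => hwf τ (List.mem_cons_of_mem _ h))
      (fun τ h => hc τ (List.mem_cons_of_mem _ h)) s₁ (hs.of_frame hf)).mono le_rfl fun s' hs' => ?_
    rw [hs', ho, List.append_assoc, List.flatMap_cons, Grounding.encode, Grounding.encode,
      List.flatMap_append, ← Template.encode_ground]
    rfl

/-! ### Cost -/

theorem length_envs_nil {ℓ : ℕ} (tbl : ℕ → List (List ℕ)) (v : Fin ℓ → ℕ) :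
    (envs tbl [] v).length = 1 := rfl

theorem length_flatMap_le {α β : Type*} {l : List α} {f : α → List β} {b : ℕ}
    (h : ∀ a ∈ l, (f a).length ≤ b) : (l.flatMap f).length ≤ l.length * b := by
  induction l with
  | nil => simp
  | cons a l ih =>
    have h1 := h a (by simp)
    have h2 := ih fun x hx => h x (List.mem_cons_of_mem _ hx)
    rw [List.flatMap_cons, List.length_append, List.length_cons, add_mul]
    omega

theorem length_envs_cons_le {ℓ : ℕ} {tbl : ℕ → List (List ℕ)} {σ : Scan ℓ} {l : List (Scan ℓ)}
    {b : ℕ} (h : ∀ v, (envs tbl l v).length ≤ b) (v : Fin ℓ → ℕ) :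
    (envs tbl (σ :: l) v).length ≤ (tbl σ.tab).length * b := by
  refine length_flatMap_le fun t _ => ?_
  split_ifs
  · exact h _
  · simp

/-- A single scan costs the size of one table; two nested scans cost the size of a table times the
number of constants, since the inner one always runs over the constants. The constant is chosen
before the tables and `M`, so it does not depend on the instance. -/
theorem exists_scan_bound {ℓ : ℕ} {l : List (Scan ℓ)} (hl : ScansWF S l) (n K : ℕ) :
    ∃ C, ∀ (tbl : ℕ → List (List ℕ)) (M : ℕ), 1 ≤ M →
      (∀ k ≤ S.numEDB, (tbl k).length ≤ K * M) →
      (∀ k ≤ S.numEDB, (tbl k).length * (tbl S.numEDB).length ≤ K * M) →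
      scanCost n tbl l ≤ C * M ∧ ∀ v, (envs tbl l v).length ≤ C * M := by
  rcases hl.cheap with rfl | ⟨σ, rfl | ⟨i, rfl⟩⟩
  · refine ⟨2 * n + 1, fun tbl M hM _ _ => ⟨?_, fun v => ?_⟩⟩
    · exact Nat.le_mul_of_pos_right _ hM
    · rw [length_envs_nil]
      exact Nat.mul_pos (by omega) hM
  · have hσ := (hl.arity σ (by simp)).1
    refine ⟨K * (8 * σ.args.length + (2 * n + 1) + 6) + 3, fun tbl M hM h1 _ => ⟨?_, fun v => ?_⟩⟩
    · have := Nat.mul_le_mul_right (8 * σ.args.length + (2 * n + 1) + 6) (h1 _ hσ)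
      simp only [scanCost]
      nlinarith
    · have := length_envs_cons_le (σ := σ) (fun v => (length_envs_nil tbl v).le) v
      have := h1 _ hσ
      nlinarith [Nat.zero_le (K * M * (8 * σ.args.length + (2 * n + 1) + 5)), Nat.zero_le M]
  · have hσ := (hl.arity σ (by simp)).1
    refine ⟨K * (8 * σ.args.length + 9) + K * (8 + (2 * n + 1) + 6) + 3,
      fun tbl M hM h1 h2 => ⟨?_, fun v => ?_⟩⟩
    · have e1 := Nat.mul_le_mul_right (8 * σ.args.length + 9) (h1 _ hσ)
      have e2 := Nat.mul_le_mul_right (8 + (2 * n + 1) + 6) (h2 _ hσ)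
      simp only [scanCost, List.length_singleton]
      nlinarith
    · have e1 := length_envs_cons_le (σ := σ) (length_envs_cons_le (σ := ⟨S.numEDB, [i]⟩)
        fun v => (length_envs_nil tbl v).le) v
      have e2 := h2 _ hσ
      simp only [mul_one] at e1
      nlinarith [Nat.zero_le (K * M * (8 + (2 * n + 1) + 5)), Nat.zero_le M,
        Nat.zero_le (K * M * (8 * σ.args.length + 9))]

theorem Template.size_ground (τ : Template S) (tbl : ℕ → List (List ℕ)) :
    (τ.ground tbl).size = (envs tbl τ.scans 0).length * (1 + τ.body.length) := by
  simp [Grounding.size, ground, Function.comp_def]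

theorem Grounding.size_append (G G' : Grounding S) :
    Grounding.size (G ++ G') = G.size + G'.size := by
  simp [Grounding.size]

theorem exists_templates_bound {Ts : List (Template S)} (hwf : ∀ τ ∈ Ts, τ.WF) (K : ℕ) :
    ∃ C, ∀ (tbl : ℕ → List (List ℕ)) (M : ℕ), 1 ≤ M →
      (∀ k ≤ S.numEDB, (tbl k).length ≤ K * M) →
      (∀ k ≤ S.numEDB, (tbl k).length * (tbl S.numEDB).length ≤ K * M) →
      templatesCost tbl Ts ≤ C * M ∧
        Grounding.size (Ts.flatMap fun τ => τ.ground tbl) ≤ C * M := by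
  induction Ts with
  | nil => exact ⟨1, fun tbl M hM _ _ => ⟨by simpa [templatesCost] using hM,
      by simp [Grounding.size]⟩⟩
  | cons τ Ts ih =>
    obtain ⟨C₁, h₁⟩ := ih fun τ h => hwf τ (List.mem_cons_of_mem _ h)
    obtain ⟨C₂, h₂⟩ := exists_scan_bound (hwf τ (by simp)).scans τ.toks.length K
    refine ⟨C₂ * (1 + τ.body.length) + C₁, fun tbl M hM e1 e2 => ?_⟩
    obtain ⟨a1, a2⟩ := h₁ tbl M hM e1 e2
    obtain ⟨b1, b2⟩ := h₂ tbl M hM e1 e2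
    constructor
    · rw [templatesCost]
      nlinarith [Nat.zero_le (C₂ * M * τ.body.length)]
    · rw [List.flatMap_cons, Grounding.size_append, Template.size_ground]
      have := Nat.mul_le_mul_right (1 + τ.body.length) (b2 0)
      nlinarith

/-! ### Preprocessing: locating the relations and listing the constants

Register `44` is a pointer into the input; registers `52`, `60` and `68` hold the pointer, its end
and the current constant in the loop over the entries of a relation; registers `76`, `84`, `92` and
`100` hold the pointer, its end, a flag and the current constant in the search of the list of
constants. -/

/-- Compute the addresses and the numbers of rows of the relations `Rs`. -/
def locateCode : List (Fin S.numEDB) → Cmd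
  | [] => skipCmd
  | R :: Rs => .seq (.load (8 * (R : ℕ) + 3) 44) (.seq (.op .add (8 * (R : ℕ) + 2) 44 4)
      (.seq (.const 28 (S.edbArity R)) (.seq (.op .mul 28 (8 * (R : ℕ) + 3) 28)
        (.seq (.op .add 44 (8 * (R : ℕ) + 2) 28) (locateCode Rs)))))

theorem length_cells {n : ℕ} (l : List (Fin n → ℕ)) :
    (l.flatMap fun t => List.ofFn t).length = l.length * n := by
  induction l with
  | nil => simp
  | cons t l ih => simp [ih, Nat.add_mul, Nat.add_comm]

/-- The arities are constants of the program, so the row count in front of each relation determines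
where the next one starts. The final inequality places all relations below the end of the input,
where the list of constants will be built. -/
theorem runs_locateCode {W : ℕ} (I : Database S) (Rs : List (Fin S.numEDB)) (hnd : Rs.Nodup)
    (har : ∀ R, S.edbArity R < W) (s : State) (h4 : s.reg 4 = 1)
    (hmem : MemAt s.mem (s.reg 44) (Rs.flatMap fun R =>
      (I.rows R).length :: (I.rows R).flatMap fun t => List.ofFn t))
    (hW : s.reg 44 + (Rs.flatMap fun R =>
      (I.rows R).length :: (I.rows R).flatMap fun t => List.ofFn t).length < W) :
    Runs W (locateCode Rs) s (5 * Rs.length + 1) fun s' =>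
      Frame (fun r => r ≠ 20 ∧ r ≠ 28 ∧ r ≠ 44 ∧
        ∀ R ∈ Rs, r ≠ 8 * (R : ℕ) + 2 ∧ r ≠ 8 * (R : ℕ) + 3) s s' ∧ s'.out = s.out ∧
      s'.reg 44 = s.reg 44 + (Rs.flatMap fun R =>
        (I.rows R).length :: (I.rows R).flatMap fun t => List.ofFn t).length ∧
      ∀ R ∈ Rs, s'.reg (8 * (R : ℕ) + 3) = (I.rows R).length ∧
        MemAt s.mem (s'.reg (8 * (R : ℕ) + 2)) ((I.rows R).flatMap fun t => List.ofFn t) ∧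
        s'.reg (8 * (R : ℕ) + 2) + ((I.rows R).flatMap fun t => List.ofFn t).length ≤
          s'.reg 44 := by
  induction Rs generalizing s with
  | nil => exact .const (by omega) ⟨⟨rfl, fun r hr => by simp [hr.1]⟩, rfl, by simp, by simp⟩
  | cons R Rs ih =>
    rw [List.flatMap_cons, List.cons_append, MemAt, memAt_append] at hmem
    rw [List.flatMap_cons, List.length_append, List.length_cons] at hW
    have hlen := length_cells (I.rows R)
    obtain ⟨hR, hnd⟩ := List.nodup_cons.1 hnd
    have htail : ∀ s₁ : State, s₁.mem = s.mem → s₁.out = s.out →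
        s₁.reg 44 = s.reg 44 + 1 + ((I.rows R).flatMap fun t => List.ofFn t).length →
        s₁.reg (8 * (R : ℕ) + 2) = s.reg 44 + 1 →
        s₁.reg (8 * (R : ℕ) + 3) = (I.rows R).length →
        (∀ r, r ≠ 28 → r ≠ 44 → r ≠ 8 * (R : ℕ) + 2 → r ≠ 8 * (R : ℕ) + 3 →
          s₁.reg r = s.reg r) →
        Runs W (locateCode Rs) s₁ (5 * Rs.length + 1) fun s' =>
          Frame (fun r => r ≠ 20 ∧ r ≠ 28 ∧ r ≠ 44 ∧
            ∀ R' ∈ R :: Rs, r ≠ 8 * (R' : ℕ) + 2 ∧ r ≠ 8 * (R' : ℕ) + 3) s s' ∧ s'.out = s.out ∧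
          s'.reg 44 = s.reg 44 + ((R :: Rs).flatMap fun R =>
            (I.rows R).length :: (I.rows R).flatMap fun t => List.ofFn t).length ∧
          ∀ R' ∈ R :: Rs, s'.reg (8 * (R' : ℕ) + 3) = (I.rows R').length ∧
            MemAt s.mem (s'.reg (8 * (R' : ℕ) + 2)) ((I.rows R').flatMap fun t => List.ofFn t) ∧
            s'.reg (8 * (R' : ℕ) + 2) + ((I.rows R').flatMap fun t => List.ofFn t).length ≤
              s'.reg 44 := by
      intro s₁ hm₁ ho₁ r44 r2 r3 hf
      refine (ih hnd s₁ ?_ ?_ ?_).mono le_rfl ?_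
      · rw [hf 4 (by omega) (by omega) (by omega) (by omega), h4]
      · rw [r44, hm₁]; exact hmem.2.2
      · rw [r44]; omega
      · rintro s' ⟨hf', ho, h44, hRs⟩
        have hne : ∀ R' ∈ Rs, (R : ℕ) ≠ R' := fun R' h e => hR (Fin.ext e ▸ h)
        refine ⟨⟨hf'.mem.trans hm₁, fun r hr => ?_⟩, ho.trans ho₁, ?_, fun R' hR' => ?_⟩
        · have := hr.2.2.2 R (by simp)
          rw [hf'.reg r ⟨hr.1, hr.2.1, hr.2.2.1, fun R' h => hr.2.2.2 R' (List.mem_cons_of_mem _ h)⟩,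
            hf r hr.2.1 hr.2.2.1 this.1 this.2]
        · rw [h44, r44, List.flatMap_cons, List.length_append, List.length_cons]
          omega
        · rcases List.mem_cons.1 hR' with rfl | hR'
          · have e2 := hf'.reg (8 * (R' : ℕ) + 2) ⟨by omega, by omega, by omega, fun R h => by
              have := hne R h; omega⟩
            have e3 := hf'.reg (8 * (R' : ℕ) + 3) ⟨by omega, by omega, by omega, fun R h => by
              have := hne R h; omega⟩
            rw [e2, e3, r2, r3, h44, r44]
            exact ⟨rfl, hmem.2.1, by omega⟩
          · rw [← hm₁]; exact hRs R' hR'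
    refine Runs.mono (b := 1 + (1 + (1 + (1 + (1 + (5 * Rs.length + 1))))))
      (.seq (.load (.seq (.add ?_ (.seq (.const (har R) (.seq (.mul ?_ (.seq (.add ?_
        (htail _ ?_ ?_ ?_ ?_ ?_ fun r e1 e2 e3 e4 => ?_)))))))))))
      (by rw [List.length_cons]; omega) fun _ h => h
    · simp (disch := omega) only [Function.update_of_ne, h4]
      omega
    · simp (disch := omega) only [Function.update_of_ne, Function.update_self, hmem.1]
      omega
    · simp (disch := omega) only [Function.update_of_ne, Function.update_self, hmem.1, h4]
      omega
    · rfl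
    · rfl
    · simp (disch := omega) only [Function.update_of_ne, Function.update_self, hmem.1, h4, hlen]
    · simp (disch := omega) only [Function.update_of_ne, Function.update_self, h4]
    · simp (disch := omega) only [Function.update_of_ne, Function.update_self, hmem.1]
    · simp (disch := omega) only [Function.update_of_ne]

/-- The state during the construction of the list of constants, with `dl` built so far. -/
structure Listing (W : ℕ) (I : Database S) (dl : List ℕ) (s : State) : Prop where
  ready : Ready W S.numEDB (tables I dl) s
  below : ∀ k < S.numEDB, s.reg (8 * k + 2) + (tables I dl k).flatten.length ≤
    s.reg (8 * S.numEDB + 2)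
  room : s.reg (8 * S.numEDB + 2) + I.adom.card < W
  nodup : dl.Nodup
  sub : ∀ a ∈ dl, a ∈ I.adom
  out : s.out = []

theorem tables_of_lt (I : Database S) (dl : List ℕ) {k : ℕ} (h : k < S.numEDB) :
    tables I dl k = (I.rows ⟨k, h⟩).map List.ofFn := dif_pos h

theorem tables_numEDB (I : Database S) (dl : List ℕ) :
    tables I dl S.numEDB = dl.map fun a => [a] := dif_neg (lt_irrefl _)

theorem flatten_map_singleton (dl : List ℕ) : (dl.map fun a => [a]).flatten = dl := by
  induction dl with
  | nil => rfl
  | cons a dl ih => simp [ih]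

theorem Listing.length_le {W : ℕ} {I : Database S} {dl : List ℕ} {s : State}
    (h : Listing W I dl s) : dl.length ≤ I.adom.card := by
  rw [← List.toFinset_card_of_nodup h.nodup]
  exact Finset.card_le_card fun a ha => h.sub a (List.mem_toFinset.1 ha)

theorem Listing.of_eq {W : ℕ} {I : Database S} {dl : List ℕ} {s s' : State}
    (h : Listing W I dl s)
    (hf : Frame (fun r => r % 8 = 2 ∨ r % 8 = 3 ∨ r = 4 ∨ r = 12) s s') (ho : s'.out = s.out) :
    Listing W I dl s' := by
  have h2 : ∀ k, s'.reg (8 * k + 2) = s.reg (8 * k + 2) := fun k => hf.reg _ (by omega)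
  refine ⟨h.ready.of_frame (ℓ := 0) (d := 0) (U := ∅) ⟨hf.mem, fun r hr => hf.reg r ?_⟩, ?_, ?_,
    h.nodup, h.sub, ho.trans h.out⟩
  · simpa [Kept] using hr
  · intro k hk; rw [h2, h2]; exact h.below k hk
  · rw [h2]; exact h.room

/-- Set register `92` if the constant in register `68` occurs between the addresses in the registers
`76` and `84`. -/
def searchCode : Cmd :=
  .loop 76 84 (.seq (.load 100 76) (.seq (.branch 68 100 skipCmd (.branch 100 68 skipCmd
    (.const 92 1))) (.op .add 76 76 4)))

theorem runs_searchCode {W : ℕ} (hW : 1 < W) (l : List ℕ) (s : State) (h4 : s.reg 4 = 1)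
    (hmem : MemAt s.mem (s.reg 76) l) (hend : s.reg 84 = s.reg 76 + l.length)
    (hlt : s.reg 84 < W) :
    Runs W searchCode s (6 * l.length + 1) fun s' =>
      Frame (fun r => r ≠ 20 ∧ r ≠ 76 ∧ r ≠ 92 ∧ r ≠ 100) s s' ∧ s'.out = s.out ∧
      s'.reg 92 = if s.reg 68 ∈ l then 1 else s.reg 92 := by
  induction l generalizing s with
  | nil => exact .loop_done (by simpa using hend.le) ⟨.refl s, rfl, by simp⟩
  | cons a l ih =>
    rw [List.length_cons] at hend
    have hstep : ∀ s₁ : State, Frame (fun r => r ≠ 20 ∧ r ≠ 92 ∧ r ≠ 100) s s₁ → s₁.out = s.out →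
        (s₁.reg 92 = if s.reg 68 = a then 1 else s.reg 92) →
        Runs W (.op .add 76 76 4) s₁ 1 fun s₂ => Runs W searchCode s₂ (6 * l.length + 1) fun s' =>
          Frame (fun r => r ≠ 20 ∧ r ≠ 76 ∧ r ≠ 92 ∧ r ≠ 100) s s' ∧ s'.out = s.out ∧
          s'.reg 92 = if s.reg 68 ∈ a :: l then 1 else s.reg 92 := by
      intro s₁ hf ho h92
      have e76 := hf.reg 76 (by decide)
      have e84 := hf.reg 84 (by decide)
      have e4 := hf.reg 4 (by decide)
      have e68 := hf.reg 68 (by decide)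
      refine .add (by omega) ?_
      rw [e76, e4, h4]
      refine (ih _ ?_ ?_ ?_ ?_).mono le_rfl ?_
      · simp [e4, h4]
      · simpa [hf.mem] using hmem.2
      · simp [e84]; omega
      · simpa [e84] using hlt
      · rintro s' ⟨hf', ho', h'⟩
        refine ⟨⟨hf'.mem.trans hf.mem, fun r hr => ?_⟩, ho'.trans ho, ?_⟩
        · rw [hf'.reg r hr]
          simp only [Function.update_of_ne hr.2.1]
          exact hf.reg r ⟨hr.1, hr.2.2⟩
        · rw [h']
          simp (disch := decide) only [Function.update_of_ne, e68, h92, List.mem_cons]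
          by_cases h1 : s.reg 68 = a <;> by_cases h2 : s.reg 68 ∈ l <;> simp [h1, h2]
    refine Runs.mono (b := (1 + (3 + 1)) + (6 * l.length + 1) + 1) (.loop_step (by omega)
      (.seq (.load (.seq (Runs.mono (b := 1 + 1 + 1) (.branch (fun h => Runs.mono (b := 1)
        (.const (by omega) (hstep _ ⟨?_, fun r hr => ?_⟩ ?_ ?_)) (by omega) fun _ h => h) fun h =>
        .branch (fun h' => .const (by omega) (hstep _ ⟨?_, fun r hr => ?_⟩ ?_ ?_))
          fun h' => .const (by omega) (hstep _ ⟨?_, fun r hr => ?_⟩ ?_ ?_)) le_rfl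
        fun _ h => h))))) (by rw [List.length_cons]; omega) fun _ h => h
    all_goals try rfl
    all_goals simp (disch := omega) only [Function.update_of_ne, Function.update_self, hmem.1] at *
    · rw [if_neg (by omega)]
    · rw [if_neg (by omega)]
    · rw [if_pos (by omega)]

/-- Append the constant in register `68` to the list of constants unless it occurs there. -/
def insertCode (E : ℕ) : Cmd :=
  .seq (.op .add 76 (8 * E + 2) 12) (.seq (.op .add 84 76 (8 * E + 3)) (.seq (.const 92 0)
    (.seq searchCode (.branch 92 4 (.seq (.store 84 68) (.op .add (8 * E + 3) (8 * E + 3) 4))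
      skipCmd))))

/-- The new word lies behind all stored relations and so damages none of them. Its address fits into
a word because the list, being free of duplicates, never exceeds the active domain, for which `room`
reserves space. -/
theorem Listing.append {W : ℕ} {I : Database S} {dl : List ℕ} {s : State}
    (h : Listing W I dl s) {x : ℕ} (hx : x ∉ dl) (hxI : x ∈ I.adom) :
    Listing W I (dl ++ [x])
      { s with
        mem := Function.update s.mem (s.reg (8 * S.numEDB + 2) + dl.length) x
        reg := Function.update s.reg (8 * S.numEDB + 3) (dl.length + 1) } := by
  have hnd : (dl ++ [x]).Nodup := by
    rw [List.nodup_append]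
    refine ⟨h.nodup, by simp, fun a ha b hb => ?_⟩
    rw [List.mem_singleton.1 hb]
    rintro rfl
    exact hx ha
  have hsub : ∀ a ∈ dl ++ [x], a ∈ I.adom := by
    intro a ha
    rcases List.mem_append.1 ha with ha | ha
    · exact h.sub a ha
    · rwa [List.mem_singleton.1 ha]
  have hcard : dl.length + 1 ≤ I.adom.card := by
    have := Finset.card_le_card fun a ha => hsub a (List.mem_toFinset.1 ha)
    rw [List.toFinset_card_of_nodup hnd, List.length_append] at this
    exact this
  have hroom := h.room
  have htab : ∀ k < S.numEDB, tables I (dl ++ [x]) k = tables I dl k := fun k hk => by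
    rw [tables_of_lt I _ hk, tables_of_lt I _ hk]
  have h2 : ∀ k, Function.update s.reg (8 * S.numEDB + 3) (dl.length + 1) (8 * k + 2) =
      s.reg (8 * k + 2) := fun k => Function.update_of_ne (by omega) _ _
  refine ⟨⟨?_, ?_, fun k hk => ?_, fun k hk => ?_, fun k hk => ?_, fun k hk => ?_⟩,
    fun k hk => ?_, ?_, hnd, hsub, h.out⟩
  · simp (disch := omega) only [Function.update_of_ne, h.ready.one]
  · simp (disch := omega) only [Function.update_of_ne, h.ready.zero]
  · rcases hk.lt_or_eq with hk' | rfl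
    · simp (disch := omega) only [Function.update_of_ne]
      rw [htab k hk', h.ready.len k hk]
    · rw [tables_numEDB]
      simp
  · rcases hk.lt_or_eq with hk' | rfl
    · rw [htab k hk']; exact h.ready.len_lt k hk
    · rw [tables_numEDB, List.length_map, List.length_append, List.length_singleton]
      omega
  · dsimp only
    rw [h2]
    rcases hk.lt_or_eq with hk' | rfl
    · rw [htab k hk']
      have := h.below k hk'
      exact (h.ready.mem k hk).congr fun i _ hi => Function.update_of_ne (by omega) _ _
    · have := h.ready.mem _ le_rfl
      rw [tables_numEDB, flatten_map_singleton] at this ⊢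
      exact memAt_append.2 ⟨this.congr fun i _ hi => Function.update_of_ne (by omega) _ _,
        Function.update_self _ _ _, trivial⟩
  · dsimp only
    rw [h2]
    rcases hk.lt_or_eq with hk' | rfl
    · rw [htab k hk']; exact h.ready.mem_lt k hk
    · rw [tables_numEDB, flatten_map_singleton, List.length_append, List.length_singleton]
      omega
  · dsimp only
    rw [h2, h2, htab k hk]
    exact h.below k hk
  · dsimp only
    rw [h2]
    exact hroom

/-- Linear search is good enough: O(n) steps per input entry give O(m·n) in total. The memory below
the list is preserved, so the surrounding loop can go on reading the input. -/
theorem runs_insertCode {W : ℕ} (hW : 1 < W) {I : Database S} {dl : List ℕ} {s : State}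
    (h : Listing W I dl s) (hx : s.reg 68 ∈ I.adom) :
    Runs W (insertCode S.numEDB) s (6 * I.adom.card + 7) fun s' =>
      ∃ dl', Listing W I dl' s' ∧ dl'.toFinset = insert (s.reg 68) dl.toFinset ∧
        s'.reg 52 = s.reg 52 ∧ s'.reg 60 = s.reg 60 ∧
        s'.reg (8 * S.numEDB + 2) = s.reg (8 * S.numEDB + 2) ∧
        ∀ i < s.reg (8 * S.numEDB + 2), s'.mem i = s.mem i := by
  have hlen := h.ready.len _ le_rfl
  have hmem := h.ready.mem _ le_rfl
  rw [tables_numEDB, List.length_map] at hlen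
  rw [tables_numEDB, flatten_map_singleton] at hmem
  have h4 := h.ready.one
  have h12 := h.ready.zero
  have hle := h.length_le
  have hroom := h.room
  have hcont : ∀ s₁ : State, Frame (fun r => r ≠ 76 ∧ r ≠ 84 ∧ r ≠ 92) s s₁ → s₁.out = s.out →
      s₁.reg 76 = s.reg (8 * S.numEDB + 2) → s₁.reg 84 = s.reg (8 * S.numEDB + 2) + dl.length →
      s₁.reg 92 = 0 → Runs W (.seq searchCode (.branch 92 4
        (.seq (.store 84 68) (.op .add (8 * S.numEDB + 3) (8 * S.numEDB + 3) 4)) skipCmd)) s₁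
        ((6 * dl.length + 1) + (1 + 1 + 1)) fun s' =>
        ∃ dl', Listing W I dl' s' ∧ dl'.toFinset = insert (s.reg 68) dl.toFinset ∧
          s'.reg 52 = s.reg 52 ∧ s'.reg 60 = s.reg 60 ∧
          s'.reg (8 * S.numEDB + 2) = s.reg (8 * S.numEDB + 2) ∧
          ∀ i < s.reg (8 * S.numEDB + 2), s'.mem i = s.mem i := by
    intro s₁ hf₁ ho₁ e76 e84 e92
    refine .seq ((runs_searchCode hW dl s₁ ?_ ?_ ?_ ?_).mono le_rfl ?_)
    · rw [hf₁.reg 4 (by decide), h4]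
    · rw [e76, hf₁.mem]; exact hmem
    · rw [e76, e84]
    · rw [e84]; omega
    rintro s₂ ⟨hf₂, ho₂, h92⟩
    rw [hf₁.reg 68 (by decide), e92] at h92
    have hf : Frame (fun r => r ≠ 20 ∧ r ≠ 76 ∧ r ≠ 84 ∧ r ≠ 92 ∧ r ≠ 100) s s₂ :=
      (hf₁.mono fun r hr => ⟨hr.2.1, hr.2.2.1, hr.2.2.2.1⟩).trans
        (hf₂.mono fun r hr => ⟨hr.1, hr.2.1, hr.2.2.2⟩)
    have hs₂ : Listing W I dl s₂ := h.of_eq (hf.mono fun r hr => by omega) (ho₂.trans ho₁)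
    have f4 : s₂.reg 4 = 1 := hs₂.ready.one
    have fE3 := hf.reg (8 * S.numEDB + 3) (by omega)
    have fE2 := hf.reg (8 * S.numEDB + 2) (by omega)
    have f84 : s₂.reg 84 = s.reg (8 * S.numEDB + 2) + dl.length :=
      (hf₂.reg 84 (by decide)).trans e84
    have f68 := hf.reg 68 (by decide)
    have f52 := hf.reg 52 (by decide)
    have f60 := hf.reg 60 (by decide)
    refine .branch (fun hlt => ?_) fun hlt => ?_
    · rw [h92, f4] at hlt
      have hxdl : s.reg 68 ∉ dl := fun hx => by simp [hx] at hlt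
      have hlen' := (hs₂.append hxdl hx).length_le
      rw [List.length_append, List.length_singleton] at hlen'
      refine .seq (.store (.add ?_ ⟨dl ++ [s.reg 68], ?_, ?_, ?_, ?_, ?_, fun i hi => ?_⟩))
      · dsimp only; omega
      · have := hs₂.append hxdl hx
        dsimp only
        rwa [fE3, hlen, f84, f4, f68, ← fE2]
      · ext a; simp [or_comm]
      · simp (disch := omega) only [Function.update_of_ne, f52]
      · simp (disch := omega) only [Function.update_of_ne, f60]
      · simp (disch := omega) only [Function.update_of_ne, fE2]
      · simp (disch := omega) only [Function.update_of_ne, hf.mem]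
    · rw [h92, f4] at hlt
      have hxdl : s.reg 68 ∈ dl := by
        by_contra hx
        simp [hx] at hlt
      refine Runs.mono (b := 1) (.const (by omega) ⟨dl, hs₂.of_eq ⟨rfl, fun r hr => ?_⟩ rfl,
        (Finset.insert_eq_of_mem (List.mem_toFinset.2 hxdl)).symm, ?_, ?_, ?_, fun i hi => ?_⟩)
        (by omega) fun _ h => h
      · simp (disch := omega) only [Function.update_of_ne]
      · simp (disch := omega) only [Function.update_of_ne, f52]
      · simp (disch := omega) only [Function.update_of_ne, f60]
      · simp (disch := omega) only [Function.update_of_ne, fE2]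
      · simp only [hf.mem]
  refine Runs.mono (b := 1 + (1 + (1 + ((6 * dl.length + 1) + (1 + 1 + 1))))) (.seq (.add ?_ (.seq
    (.add ?_ (.seq (.const (by omega) (hcont _ ⟨?_, fun r hr => ?_⟩ ?_ ?_ ?_ ?_))))))) (by omega)
    fun _ h => h
  all_goals try rfl
  all_goals simp (disch := omega) only [Function.update_of_ne, Function.update_self, h12, hlen,
    add_zero]
  all_goals omega

/-- Insert the constants between the addresses in the registers `52` and `60`. -/
def insertLoop (E : ℕ) : Cmd :=
  .loop 52 60 (.seq (.load 68 52) (.seq (insertCode E) (.op .add 52 52 4)))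

theorem runs_insertLoop {W : ℕ} (hW : 1 < W) {I : Database S} (l : List ℕ) {dl : List ℕ} {s : State}
    (h : Listing W I dl s) (hl : ∀ a ∈ l, a ∈ I.adom) (hmem : MemAt s.mem (s.reg 52) l)
    (hend : s.reg 60 = s.reg 52 + l.length) (hle : s.reg 60 ≤ s.reg (8 * S.numEDB + 2)) :
    Runs W (insertLoop S.numEDB) s (l.length * (6 * I.adom.card + 10) + 1) fun s' =>
      ∃ dl', Listing W I dl' s' ∧ dl'.toFinset = dl.toFinset ∪ l.toFinset := by
  induction l generalizing dl s with
  | nil =>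
    refine Runs.mono (b := 1) (.loop_done ?_ ⟨dl, h, by simp⟩) (by omega) fun _ h => h
    simpa using hend.le
  | cons a l ih =>
    rw [List.length_cons] at hend
    have hroom := h.room
    have hcont : ∀ s₁ : State, Frame (· ≠ 68) s s₁ → s₁.out = s.out → s₁.reg 68 = a →
        Runs W (.seq (insertCode S.numEDB) (.op .add 52 52 4)) s₁ ((6 * I.adom.card + 7) + 1)
          fun s₂ => Runs W (insertLoop S.numEDB) s₂ (l.length * (6 * I.adom.card + 10) + 1)
          fun s' => ∃ dl', Listing W I dl' s' ∧ dl'.toFinset = dl.toFinset ∪ (a :: l).toFinset := by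
      intro s₁ hf ho h68
      refine .seq ((runs_insertCode hW (h.of_eq (hf.mono fun r hr => by omega) ho)
        (by rw [h68]; exact hl a (by simp))).mono le_rfl ?_)
      rintro s₂ ⟨dl₂, h₂, hdl₂, e52, e60, eE, em⟩
      rw [hf.reg _ (by decide)] at e52 e60
      rw [hf.reg _ (by omega)] at eE em
      refine .add (by rw [e52, h₂.ready.one]; omega) ?_
      rw [e52, h₂.ready.one]
      refine (ih (dl := dl₂) (h₂.of_eq ⟨?_, fun r hr => ?_⟩ ?_)
        (fun b hb => hl b (List.mem_cons_of_mem _ hb)) ?_ ?_ ?_).mono le_rfl ?_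
      · rfl
      · simp (disch := omega) only [Function.update_of_ne]
      · rfl
      · simp only [Function.update_self]
        exact hmem.2.congr fun i _ hi => by rw [em i (by omega), hf.mem]
      · simp (disch := omega) only [Function.update_self, Function.update_of_ne, e60]
        omega
      · simp (disch := omega) only [Function.update_of_ne, e60, eE]
        exact hle
      · rintro s' ⟨dl', h', hdl'⟩
        refine ⟨dl', h', ?_⟩
        rw [hdl', hdl₂, h68]
        ext b
        simp
    refine Runs.mono (b := (1 + ((6 * I.adom.card + 7) + 1)) +
      (l.length * (6 * I.adom.card + 10) + 1) + 1) (.loop_step (by omega)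
      (.seq (.load (hcont _ ⟨?_, fun r hr => ?_⟩ ?_ ?_))))
      (by rw [List.length_cons, Nat.add_mul l.length 1]; omega) fun _ h => h
    · rfl
    · exact Function.update_of_ne hr _ _
    · rfl
    · simp only [Function.update_self]; exact hmem.1

/-- Insert the constants of the relations `Rs` into the list of constants. -/
def collectCode : List (Fin S.numEDB) → Cmd
  | [] => skipCmd
  | R :: Rs => .seq (.op .add 52 (8 * (R : ℕ) + 2) 12) (.seq (.const 60 (S.edbArity R))
      (.seq (.op .mul 60 (8 * (R : ℕ) + 3) 60) (.seq (.op .add 60 52 60)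
        (.seq (insertLoop S.numEDB) (collectCode Rs)))))

theorem flatten_tables (I : Database S) (dl : List ℕ) (R : Fin S.numEDB) :
    (tables I dl R).flatten = (I.rows R).flatMap fun t => List.ofFn t := by
  rw [tables_of_lt I dl R.2, List.flatMap]

theorem runs_collectCode {W : ℕ} (hW : 1 < W) {I : Database S} (har : ∀ R, S.edbArity R < W)
    (Rs : List (Fin S.numEDB)) {dl : List ℕ} {s : State} (h : Listing W I dl s) :
    Runs W (collectCode Rs) s ((Rs.flatMap fun R => (I.rows R).flatMap fun t =>
      List.ofFn t).length * (6 * I.adom.card + 10) + 5 * Rs.length + 1) fun s' =>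
      ∃ dl', Listing W I dl' s' ∧ dl'.toFinset = dl.toFinset ∪
        (Rs.flatMap fun R => (I.rows R).flatMap fun t => List.ofFn t).toFinset := by
  induction Rs generalizing dl s with
  | nil =>
    refine Runs.mono (b := 1) (.const (by omega) ⟨dl, h.of_eq ⟨rfl, fun r hr => ?_⟩ rfl, by simp⟩)
      (by omega) fun _ h => h
    exact Function.update_of_ne (by omega) _ _
  | cons R Rs ih =>
    have hlen := length_cells (I.rows R)
    have h12 := h.ready.zero
    have h3 : s.reg (8 * (R : ℕ) + 3) = (I.rows R).length := by
      rw [h.ready.len R R.2.le, tables_of_lt I dl R.2, List.length_map]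
    have hbelow := h.below R R.2
    have hroom := h.room
    have hmem := h.ready.mem R R.2.le
    rw [flatten_tables] at hbelow hmem
    have hcont : ∀ s₁ : State, Frame (fun r => r ≠ 52 ∧ r ≠ 60) s s₁ → s₁.out = s.out →
        s₁.reg 52 = s.reg (8 * (R : ℕ) + 2) → s₁.reg 60 = s.reg (8 * (R : ℕ) + 2) +
          ((I.rows R).flatMap fun t => List.ofFn t).length →
        Runs W (.seq (insertLoop S.numEDB) (collectCode Rs)) s₁
          ((((I.rows R).flatMap fun t => List.ofFn t).length * (6 * I.adom.card + 10) + 1) +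
          ((Rs.flatMap fun R => (I.rows R).flatMap fun t => List.ofFn t).length *
            (6 * I.adom.card + 10) + 5 * Rs.length + 1)) fun s' =>
          ∃ dl', Listing W I dl' s' ∧ dl'.toFinset = dl.toFinset ∪
            ((R :: Rs).flatMap fun R => (I.rows R).flatMap fun t => List.ofFn t).toFinset := by
      intro s₁ hf ho e52 e60
      refine .seq ((runs_insertLoop hW ((I.rows R).flatMap fun t => List.ofFn t) (dl := dl)
        (h.of_eq (hf.mono fun r hr => by omega) ho) ?_ ?_ ?_ ?_).mono le_rfl ?_)
      · intro a ha
        obtain ⟨t, ht, ha⟩ := List.mem_flatMap.1 ha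
        obtain ⟨i, rfl⟩ := (List.mem_ofFn' _ _).1 ha
        exact mem_adom.2 ⟨R, t, ht, i, rfl⟩
      · rw [e52, hf.mem]; exact hmem
      · rw [e52, e60]
      · rw [e60, hf.reg _ (by omega)]; exact hbelow
      · rintro s₂ ⟨dl₂, h₂, hdl₂⟩
        refine (ih h₂).mono le_rfl ?_
        rintro s' ⟨dl', h', hdl'⟩
        refine ⟨dl', h', ?_⟩
        rw [hdl', hdl₂, List.flatMap_cons, List.toFinset_append, Finset.union_assoc]
    refine Runs.mono (b := 1 + (1 + (1 + (1 +
      ((((I.rows R).flatMap fun t => List.ofFn t).length * (6 * I.adom.card + 10) + 1) +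
          ((Rs.flatMap fun R => (I.rows R).flatMap fun t => List.ofFn t).length *
            (6 * I.adom.card + 10) + 5 * Rs.length + 1)))))) (.seq (.add ?_ (.seq
      (.const (har R) (.seq (.mul ?_ (.seq (.add ?_ (hcont _ ⟨?_, fun r hr => ?_⟩ ?_ ?_ ?_)))))))))
      ?_ fun _ h => h
    all_goals try rfl
    all_goals try simp (disch := omega) only [Function.update_of_ne, Function.update_self, h12, h3,
      add_zero]
    · omega
    · omega
    · omega
    · rw [hlen]
    · rw [List.flatMap_cons, List.length_append, List.length_cons, Nat.add_mul
        ((I.rows R).flatMap fun t => List.ofFn t).length]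
      omega

theorem memAt_getD (l : List ℕ) {l' : List ℕ} :
    MemAt (fun i => (l' ++ l).getD i 0) l'.length l := by
  induction l generalizing l' with
  | nil => trivial
  | cons a l ih =>
    refine ⟨by simp, ?_⟩
    have := ih (l' := l' ++ [a])
    rw [List.append_assoc, List.length_append] at this
    exact this

/-- Locate the relations and list the constants. -/
def prepareCode (S : Schema) : Cmd :=
  .seq (.const 4 1) (.seq (locateCode (List.finRange S.numEDB))
    (.seq (.op .add (8 * S.numEDB + 2) 44 12) (collectCode (List.finRange S.numEDB))))

/-- The number of entries of the stored tuples. -/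
def Database.numCells (I : Database S) : ℕ := ∑ R, (I.rows R).length * S.edbArity R

theorem length_flatMap_finRange {n : ℕ} (f : Fin n → List ℕ) :
    ((List.finRange n).flatMap f).length = ∑ i, (f i).length := by
  rw [List.length_flatMap, ← List.ofFn_eq_map, List.sum_ofFn]

theorem length_encode (I : Database S) : I.encode.length = S.numEDB + I.numCells := by
  rw [Database.encode, length_flatMap_finRange, Database.numCells]
  simp only [List.length_cons, length_cells, Finset.sum_add_distrib]
  simp [add_comm]

theorem runs_prepareCode {W : ℕ} (hW : 1 < W) (I : Database S) (har : ∀ R, S.edbArity R < W)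
    (hlt : I.encode.length + I.adom.card < W) (hrows : ∀ R, (I.rows R).length < W) :
    Runs W (prepareCode S) (State.init I.encode)
      (I.numCells * (6 * I.adom.card + 10) + 10 * S.numEDB + 4) fun s' =>
      ∃ dl, Listing W I dl s' ∧ dl.toFinset = I.adom := by
  have hcells : ((List.finRange S.numEDB).flatMap fun R => (I.rows R).flatMap fun t =>
      List.ofFn t).length = I.numCells := by
    rw [length_flatMap_finRange, Database.numCells]
    simp only [length_cells]
  refine Runs.mono (b := 1 + ((5 * (List.finRange S.numEDB).length + 1) + (1 +
    (((List.finRange S.numEDB).flatMap fun R => (I.rows R).flatMap fun t =>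
      List.ofFn t).length * (6 * I.adom.card + 10) + 5 * (List.finRange S.numEDB).length + 1))))
    (.seq (.const hW (.seq ((runs_locateCode I (List.finRange S.numEDB) (List.nodup_finRange _) har
      _ (by simp) ?_ ?_).mono le_rfl ?_)))) (by rw [hcells, List.length_finRange]; omega)
      fun _ h => h
  · exact memAt_getD I.encode (l' := [])
  · change 0 + I.encode.length < W
    omega
  rintro s₁ ⟨hf, ho, h44, hR⟩
  replace h44 : s₁.reg 44 = I.encode.length := h44.trans (zero_add _)
  have hne : ∀ R : Fin S.numEDB, (R : ℕ) ≠ S.numEDB := fun R => R.2.ne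
  have h12 : s₁.reg 12 = 0 := hf.reg 12 ⟨by omega, by omega, by omega, fun R _ => by omega⟩
  have h4 : s₁.reg 4 = 1 := hf.reg 4 ⟨by omega, by omega, by omega, fun R _ => by omega⟩
  -- The length register of the list of constants has not been written yet; its initial value `0`
  -- stands for the empty list.
  have hE3 : s₁.reg (8 * S.numEDB + 3) = 0 :=
    (hf.reg _ ⟨by omega, by omega, by omega, fun R _ => by have := hne R; omega⟩).trans
      (Function.update_of_ne (by omega) _ _)
  refine .seq (.add (by omega) ?_)
  rw [h44, h12, add_zero]
  refine (runs_collectCode hW har _ (dl := []) ⟨⟨?_, ?_, fun k hk => ?_, fun k hk => ?_,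
    fun k hk => ?_, fun k hk => ?_⟩, fun k hk => ?_, ?_, List.nodup_nil, by simp, ?_⟩).mono
      le_rfl ?_
  · simp (disch := omega) only [Function.update_of_ne, h4]
  · simp (disch := omega) only [Function.update_of_ne, h12]
  · simp (disch := omega) only [Function.update_of_ne]
    rcases hk.lt_or_eq with hk' | rfl
    · rw [tables_of_lt I _ hk', List.length_map]
      exact (hR ⟨k, hk'⟩ (List.mem_finRange _)).1
    · rw [tables_numEDB, hE3]; rfl
  · rcases hk.lt_or_eq with hk' | rfl
    · rw [tables_of_lt I _ hk', List.length_map]; exact hrows _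
    · rw [tables_numEDB]; exact (Nat.zero_lt_one.trans hW)
  · rcases hk.lt_or_eq with hk' | rfl
    · simp (disch := omega) only [Function.update_of_ne]
      rw [flatten_tables I [] ⟨k, hk'⟩, hf.mem]
      exact (hR ⟨k, hk'⟩ (List.mem_finRange _)).2.1
    · rw [tables_numEDB]; trivial
  · rcases hk.lt_or_eq with hk' | rfl
    · simp (disch := omega) only [Function.update_of_ne]
      rw [flatten_tables I [] ⟨k, hk'⟩]
      have := (hR ⟨k, hk'⟩ (List.mem_finRange _)).2.2
      dsimp only at this
      omega
    · rw [tables_numEDB]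
      simp only [Function.update_self, List.map_nil, List.flatten_nil, List.length_nil]
      omega
  · simp (disch := omega) only [Function.update_of_ne, Function.update_self]
    rw [flatten_tables I [] ⟨k, hk⟩, ← h44]
    exact (hR ⟨k, hk⟩ (List.mem_finRange _)).2.2
  · simp only [Function.update_self]
    exact hlt
  · exact ho
  · rintro s' ⟨dl, h, hdl⟩
    refine ⟨dl, h, hdl.trans ?_⟩
    ext a
    simp [mem_adom]

/-! ### Bounds in terms of m·n + 1, and the word length -/

theorem Database.length_rows_le (I : Database S) (R : Fin S.numEDB) :
    (I.rows R).length ≤ I.size :=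
  Finset.single_le_sum (f := fun R => (I.rows R).length) (fun _ _ => Nat.zero_le _)
    (Finset.mem_univ R)

theorem edbArity_le_sum (S : Schema) (R : Fin S.numEDB) : S.edbArity R ≤ ∑ R, S.edbArity R :=
  Finset.single_le_sum (fun _ _ => Nat.zero_le _) (Finset.mem_univ R)

theorem Database.numCells_le (I : Database S) : I.numCells ≤ (∑ R, S.edbArity R) * I.size := by
  rw [Database.numCells, Database.size, mul_comm, Finset.sum_mul]
  exact Finset.sum_le_sum fun R _ => Nat.mul_le_mul_left _ (edbArity_le_sum S R)

theorem Database.card_adom_le (I : Database S) : I.adom.card ≤ I.numCells := by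
  have h : I.adom = ((List.finRange S.numEDB).flatMap fun R => (I.rows R).flatMap fun t =>
      List.ofFn t).toFinset := by
    ext a
    simp [mem_adom]
  rw [h]
  refine (List.toFinset_card_le _).trans_eq ?_
  rw [length_flatMap_finRange, Database.numCells]
  simp only [length_cells]

/-- If a constant occurs, then m ≤ m·n. If none occurs, any two rows of a relation are equal, so
there are at most as many tuples as relations; the summand 1 on the right is for this case. -/
theorem Database.size_le (I : Database S) :
    I.size ≤ (S.numEDB + 1) * (I.size * I.adom.card + 1) := by
  rcases Nat.eq_zero_or_pos I.adom.card with h | h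
  · have h1 : I.size ≤ ∑ _R : Fin S.numEDB, 1 := by
      refine Finset.sum_le_sum fun R _ => ?_
      have hsub : ∀ t ∈ I.rows R, ∀ t' ∈ I.rows R, t = t' := by
        intro t ht t' _
        funext i
        have : t i ∈ I.adom := mem_adom.2 ⟨R, t, ht, i, rfl⟩
        rw [Finset.card_eq_zero.1 h] at this
        simp at this
      rw [← List.toFinset_card_of_nodup (I.nodup R), Finset.card_le_one]
      exact fun a ha b hb => hsub a (List.mem_toFinset.1 ha) b (List.mem_toFinset.1 hb)
    rw [h]
    simp only [Finset.sum_const, Finset.card_univ, Fintype.card_fin, smul_eq_mul, mul_one] at h1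
    omega
  · have h1 : I.size ≤ I.size * I.adom.card := Nat.le_mul_of_pos_right _ h
    calc I.size ≤ 1 * (I.size * I.adom.card + 1) := by omega
      _ ≤ _ := Nat.mul_le_mul_right _ (by omega)

/-- Every table, including the list of constants, has O(m) rows, since each constant occupies an
entry of a stored tuple. This is also why a bag of two free variables costs only O(m·n). -/
theorem tables_bounds (I : Database S) {dl : List ℕ} (hdl : dl.length = I.adom.card) {k : ℕ}
    (hk : k ≤ S.numEDB) :
    (tables I dl k).length ≤
        (S.numEDB + 1) * ((∑ R, S.edbArity R) + 1) * (I.size * I.adom.card + 1) ∧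
      (tables I dl k).length * (tables I dl S.numEDB).length ≤
        (S.numEDB + 1) * ((∑ R, S.edbArity R) + 1) * (I.size * I.adom.card + 1) := by
  have h1 := I.size_le
  have h2 := I.card_adom_le.trans I.numCells_le
  set A := ∑ R, S.edbArity R
  set n := I.adom.card
  set m := I.size
  set E := S.numEDB
  have hl : (tables I dl k).length ≤ (A + 1) * m := by
    rcases hk.lt_or_eq with hk' | rfl
    · rw [tables_of_lt I dl hk', List.length_map, add_mul, one_mul]
      exact (I.length_rows_le _).trans (Nat.le_add_left _ _)
    · rw [tables_numEDB, List.length_map, hdl, add_mul]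
      omega
  constructor
  · calc _ ≤ (A + 1) * m := hl
      _ ≤ (A + 1) * ((E + 1) * (m * n + 1)) := Nat.mul_le_mul_left _ h1
      _ = _ := by ring
  · rw [tables_numEDB, List.length_map, hdl]
    calc _ ≤ (A + 1) * m * n := Nat.mul_le_mul_right _ hl
      _ = 1 * (A + 1) * (m * n) := by ring
      _ ≤ _ := Nat.mul_le_mul (Nat.mul_le_mul_right _ (by omega)) (by omega)

/-- One factor m + 2 absorbs the input size, and b further factors absorb the constant, as b < 2^b ≤
(m + 2)^b. -/
theorem lt_wordBound {k b m : ℕ} (h : b + 1 ≤ k) : (m + 2) * b < wordBound k m := by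
  have h1 : m + 2 ≤ 2 ^ Nat.clog 2 (m + 2) := Nat.le_pow_clog (by norm_num) _
  rw [wordBound, mul_comm k, pow_mul]
  calc (m + 2) * b < (m + 2) * 2 ^ b := Nat.mul_lt_mul_of_pos_left Nat.lt_two_pow_self (by omega)
    _ ≤ (m + 2) * (m + 2) ^ b := Nat.mul_le_mul_left _ (Nat.pow_le_pow_left (by omega) b)
    _ = (m + 2) ^ (b + 1) := by ring
    _ ≤ (m + 2) ^ k := Nat.pow_le_pow_right (by omega) h
    _ ≤ _ := Nat.pow_le_pow_left h1 k

theorem exists_const_bound (Ts : List (Template S)) :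
    ∃ N, ∀ τ ∈ Ts, ∀ c, Tok.const c ∈ τ.toks → c < N := by
  induction Ts with
  | nil => exact ⟨0, by simp⟩
  | cons τ Ts ih =>
    obtain ⟨N, hN⟩ := ih
    obtain ⟨N', hN'⟩ := exists_const_lt τ.toks
    refine ⟨N + N', fun τ' h c hc => ?_⟩
    rcases List.mem_cons.1 h with rfl | h
    · exact (hN' c hc).trans_le (Nat.le_add_left _ _)
    · exact (hN τ' h c hc).trans_le (Nat.le_add_right _ _)

end DatalogGrounding

theorem mainTheorem6 (P : DatalogGrounding.Program)
    (hlin : P.IsLinear) (hacyc : P.IsRulewiseAcyclic) (harity : P.arity ≤ 2) (κ : ℕ) :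
    ∃ (c : DatalogGrounding.Cmd) (k C : ℕ), κ ≤ k ∧
      ∀ I : DatalogGrounding.Database P.schema,
        (∀ a ∈ I.adom, a < DatalogGrounding.wordBound κ I.size) →
        ∃ (G : DatalogGrounding.Grounding P.schema) (s : DatalogGrounding.State) (t : ℕ),
          DatalogGrounding.Exec (DatalogGrounding.wordBound k I.size) c
            (DatalogGrounding.State.init I.encode) s t ∧
          s.out = G.encode ∧
          t ≤ C * (I.size * I.adom.card + 1) ∧
          G.size ≤ C * (I.size * I.adom.card + 1) ∧
          ∀ (D : Type*) [CommSemiring D] [PartialOrder D]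
            [DatalogGrounding.OmegaContinuousSemiring D],
            G.IsEquivalent (I := I) D := by
  obtain ⟨Ts, hwf, heq⟩ := P.exists_templates hlin hacyc harity
  obtain ⟨N, hN⟩ := DatalogGrounding.exists_const_bound Ts
  set A := ∑ R, P.schema.edbArity R with hA
  set E := P.schema.numEDB
  obtain ⟨C, hC⟩ := DatalogGrounding.exists_templates_bound hwf ((E + 1) * (A + 1))
  refine ⟨.seq (DatalogGrounding.prepareCode P.schema) (DatalogGrounding.templatesCode Ts),
    -- The first witness makes words large enough for the input (at most E + A·m words), the list of
    -- constants (at most A·m words), the arities and the constants below `N` in the code. In the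
    -- second, `C` pays for the templates and the rest for the preprocessing; `10 * A * (E + 1)`
    -- comes from bounding 10·A·m by `Database.size_le`.
    κ + (E + 2 * A + N + 1) + 1, 6 * A + 10 * A * (E + 1) + 10 * E + 4 + C, by omega,
    fun I _ => ?_⟩
  set W := DatalogGrounding.wordBound (κ + (E + 2 * A + N + 1) + 1) I.size
  have hW : (I.size + 2) * (E + 2 * A + N + 1) < W := DatalogGrounding.lt_wordBound (by omega)
  have hWN : E + 2 * A + N + 1 + 2 * A * I.size + I.size < W := by
    refine lt_of_le_of_lt ?_ hW
    nlinarith [Nat.zero_le (I.size * (E + N))]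
  have hcells : I.numCells ≤ A * I.size := I.numCells_le
  have hcard := I.card_adom_le
  obtain ⟨s₁, t₁, he₁, ht₁, dl, hs₁, hdl⟩ := DatalogGrounding.runs_prepareCode (W := W)
    (by omega) I (fun R => lt_of_le_of_lt (DatalogGrounding.edbArity_le_sum _ R) (by omega))
    (by rw [DatalogGrounding.length_encode]; nlinarith)
    (fun R => lt_of_le_of_lt (I.length_rows_le R) (by omega))
  obtain ⟨s₂, t₂, he₂, ht₂, ho₂⟩ := DatalogGrounding.runs_templatesCode (by omega) hwf
    (fun τ hτ c hc => (hN τ hτ c hc).trans (by omega)) s₁ hs₁.ready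
  have hlen : dl.length = I.adom.card := by
    rw [← hdl, List.toFinset_card_of_nodup hs₁.nodup]
  obtain ⟨hcost, hsize⟩ := hC (DatalogGrounding.tables I dl) (I.size * I.adom.card + 1) (by omega)
    (fun k hk => (DatalogGrounding.tables_bounds I hlen hk).1)
    (fun k hk => (DatalogGrounding.tables_bounds I hlen hk).2)
  refine ⟨_, s₂, _, .seq he₁ he₂, by rw [ho₂, hs₁.out, List.nil_append], ?_,
    hsize.trans (Nat.mul_le_mul_right _ (by omega)), fun D => heq I dl hs₁.nodup hdl D⟩
  have h1 : I.numCells * (6 * I.adom.card + 10) ≤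
      6 * A * (I.size * I.adom.card) + 10 * A * I.size :=
    (Nat.mul_le_mul_right _ hcells).trans_eq (by ring)
  have h2 := Nat.mul_le_mul_left (10 * A) I.size_le
  nlinarith [Nat.zero_le (E * (I.size * I.adom.card)), Nat.zero_le (I.size * I.adom.card)]
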